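/- **Setting.** Let $l_n(x)=L_n(x)e^{-x/2}$ ($n\in\mathbb N_0$, $x\ge 0$) be the Laguerre functions and $h_n$ ($n\in\mathbb N_0^d$) the Hermite functions on $\mathbb R^d$, $|n|=n_1+\dots+n_d$. For $\alpha>0$, $\mathcal G_\alpha(\mathbb R_+)$ (Roumieu case), resp. $\mathcal G_{0,\alpha}(\mathbb R_+)$ (Beurling case), is the space of functions $\sum_n a_nl_n$ with $\sup_n|a_n|e^{h n^{1/\alpha}}<\infty$ for some, resp. for every, $h>0$; $\mathcal H_{\alpha/2}(\mathbb R^d)$, resp. $\mathcal H_{0,\alpha/2}(\mathbb R^d)$, is the space of functions $\sum_n a_nh_n$ with $\sup_n|a_n|e^{h|n|^{1/\alpha}}<\infty$ for some, resp. for every, $h>0$. They carry the inductive, resp. projective, limit topologies of the corresponding norms; a prime denotes the dual space. $\mathcal G_0'(\mathbb R_+)$ and $\mathcal H_0'(\mathbb R^d)$ denote the spaces of all formal Laguerre, resp. Hermite, series, i.e. the duals of the spaces of finite sums. The subscript "even" denotes the functions invariant under all sign changes of coordinates; on $\mathbb R$ its dual is $\mathcal H'_{\alpha/2,even}(\mathbb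 R)$, and an ultradistribution on $\mathbb R^2$ is even (radial) if it is invariant under all sign changes of coordinates (under $O(2)$). Put $(\mathcal J\psi)(x)=\psi(\sqrt x)$, $x\ge0$, and $(\Phi\psi)(x)=\psi(|x|)$, $x\in\mathbb R^2$, for even test functions $\psi$ on $\mathbb R$, and let $\langle \mathcal J'u,\psi\rangle=\langle u,\mathcal J\psi\rangle$, $\langle \Phi'w,\psi\rangle=\langle w,\Phi\psi\rangle$ be the transposes. Let $$E_{\rho,c}=-\rho\Big(x\frac{d^2}{dx^2}+\frac{d}{dx}-\frac x4+\frac12\Big)+c\ \text{ on } \mathbb R_+,\qquad H_{z,b}=z(-\Delta+|x|^2)+b\ \text{ on } \mathbb R^2 .$$ Solutions are understood in the sense of ultradistributions: $u(t,\cdot)$, $t\in[0,T]$, solves $i\partial_tu-E_{\rho,c}u=0$, $u(0,\cdot)=f$, if $i\frac{d}{dt}\langle u(t,\cdot),\varphi\rangle=\langle u(t,\cdot),E_{\rho,c}\varphi\rangle$ on $[0,T]$ for every test function $\varphi$ and $u(0,\cdot)=f$; similarly for $H_{z,b}$. **Proposition.** Let $\alpha>0$, $T>0$, $\rho\in\mathbb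 C\setminus\{0\}$, $c\in\mathbb C$. Consider families $u(t,\cdot)$ in $\mathcal G'_\alpha(\mathbb R_+)$ and $w(t,\cdot)$ in $\mathcal H'_{\alpha/2}(\mathbb R^2)$ or, more generally, families of formal series, $u(t,\cdot)\in\mathcal G_0'(\mathbb R_+)$ and $w(t,\cdot)\in\mathcal H_0'(\mathbb R^2)$. On each of these spaces, for every $u$ there is exactly one radial $w$ with $\Phi'w=\mathcal J'u$, written $w=(\mathcal J'\circ(\Phi')^{-1})u$; and for every $w$ there is exactly one $u$ with $\mathcal J'u=\Phi'w$, written $u=(\Phi'\circ(\mathcal J')^{-1})w$. (i) If $u(t,\cdot)$ solves $$i\partial_tu-E_{\rho,c}u=0,\quad t\in[0,T],\qquad u(0,\cdot)=f\in\mathcal G'_\alpha(\mathbb R_+),$$ then $w(t,\cdot)=(\mathcal J'\circ(\Phi')^{-1})u(t,\cdot)$ is even for every $t\in[0,T]$ and solves $$i\partial_tw-H_{\frac\rho4,\,c-\frac\rho2}\,w=0,\quad t\in[0,T],\qquad w(0,\cdot)=(\mathcal J'\circ(\Phi')^{-1})f\in\mathcal H'_{\alpha/2,even}(\mathbb R^2).$$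 (ii) Conversely, if $w(t,\cdot)$ solves $$i\partial_tw-H_{\rho,c}\,w=0,\quad t\in[0,T],\qquad w(0,\cdot)=g\in\mathcal H'_{\alpha/2,even}(\mathbb R^2),$$ then $u(t,\cdot)=(\Phi'\circ(\mathcal J')^{-1})w(t,\cdot)$ solves $$i\partial_tu-E_{4\rho,\,c+2\rho}\,u=0,\quad t\in[0,T],\qquad u(0,\cdot)=(\Phi'\circ(\mathcal J')^{-1})g\in\mathcal G'_\alpha(\mathbb R_+).$$ The same holds in the Beurling case, with $\mathcal G'_{0,\alpha}(\mathbb R_+)$, $\mathcal H'_{0,\alpha/2}(\mathbb R^2)$ and $\mathcal H'_{0,\alpha/2,even}(\mathbb R^2)$ in place of $\mathcal G'_\alpha(\mathbb R_+)$, $\mathcal H'_{\alpha/2}(\mathbb R^2)$ and $\mathcal H'_{\alpha/2,even}(\mathbb R^2)$. -/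

import Mathlib

open scoped NNReal

noncomputable section

namespace LaguerreHermite

/-! ### Laguerre and Hermite functions -/

/-- The Laguerre polynomial `L_n(x) = ∑_{k ≤ n} (-1)^k (n choose k) x^k / k!`. -/
def laguerrePoly (n : ℕ) (x : ℝ) : ℝ :=
  ∑ k ∈ Finset.range (n + 1), (-1) ^ k * (n.choose k : ℝ) * x ^ k / (k.factorial : ℝ)

/-- The Laguerre function `l_n(x) = L_n(x) e^{-x/2}` on `[0, ∞)`. -/
def laguerreFun (n : ℕ) (x : ℝ≥0) : ℝ :=
  laguerrePoly n x * Real.exp (-(x : ℝ) / 2)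

/-- The Hermite function `h_n(x) = (2^n n! √π)^{-1/2} e^{-x^2/2} H_n(x)`, where
`H_n(x) = 2^{n/2} He_n(√2 x)` is the physicists' Hermite polynomial and `He_n` is Mathlib's
(probabilists') Hermite polynomial; the two powers of `2` cancel. -/
def hermiteFun (n : ℕ) (x : ℝ) : ℝ :=
  (Real.sqrt ((n.factorial : ℝ) * Real.sqrt Real.pi))⁻¹ * Real.exp (-x ^ 2 / 2)
    * Polynomial.aeval (Real.sqrt 2 * x) (Polynomial.hermite n)

/-- The Hermite functions on `ℝ^d`, as tensor products. -/
def hermiteFunD (d : ℕ) (n : Fin d → ℕ) (x : EuclideanSpace ℝ (Fin d)) : ℝ :=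
  ∏ i, hermiteFun (n i) (x i)

/-! ### Test spaces given by series expansions, and their duals

Everything is parametrised by an index set `ι`, the length `deg n = |n|` of an index, and the
family `e : ι → X → ℝ` in which functions on `X` are expanded. -/

/-- The type of a space of series: `finite` (finite sums, dual: all formal series), and, for a
parameter `α`, the Roumieu and the Beurling type with weights `exp (h |n|^{1/α})`. -/
inductive Scale where
  | finite : Scale
  | roumieu (α : ℝ) : Scale
  | beurling (α : ℝ) : Scale

variable {ι X : Type*}

/-- `sup_n |a_n| exp (h |n|^{1/α}) ≤ M`. -/
def WeightBound (deg : ι → ℕ) (α h M : ℝ) (a : ι → ℂ) : Prop :=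
  ∀ n, ‖a n‖ * Real.exp (h * (deg n : ℝ) ^ (1 / α)) ≤ M

/-- The coefficient sequences of the test functions of a given type. -/
def Scale.Admissible (deg : ι → ℕ) : Scale → (ι → ℂ) → Prop
  | .finite, a => a.support.Finite
  | .roumieu α, a => ∃ h > 0, ∃ M, WeightBound deg α h M a
  | .beurling α, a => ∀ h > 0, ∃ M, WeightBound deg α h M a

/-- `f = ∑ a_n e_n` pointwise (unconditionally convergent). -/
def Expands (e : ι → X → ℝ) (a : ι → ℂ) (f : X → ℂ) : Prop :=
  ∀ x, HasSum (fun n => a n * (e n x : ℂ)) (f x)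

theorem WeightBound.mono {deg : ι → ℕ} {α h h' M : ℝ} {a : ι → ℂ} (hh : h' ≤ h)
    (H : WeightBound deg α h M a) : WeightBound deg α h' M a := fun n =>
  le_trans (mul_le_mul_of_nonneg_left (Real.exp_le_exp.2
    (mul_le_mul_of_nonneg_right hh (Real.rpow_nonneg (Nat.cast_nonneg _) _)))
    (norm_nonneg _)) (H n)

theorem WeightBound.add {deg : ι → ℕ} {α h M N : ℝ} {a b : ι → ℂ}
    (ha : WeightBound deg α h M a) (hb : WeightBound deg α h N b) :
    WeightBound deg α h (M + N) (a + b) := fun n => by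
  have h1 := ha n
  have h2 := hb n
  have h3 := mul_le_mul_of_nonneg_right (norm_add_le (a n) (b n))
    (Real.exp_pos (h * (deg n : ℝ) ^ (1 / α))).le
  rw [add_mul] at h3
  exact h3.trans (add_le_add h1 h2)

theorem WeightBound.smul {deg : ι → ℕ} {α h M : ℝ} {a : ι → ℂ} (c : ℂ)
    (ha : WeightBound deg α h M a) : WeightBound deg α h (‖c‖ * M) (c • a) := fun n => by
  have h1 := mul_le_mul_of_nonneg_left (ha n) (norm_nonneg c)
  rw [← mul_assoc] at h1
  simpa using h1

theorem WeightBound.zero (deg : ι → ℕ) (α h : ℝ) : WeightBound deg α h 0 (0 : ι → ℂ) :=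
  fun n => by simp

theorem Scale.Admissible.zero (K : Scale) (deg : ι → ℕ) : K.Admissible deg (0 : ι → ℂ) := by
  cases K with
  | finite => simp [Scale.Admissible]
  | roumieu α => exact ⟨1, one_pos, 0, WeightBound.zero _ _ _⟩
  | beurling α => exact fun h _ => ⟨0, WeightBound.zero _ _ _⟩

theorem Scale.Admissible.add {K : Scale} {deg : ι → ℕ} {a b : ι → ℂ}
    (ha : K.Admissible deg a) (hb : K.Admissible deg b) : K.Admissible deg (a + b) := by
  cases K with
  | finite => exact (Set.Finite.union ha hb).subset (Function.support_add a b)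
  | roumieu α =>
    obtain ⟨h, hh, M, hM⟩ := ha
    obtain ⟨k, hk, N, hN⟩ := hb
    exact ⟨min h k, lt_min hh hk, M + N,
      (hM.mono (min_le_left h k)).add (hN.mono (min_le_right h k))⟩
  | beurling α =>
    intro h hh
    obtain ⟨M, hM⟩ := ha h hh
    obtain ⟨N, hN⟩ := hb h hh
    exact ⟨M + N, hM.add hN⟩

theorem Scale.Admissible.smul {K : Scale} {deg : ι → ℕ} {a : ι → ℂ} (c : ℂ)
    (ha : K.Admissible deg a) : K.Admissible deg (c • a) := by
  cases K with
  | finite => exact Set.Finite.subset ha (Function.support_const_smul_subset c a)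
  | roumieu α =>
    obtain ⟨h, hh, M, hM⟩ := ha
    exact ⟨h, hh, ‖c‖ * M, hM.smul c⟩
  | beurling α =>
    intro h hh
    obtain ⟨M, hM⟩ := ha h hh
    exact ⟨‖c‖ * M, hM.smul c⟩

/-- The space of the functions `∑ a_n e_n` with coefficients of the given type. -/
def Scale.testSpace (K : Scale) (deg : ι → ℕ) (e : ι → X → ℝ) : Submodule ℂ (X → ℂ) where
  carrier := {f | ∃ a, K.Admissible deg a ∧ Expands e a f}
  zero_mem' := ⟨0, Scale.Admissible.zero K deg, fun x => by simp [hasSum_zero]⟩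
  add_mem' := by
    rintro f g ⟨a, ha, hf⟩ ⟨b, hb, hg⟩
    refine ⟨a + b, ha.add hb, fun x => ?_⟩
    simpa [add_mul] using (hf x).add (hg x)
  smul_mem' := by
    rintro c f ⟨a, ha, hf⟩
    refine ⟨c • a, ha.smul c, fun x => ?_⟩
    simpa [mul_assoc] using (hf x).mul_left c

/-- Continuity of a linear functional on a subspace `V` of a test space, with respect to
the norms `‖∑ a_n e_n‖_h = sup_n |a_n| exp (h |n|^{1/α})`: for the Roumieu type
(inductive limit as `h → 0`) the functional is bounded on each step; for the Beurling type
(projective limit as `h → ∞`) it is bounded with respect to one of the norms; on finite sums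
every linear functional is continuous. -/
def Scale.IsContinuous (deg : ι → ℕ) (e : ι → X → ℝ) (V : Submodule ℂ (X → ℂ))
    (u : V →ₗ[ℂ] ℂ) : Scale → Prop
  | .finite => True
  | .roumieu α => ∀ h > 0, ∃ C : ℝ, ∀ (f : V) (a : ι → ℂ) (M : ℝ),
      Expands e a f → WeightBound deg α h M a → ‖u f‖ ≤ C * M
  | .beurling α => ∃ h > 0, ∃ C : ℝ, ∀ (f : V) (a : ι → ℂ) (M : ℝ),
      Expands e a f → (Scale.beurling α).Admissible deg a → WeightBound deg α h M a →
        ‖u f‖ ≤ C * M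

/-! ### The spaces of the Laguerre and of the Hermite side -/

/-- Test functions on the half line: `𝒢_0`, `𝒢_α`, `𝒢_{0,α}`. Elements are functions on
`[0, ∞)`. -/
def LagTest (K : Scale) : Submodule ℂ (ℝ≥0 → ℂ) :=
  K.testSpace (fun n : ℕ => n) laguerreFun

/-- Ultradistributions on the half line: `𝒢'_0` (all formal series), `𝒢'_α`, `𝒢'_{0,α}`. -/
def LagDual (K : Scale) : Type :=
  {u : LagTest K →ₗ[ℂ] ℂ // K.IsContinuous (fun n : ℕ => n) laguerreFun (LagTest K) u}

/-- The length of a multi-index. -/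
def multiDeg (d : ℕ) (n : Fin d → ℕ) : ℕ := ∑ i, n i

/-- Test functions on `ℝ^d`: finite Hermite sums, `ℋ_{α/2}(ℝ^d)`, `ℋ_{0,α/2}(ℝ^d)` (the
coefficients are weighted with `exp (h |n|^{1/α})`). -/
def HermTest (K : Scale) (d : ℕ) : Submodule ℂ (EuclideanSpace ℝ (Fin d) → ℂ) :=
  K.testSpace (multiDeg d) (hermiteFunD d)

/-- Ultradistributions on `ℝ^d`: all formal Hermite series, `ℋ'_{α/2}(ℝ^d)`,
`ℋ'_{0,α/2}(ℝ^d)`. -/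
def HermDual (K : Scale) (d : ℕ) : Type :=
  {w : HermTest K d →ₗ[ℂ] ℂ // K.IsContinuous (multiDeg d) (hermiteFunD d) (HermTest K d) w}

/-- `(x_1, …, x_d) ↦ (ε_1 x_1, …, ε_d x_d)` with signs `ε_j = ±1`. -/
def signFlip {d : ℕ} (ε : Fin d → ℤˣ) (x : EuclideanSpace ℝ (Fin d)) :
    EuclideanSpace ℝ (Fin d) :=
  WithLp.toLp 2 (fun i => ((ε i : ℤ) : ℝ) * x i)

/-- Functions that are invariant under all sign changes of the coordinates. -/
def evenFun (d : ℕ) : Submodule ℂ (EuclideanSpace ℝ (Fin d) → ℂ) where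
  carrier := {f | ∀ (ε : Fin d → ℤˣ) x, f (signFlip ε x) = f x}
  zero_mem' := fun _ _ => rfl
  add_mem' := fun hf hg ε x => by simp [hf ε x, hg ε x]
  smul_mem' := fun c f hf ε x => by simp [hf ε x]

/-- The even test functions, `ℋ_{α/2,even}(ℝ^d)` and so on. -/
def HermEven (K : Scale) (d : ℕ) : Submodule ℂ (EuclideanSpace ℝ (Fin d) → ℂ) :=
  HermTest K d ⊓ evenFun d

/-- The dual of the space of even test functions. -/
def HermEvenDual (K : Scale) (d : ℕ) : Type :=
  {v : HermEven K d →ₗ[ℂ] ℂ //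
    K.IsContinuous (multiDeg d) (hermiteFunD d) (HermEven K d) v}

/-- `w` is even: `⟨w, φ ∘ ε⟩ = ⟨w, φ⟩` for all sign changes `ε`. -/
def HermDual.IsEven {K : Scale} {d : ℕ} (w : HermDual K d) : Prop :=
  ∀ (ε : Fin d → ℤˣ) (φ : HermTest K d),
    ∃ h : (fun x => φ.1 (signFlip ε x)) ∈ HermTest K d, w.1 ⟨_, h⟩ = w.1 φ

/-- `w` is radial: `⟨w, φ ∘ A⁻¹⟩ = ⟨w, φ⟩` for all `A ∈ O(d)`. -/
def HermDual.IsRadial {K : Scale} {d : ℕ} (w : HermDual K d) : Prop :=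
  ∀ (A : EuclideanSpace ℝ (Fin d) ≃ₗᵢ[ℝ] EuclideanSpace ℝ (Fin d)) (φ : HermTest K d),
    ∃ h : (fun x => φ.1 (A.symm x)) ∈ HermTest K d, w.1 ⟨_, h⟩ = w.1 φ

/-! ### The change of variables `𝒥`, the radial extension `Φ`, and their transposes -/

/-- `(𝒥 ψ)(x) = ψ(√x)`, `x ≥ 0`. -/
def mapJ (ψ : EuclideanSpace ℝ (Fin 1) → ℂ) : ℝ≥0 → ℂ :=
  fun x => ψ (WithLp.toLp 2 fun _ => Real.sqrt (x : ℝ))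

/-- `(Φ ψ)(x) = ψ(|x|)`, `x ∈ ℝ²`. -/
def mapPhi (ψ : EuclideanSpace ℝ (Fin 1) → ℂ) : EuclideanSpace ℝ (Fin 2) → ℂ :=
  fun x => ψ (WithLp.toLp 2 fun _ => ‖x‖)

/-- `v = 𝒥' u`: `𝒥 ψ` is a test function and `⟨v, ψ⟩ = ⟨u, 𝒥 ψ⟩`, for all even test
functions `ψ` on `ℝ`. -/
def IsTransposeJ {K : Scale} (u : LagDual K) (v : HermEvenDual K 1) : Prop :=
  ∀ ψ : HermEven K 1, ∃ h : mapJ ψ.1 ∈ LagTest K, v.1 ψ = u.1 ⟨_, h⟩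

/-- `v = Φ' w`: `Φ ψ` is a test function and `⟨v, ψ⟩ = ⟨w, Φ ψ⟩`, for all even test
functions `ψ` on `ℝ`. -/
def IsTransposePhi {K : Scale} (w : HermDual K 2) (v : HermEvenDual K 1) : Prop :=
  ∀ ψ : HermEven K 1, ∃ h : mapPhi ψ.1 ∈ HermTest K 2, v.1 ψ = w.1 ⟨_, h⟩

/-- `w` is the image of `u` under `𝒥'` followed by the inverse of `Φ'`, where `Φ'` is
considered on the radial ultradistributions: `w` is radial and `Φ' w = 𝒥' u`. -/
def IsForwardImage {K : Scale} (u : LagDual K) (w : HermDual K 2) : Prop :=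
  w.IsRadial ∧ ∃ v : HermEvenDual K 1, IsTransposeJ u v ∧ IsTransposePhi w v

/-- `u` is the image of `w` under `Φ'` followed by the inverse of `𝒥'`: `𝒥' u = Φ' w`. -/
def IsBackwardImage {K : Scale} (w : HermDual K 2) (u : LagDual K) : Prop :=
  ∃ v : HermEvenDual K 1, IsTransposePhi w v ∧ IsTransposeJ u v

/-! ### The two Cauchy problems -/

/-- The operator `E_{ρ,c} = ρ E + c` on functions on `[0, ∞)`, where
`E = -(x d²/dx² + d/dx - x/4 + 1/2)` (one-sided derivatives at `0`). -/
def laguerreOp (ρ c : ℂ) (φ : ℝ≥0 → ℂ) : ℝ≥0 → ℂ := fun x =>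
  let F : ℝ → ℂ := fun y => φ y.toNNReal
  ρ * (-(((x : ℝ) : ℂ) * iteratedDerivWithin 2 F (Set.Ici 0) x
      + derivWithin F (Set.Ici 0) x - ((x : ℝ) : ℂ) / 4 * φ x + 1 / 2 * φ x)) + c * φ x

/-- The operator `H_{z,b} = z (-Δ + |x|²) + b` on functions on `ℝ²`. -/
def oscillatorOp (z b : ℂ) (φ : EuclideanSpace ℝ (Fin 2) → ℂ) :
    EuclideanSpace ℝ (Fin 2) → ℂ := fun x =>
  z * (-(Laplacian.laplacian φ) x + ((‖x‖ ^ 2 : ℝ) : ℂ) * φ x) + b * φ x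

/-- The family `u(t, ·)`, `t ∈ [0,T]`, solves `i ∂_t u - E_{ρ,c} u = 0`, `u(0, ·) = f`, in the
sense of ultradistributions: `i d/dt ⟨u(t), φ⟩ - ⟨u(t), E_{ρ,c} φ⟩ = 0` for all test functions
`φ`. The operator is (formally) its own transpose for the bilinear duality. The type `S` of
the ultradistributions `u(t)` may differ from the type `K` of the initial datum `f`; the
initial condition is then an equality on the common test functions. -/
def SolvesLaguerre {S K : Scale} (ρ c : ℂ) (T : ℝ) (u : ℝ → LagDual S) (f : LagDual K) : Prop :=
  (∀ t ∈ Set.Icc 0 T, ∀ φ : LagTest S, ∃ h : laguerreOp ρ c φ.1 ∈ LagTest S, ∃ D : ℂ,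
    HasDerivWithinAt (fun s => (u s).1 φ) D (Set.Icc 0 T) t ∧
      Complex.I * D - (u t).1 ⟨_, h⟩ = 0) ∧
  ∀ (φ : ℝ≥0 → ℂ) (hS : φ ∈ LagTest S) (hK : φ ∈ LagTest K), (u 0).1 ⟨φ, hS⟩ = f.1 ⟨φ, hK⟩

/-- The family `w(t, ·)`, `t ∈ [0,T]`, solves `i ∂_t w - H_{z,b} w = 0`, `w(0, ·) = g`, in the
sense of ultradistributions on `ℝ²`. -/
def SolvesOscillator {S K : Scale} (z b : ℂ) (T : ℝ) (w : ℝ → HermDual S 2)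
    (g : HermDual K 2) : Prop :=
  (∀ t ∈ Set.Icc 0 T, ∀ φ : HermTest S 2, ∃ h : oscillatorOp z b φ.1 ∈ HermTest S 2, ∃ D : ℂ,
    HasDerivWithinAt (fun s => (w s).1 φ) D (Set.Icc 0 T) t ∧
      Complex.I * D - (w t).1 ⟨_, h⟩ = 0) ∧
  ∀ (φ : EuclideanSpace ℝ (Fin 2) → ℂ) (hS : φ ∈ HermTest S 2) (hK : φ ∈ HermTest K 2),
    (w 0).1 ⟨φ, hS⟩ = g.1 ⟨φ, hK⟩

end LaguerreHermite

end

open LaguerreHermite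

open scoped NNReal
open Finset.HasAntidiagonal (antidiagonal)

noncomputable section

namespace LaguerreHermite

/-! ### Rapidly decreasing coefficient sequences -/

section Abstract

variable {ι ι' X Y : Type*}

/-! All maps involved are governed by their action on basis functions. Put `c_i = evenCoeff i`. The
addition theorem for Laguerre polynomials gives `l_n(x² + y²) = ∑_{i+j=n} c_i c_j h_{2i}(x)
h_{2j}(y)` (`laguerreFun_eq_sum`), so the lift `φ ↦ φ(|x|²)` sends `l_n` to a finite Hermite sum of
degree `2n`. Since `E l_n = n l_n` and `(-Δ + |x|²) h_m = (2|m| + 2) h_m`, the operators `E_{ρ,c}`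
and `H_{z,b}` correspond under the lift exactly when `ρ n + c = z (4n + 2) + b` for all `n`, that
is, `z = ρ/4` and `b = c - ρ/2`.

Because `Φ ψ` is the lift of `𝒥 ψ` and `𝒥` maps the even test functions onto the Laguerre test
functions, `𝒥' u = Φ' w` means that `u` is `w` composed with the lift (`isBackwardImage_iff`). For
the other direction there is a projection sending `h_{2i} h_{2j}` to `(c_i c_j / π) l_{i+j}` and the
remaining products to zero. It is a left inverse of the lift because `∑_{i+j=n} (c_i c_j)² = π`, and
a radial `w` satisfies `w = w ∘ lift ∘ proj` (`HermDual.IsRadial.eq_lift_proj`). Hence the radial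
solution of `𝒥' u = Φ' w` is `w = u ∘ proj` (`isForwardImage_iff`). Radiality is handled on each
degree `N`: rotations act on the products `h_k h_{N-k}` by `exp(θ A)` with a skew tridiagonal matrix
`A`, and the kernel equation of `A` is a two-term recursion that `c_i c_j` solves, uniquely up to a
factor among the entries of even index.

The analysis is done once, for row-finite kernels with polynomially bounded rows which multiply the
degree by at most a constant (`IsKernel`). They act on every test space and preserve continuity of
functionals under transposition (`Scale.IsContinuous.comp_kerMap`). Finite sums are dense
(`eq_zero_of_basisVec`), so identities between continuous functionals need checking only on basis
functions. To recognise a kernel operator as a concrete one, the Laguerre and Hermite systems must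
be polynomially bounded and independent (`IsSystem`); this rests on orthonormality of the Hermite
functions. -/

/-- Sequences that decrease faster than every power of the degree. -/
def RapidDecay (deg : ι → ℕ) (a : ι → ℂ) : Prop :=
  ∀ p : ℕ, ∃ C : ℝ, ∀ n, ‖a n‖ * (1 + (deg n : ℝ)) ^ p ≤ C

/-- The parameter of the scale, if there is one, is positive. -/
def Scale.Pos : Scale → Prop
  | .finite => True
  | .roumieu α => 0 < α
  | .beurling α => 0 < α

/-- Some negative power of the degree is summable. -/
def PolynomialGrowth (deg : ι → ℕ) : Prop :=
  ∃ q : ℕ, Summable fun n => ((1 + (deg n : ℝ)) ^ q)⁻¹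

/-- A family of functions that is polynomially bounded and independent with respect to rapidly
decreasing coefficients. -/
structure IsSystem (deg : ι → ℕ) (e : ι → X → ℝ) : Prop where
  growth : PolynomialGrowth deg
  bound : ∃ (C : ℝ) (p : ℕ), ∀ n x, |e n x| ≤ C * (1 + (deg n : ℝ)) ^ p
  independent : ∀ a, RapidDecay deg a → Expands e a 0 → a = 0

/-- With `x = N^{1/α}` and an integer `k ≥ p α` one has `N^p ≤ x^k` for `N ≥ 1`, and `x^k` is
controlled by the `k`-th term of the series of `exp (h x)`. -/
theorem exists_pow_le_exp_rpow {α h : ℝ} (hα : 0 < α) (hh : 0 < h) (p : ℕ) :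
    ∃ C : ℝ, 0 < C ∧ ∀ N : ℕ, (1 + (N : ℝ)) ^ p ≤ C * Real.exp (h * (N : ℝ) ^ (1 / α)) := by
  obtain ⟨k, hk⟩ := exists_nat_ge (p * α)
  refine ⟨1 + 2 ^ p * (k.factorial / h ^ k), by positivity, fun N => ?_⟩
  rcases Nat.eq_zero_or_pos N with rfl | hN
  · have : (0 : ℝ) ^ (1 / α) = 0 := Real.zero_rpow (by positivity)
    have h2 : 0 ≤ (2 : ℝ) ^ p * (k.factorial / h ^ k) := by positivity
    simp only [Nat.cast_zero, add_zero, one_pow, this, mul_zero, Real.exp_zero, mul_one]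
    linarith
  · have hN1 : (1 : ℝ) ≤ N := by exact_mod_cast hN
    set x := (N : ℝ) ^ (1 / α) with hx
    have hx0 : 0 ≤ x := by positivity
    have h1 : (1 + (N : ℝ)) ^ p ≤ 2 ^ p * (N : ℝ) ^ p := by
      rw [← mul_pow]; gcongr; linarith
    have h2 : (N : ℝ) ^ p ≤ x ^ k := by
      rw [hx, ← Real.rpow_natCast, ← Real.rpow_natCast, ← Real.rpow_mul (by positivity)]
      apply Real.rpow_le_rpow_of_exponent_le hN1
      rw [one_div, inv_mul_eq_div, le_div_iff₀ hα]; exact hk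
    have h3 : x ^ k ≤ k.factorial / h ^ k * Real.exp (h * x) := by
      have := Real.pow_div_factorial_le_exp (h * x) (by positivity) k
      rw [mul_pow, div_le_iff₀ (by positivity)] at this
      rw [div_mul_eq_mul_div, le_div_iff₀ (by positivity)]
      linarith
    calc (1 + (N : ℝ)) ^ p ≤ 2 ^ p * (k.factorial / h ^ k * Real.exp (h * x)) := by
          refine h1.trans ?_; gcongr; exact h2.trans h3
      _ = (2 ^ p * (k.factorial / h ^ k)) * Real.exp (h * x) := by ring
      _ ≤ _ := by gcongr; linarith

theorem WeightBound.nonneg {deg : ι → ℕ} {α h M : ℝ} {a : ι → ℂ} (H : WeightBound deg α h M a)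
    (n : ι) : 0 ≤ M := le_trans (by positivity) (H n)

theorem WeightBound.norm_le {deg : ι → ℕ} {α h M : ℝ} {a : ι → ℂ} (H : WeightBound deg α h M a)
    (n : ι) : ‖a n‖ ≤ M * Real.exp (-(h * (deg n : ℝ) ^ (1 / α))) := by
  rw [Real.exp_neg, ← div_eq_mul_inv, le_div_iff₀ (Real.exp_pos _)]
  exact H n

theorem WeightBound.rapidDecay {deg : ι → ℕ} {α h M : ℝ} {a : ι → ℂ} (hα : 0 < α) (hh : 0 < h)
    (H : WeightBound deg α h M a) : RapidDecay deg a := fun p => by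
  obtain ⟨C, hC, hp⟩ := exists_pow_le_exp_rpow hα hh p
  refine ⟨C * M, fun n => ?_⟩
  calc ‖a n‖ * (1 + (deg n : ℝ)) ^ p ≤ ‖a n‖ * (C * Real.exp (h * (deg n : ℝ) ^ (1 / α))) := by
        gcongr; exact hp _
    _ = C * (‖a n‖ * Real.exp (h * (deg n : ℝ) ^ (1 / α))) := by ring
    _ ≤ C * M := by gcongr; exact H n

theorem RapidDecay.of_finite_support {deg : ι → ℕ} {a : ι → ℂ} (ha : a.support.Finite) :
    RapidDecay deg a := fun p => by
  refine ⟨∑ n ∈ ha.toFinset, ‖a n‖ * (1 + (deg n : ℝ)) ^ p, fun n => ?_⟩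
  by_cases h : a n = 0
  · rw [h, norm_zero, zero_mul]; positivity
  · exact Finset.single_le_sum (f := fun n => ‖a n‖ * (1 + (deg n : ℝ)) ^ p)
      (fun _ _ => by positivity) (by simpa using h)

theorem Scale.Admissible.rapidDecay {K : Scale} (hK : K.Pos) {deg : ι → ℕ} {a : ι → ℂ}
    (ha : K.Admissible deg a) : RapidDecay deg a := by
  cases K with
  | finite => exact .of_finite_support ha
  | roumieu α => obtain ⟨h, hh, M, hM⟩ := ha; exact hM.rapidDecay hK hh
  | beurling α => obtain ⟨M, hM⟩ := ha 1 one_pos; exact hM.rapidDecay hK one_pos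

theorem Scale.Admissible.of_finite_support {K : Scale} {deg : ι → ℕ} {a : ι → ℂ}
    (ha : a.support.Finite) : K.Admissible deg a := by
  have key : ∀ α h : ℝ, ∃ M, WeightBound deg α h M a := fun α h => by
    refine ⟨∑ n ∈ ha.toFinset, ‖a n‖ * Real.exp (h * (deg n : ℝ) ^ (1 / α)), fun n => ?_⟩
    by_cases h' : a n = 0
    · rw [h', norm_zero, zero_mul]; positivity
    · exact Finset.single_le_sum (f := fun n => ‖a n‖ * Real.exp (h * (deg n : ℝ) ^ (1 / α)))
        (fun _ _ => by positivity) (by simpa using h')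
  cases K with
  | finite => exact ha
  | roumieu α => exact ⟨1, one_pos, key α 1⟩
  | beurling α => exact fun h _ => key α h

theorem RapidDecay.add {deg : ι → ℕ} {a b : ι → ℂ} (ha : RapidDecay deg a)
    (hb : RapidDecay deg b) : RapidDecay deg (a + b) := fun p => by
  obtain ⟨C, hC⟩ := ha p
  obtain ⟨D, hD⟩ := hb p
  refine ⟨C + D, fun n => ?_⟩
  calc ‖(a + b) n‖ * (1 + (deg n : ℝ)) ^ p ≤ (‖a n‖ + ‖b n‖) * (1 + (deg n : ℝ)) ^ p := by
        gcongr; exact norm_add_le _ _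
    _ ≤ C + D := by rw [add_mul]; exact add_le_add (hC n) (hD n)

theorem RapidDecay.smul {deg : ι → ℕ} {a : ι → ℂ} (c : ℂ) (ha : RapidDecay deg a) :
    RapidDecay deg (c • a) := fun p => by
  obtain ⟨C, hC⟩ := ha p
  refine ⟨‖c‖ * C, fun n => ?_⟩
  rw [Pi.smul_apply, norm_smul, mul_assoc]
  exact mul_le_mul_of_nonneg_left (hC n) (norm_nonneg _)

theorem RapidDecay.summable {deg : ι → ℕ} (hd : PolynomialGrowth deg) {a : ι → ℂ}
    (ha : RapidDecay deg a) (p : ℕ) : Summable fun n => ‖a n‖ * (1 + (deg n : ℝ)) ^ p := by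
  obtain ⟨q, hq⟩ := hd
  obtain ⟨C, hC⟩ := ha (p + q)
  refine Summable.of_nonneg_of_le (fun _ => by positivity) (fun n => ?_) (hq.mul_left C)
  rw [← div_eq_mul_inv, le_div_iff₀ (by positivity), mul_assoc, ← pow_add]
  exact hC n

theorem PolynomialGrowth.summable_weight {deg : ι → ℕ} (hd : PolynomialGrowth deg) {α h : ℝ}
    (hα : 0 < α) (hh : 0 < h) (p : ℕ) :
    Summable fun n => (1 + (deg n : ℝ)) ^ p * Real.exp (-(h * (deg n : ℝ) ^ (1 / α))) := by
  have H : WeightBound deg α h 1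
      (fun n => ((Real.exp (-(h * (deg n : ℝ) ^ (1 / α))) : ℝ) : ℂ)) := fun n => by
    simp only [Complex.norm_real, Real.norm_eq_abs, abs_of_pos (Real.exp_pos _), ← Real.exp_add]
    simp
  refine ((H.rapidDecay hα hh).summable hd p).congr fun n => ?_
  rw [Complex.norm_real, Real.norm_eq_abs, abs_of_pos (Real.exp_pos _), mul_comm]

/-! ### Kernel operators on coefficient sequences -/

/-- Row-finite kernels with polynomially bounded rows that increase the degree at most by a
factor. -/
structure IsKernel (deg : ι → ℕ) (deg' : ι' → ℕ) (k : ι → ι' →₀ ℂ) : Prop where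
  bound : ∃ (C : ℝ) (p : ℕ), ∀ n, ∑ m ∈ (k n).support, ‖k n m‖ ≤ C * (1 + (deg n : ℝ)) ^ p
  support : ∃ c : ℕ, ∀ n m, k n m ≠ 0 → deg' m ≤ c * deg n

theorem IsKernel.norm_apply_le {k : ι → ι' →₀ ℂ} {C : ℝ} (n : ι)
    (h : ∑ m ∈ (k n).support, ‖k n m‖ ≤ C) (m : ι') : ‖k n m‖ ≤ C := by
  by_cases hm : k n m = 0
  · rw [hm, norm_zero]; exact le_trans (by positivity) h
  · exact (Finset.single_le_sum (f := fun m => ‖k n m‖) (fun _ _ => norm_nonneg _)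
      (by simpa using hm)).trans h

/-- The action of a kernel on coefficient sequences. -/
def kerCoeff (k : ι → ι' →₀ ℂ) (a : ι → ℂ) : ι' → ℂ := fun m => ∑' n, a n * k n m

theorem kerCoeff_finite_support (k : ι → ι' →₀ ℂ) {a : ι → ℂ} (ha : a.support.Finite) :
    (kerCoeff k a).support.Finite := by
  classical
  refine (ha.toFinset.biUnion fun n => (k n).support).finite_toSet.subset fun m hm => ?_
  by_contra hcon
  refine hm (?_ : ∑' n, a n * k n m = 0)
  convert tsum_zero with n
  by_contra h
  rw [mul_eq_zero, not_or] at h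
  exact hcon (by simpa using ⟨n, h.1, h.2⟩)

/-- Half of the decay of `a n` absorbs the polynomial row bound and the summation over `n`. The
other half is passed on to `m`, using `deg' m ≤ (c + 1) deg n` wherever the entry is nonzero; this
gives `κ = (c + 1)^{-1/α} / 2`. That `κ` does not depend on `h` is essential for the Beurling type.
-/
theorem IsKernel.weightBound {deg : ι → ℕ} {deg' : ι' → ℕ} {k : ι → ι' →₀ ℂ}
    (hk : IsKernel deg deg' k) (hd : PolynomialGrowth deg) {α : ℝ} (hα : 0 < α) :
    ∃ κ > 0, ∀ h > 0, ∃ C : ℝ, ∀ (a : ι → ℂ) (M : ℝ), WeightBound deg α h M a →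
      WeightBound deg' α (κ * h) (C * M) (kerCoeff k a) := by
  obtain ⟨C, p, hC⟩ := hk.bound
  obtain ⟨c, hc⟩ := hk.support
  have hc0 : (0 : ℝ) < ((c : ℝ) + 1) ^ (1 / α) := by positivity
  refine ⟨((((c : ℝ) + 1) ^ (1 / α))⁻¹) / 2, by positivity, fun h hh => ?_⟩
  have hs := (hd.summable_weight hα (half_pos hh) p).mul_left C
  refine ⟨∑' n, C * ((1 + (deg n : ℝ)) ^ p * Real.exp (-(h / 2 * (deg n : ℝ) ^ (1 / α)))),
    fun a M ha m => ?_⟩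
  set κ := ((((c : ℝ) + 1) ^ (1 / α))⁻¹) / 2 with hκ
  set w := Real.exp (κ * h * (deg' m : ℝ) ^ (1 / α)) with hw
  have hterm : ∀ n, ‖a n * k n m‖ ≤
      C * ((1 + (deg n : ℝ)) ^ p * Real.exp (-(h / 2 * (deg n : ℝ) ^ (1 / α)))) * (M / w) := by
    intro n
    have hM := ha.nonneg n
    have hrow := IsKernel.norm_apply_le n (hC n) m
    have hrow0 : 0 ≤ C * (1 + (deg n : ℝ)) ^ p := le_trans (norm_nonneg _) hrow
    by_cases hz : k n m = 0
    · rw [hz, mul_zero, norm_zero, ← mul_assoc]; positivity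
    have hdeg : (deg' m : ℝ) ≤ ((c : ℝ) + 1) * deg n := by
      have h1 : (deg' m : ℝ) ≤ c * deg n := by exact_mod_cast hc n m hz
      have h2 : (0 : ℝ) ≤ deg n := by positivity
      linarith
    have hexp : κ * h * (deg' m : ℝ) ^ (1 / α) ≤ h / 2 * (deg n : ℝ) ^ (1 / α) := by
      have h1 : (deg' m : ℝ) ^ (1 / α) ≤ ((c : ℝ) + 1) ^ (1 / α) * (deg n : ℝ) ^ (1 / α) := by
        rw [← Real.mul_rpow (by positivity) (by positivity)]
        exact Real.rpow_le_rpow (by positivity) hdeg (by positivity)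
      calc κ * h * (deg' m : ℝ) ^ (1 / α)
          ≤ κ * h * (((c : ℝ) + 1) ^ (1 / α) * (deg n : ℝ) ^ (1 / α)) := by gcongr
        _ = h / 2 * (deg n : ℝ) ^ (1 / α) := by rw [hκ]; field_simp
    have he : Real.exp (-(h * (deg n : ℝ) ^ (1 / α)))
        ≤ Real.exp (-(h / 2 * (deg n : ℝ) ^ (1 / α))) / w := by
      rw [hw, ← Real.exp_sub]
      apply Real.exp_le_exp.2
      linarith
    calc ‖a n * k n m‖ = ‖k n m‖ * ‖a n‖ := by rw [norm_mul, mul_comm]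
      _ ≤ (C * (1 + (deg n : ℝ)) ^ p) * (M * Real.exp (-(h * (deg n : ℝ) ^ (1 / α)))) :=
          mul_le_mul hrow (ha.norm_le n) (norm_nonneg _) hrow0
      _ ≤ (C * (1 + (deg n : ℝ)) ^ p)
            * (M * (Real.exp (-(h / 2 * (deg n : ℝ) ^ (1 / α))) / w)) := by gcongr
      _ = _ := by ring
  have hb := tsum_of_norm_bounded (hs.mul_right (M / w)).hasSum hterm
  rw [tsum_mul_right] at hb
  have hw0 : 0 < w := Real.exp_pos _
  calc ‖kerCoeff k a m‖ * w ≤ _ * (M / w) * w := by gcongr; exact hb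
    _ = _ := by field_simp

theorem IsKernel.admissible {deg : ι → ℕ} {deg' : ι' → ℕ} {k : ι → ι' →₀ ℂ}
    (hk : IsKernel deg deg' k) (hd : PolynomialGrowth deg) {K : Scale} (hK : K.Pos) {a : ι → ℂ}
    (ha : K.Admissible deg a) : K.Admissible deg' (kerCoeff k a) := by
  cases K with
  | finite => exact kerCoeff_finite_support k ha
  | roumieu α =>
    obtain ⟨κ, hκ, H⟩ := hk.weightBound hd hK
    obtain ⟨h, hh, M, hM⟩ := ha
    obtain ⟨C, hC⟩ := H h hh
    exact ⟨κ * h, by positivity, _, hC a M hM⟩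
  | beurling α =>
    obtain ⟨κ, hκ, H⟩ := hk.weightBound hd hK
    intro h hh
    obtain ⟨C, hC⟩ := H (h / κ) (by positivity)
    obtain ⟨M, hM⟩ := ha (h / κ) (by positivity)
    have := hC a M hM
    rw [mul_div_cancel₀ _ hκ.ne'] at this
    exact ⟨_, this⟩

/-- Interchange of summation for the double family `a n * k n m * E m`: the hypothesis sums it by
rows, the conclusion by columns. -/
theorem IsKernel.hasSum {deg : ι → ℕ} {deg' : ι' → ℕ} {k : ι → ι' →₀ ℂ}
    (hk : IsKernel deg deg' k) (hd : PolynomialGrowth deg) {a : ι → ℂ} (ha : RapidDecay deg a)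
    {E : ι' → ℂ} {C : ℝ} {p : ℕ} (hE : ∀ m, ‖E m‖ ≤ C * (1 + (deg' m : ℝ)) ^ p) {s : ℂ}
    (hs : HasSum (fun n => a n * ∑ m ∈ (k n).support, k n m * E m) s) :
    HasSum (fun m => kerCoeff k a m * E m) s := by
  obtain ⟨D, q, hD⟩ := hk.bound
  obtain ⟨c, hc⟩ := hk.support
  set F : ι × ι' → ℂ := fun z => a z.1 * (k z.1 z.2 * E z.2) with hF
  have hrow : ∀ n, HasSum (fun m => k n m * E m) (∑ m ∈ (k n).support, k n m * E m) := fun n =>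
    hasSum_sum_of_ne_finset_zero fun m hm => by
      rw [Finsupp.notMem_support_iff.1 hm, zero_mul]
  have hrown : ∀ n, HasSum (fun m => ‖F (n, m)‖) (∑ m ∈ (k n).support, ‖F (n, m)‖) := fun n =>
    hasSum_sum_of_ne_finset_zero fun m hm => by
      simp [hF, Finsupp.notMem_support_iff.1 hm]
  -- Absolute convergence: on the support of row `n` the factor `E m` is polynomially bounded in
  -- `deg n`, and `a` decays faster than any power.
  have hsum : Summable F := by
    rw [← summable_norm_iff]
    rw [summable_prod_of_nonneg (fun _ => norm_nonneg _)]
    refine ⟨fun n => (hrown n).summable, ?_⟩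
    refine Summable.of_nonneg_of_le (fun n => tsum_nonneg fun _ => norm_nonneg _) (fun n => ?_)
      ((ha.summable hd (p + q)).mul_left (|C| * (1 + c) ^ p * D))
    rw [(hrown n).tsum_eq]
    have hEn : ∀ m ∈ (k n).support, ‖E m‖ ≤ |C| * (1 + c) ^ p * (1 + (deg n : ℝ)) ^ p := by
      intro m hm
      have h1 : (deg' m : ℝ) ≤ c * deg n := by
        exact_mod_cast hc n m (Finsupp.mem_support_iff.1 hm)
      have h2 : (0 : ℝ) ≤ deg n := by positivity
      have h3 : (0 : ℝ) ≤ c := by positivity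
      calc ‖E m‖ ≤ |C| * (1 + (deg' m : ℝ)) ^ p := by
            refine (hE m).trans ?_; gcongr; exact le_abs_self C
        _ ≤ |C| * ((1 + c) * (1 + (deg n : ℝ))) ^ p := by gcongr; nlinarith
        _ = _ := by rw [mul_pow]; ring
    calc ∑ m ∈ (k n).support, ‖F (n, m)‖
        ≤ ∑ m ∈ (k n).support,
            ‖a n‖ * (‖k n m‖ * (|C| * (1 + c) ^ p * (1 + (deg n : ℝ)) ^ p)) := by
          refine Finset.sum_le_sum fun m hm => ?_
          simp only [hF, norm_mul]
          gcongr
          exact hEn m hm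
      _ = ‖a n‖ * ((∑ m ∈ (k n).support, ‖k n m‖)
            * (|C| * (1 + c) ^ p * (1 + (deg n : ℝ)) ^ p)) := by
          rw [Finset.sum_mul, Finset.mul_sum]
      _ ≤ ‖a n‖ * ((D * (1 + (deg n : ℝ)) ^ q)
            * (|C| * (1 + c) ^ p * (1 + (deg n : ℝ)) ^ p)) := by
          gcongr; exact hD n
      _ = _ := by rw [pow_add]; ring
  have hFs : HasSum F s := by
    have h1 := hsum.hasSum.prod_fiberwise fun n => (hrow n).mul_left (a n)
    rw [← h1.unique hs]
    exact hsum.hasSum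
  have hswap : HasSum (fun z : ι' × ι => F z.swap) s :=
    (Equiv.prodComm ι' ι).hasSum_iff.2 hFs
  refine hswap.prod_fiberwise fun m => ?_
  have h2 : Summable fun n => F (n, m) := hswap.summable.prod_factor m
  have h3 : (∑' n, F (n, m)) = kerCoeff k a m * E m := by
    rw [kerCoeff, ← tsum_mul_right]
    exact tsum_congr fun n => by simp only [hF]; ring
  exact h3 ▸ h2.hasSum

theorem IsKernel.hasSum_coeff {deg : ι → ℕ} {deg' : ι' → ℕ} {k : ι → ι' →₀ ℂ}
    (hk : IsKernel deg deg' k) (hd : PolynomialGrowth deg) {a : ι → ℂ} (ha : RapidDecay deg a)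
    (m : ι') : Summable fun n => a n * k n m := by
  obtain ⟨D, q, hD⟩ := hk.bound
  refine Summable.of_norm_bounded ((ha.summable hd q).mul_left D) fun n => ?_
  rw [norm_mul]
  calc ‖a n‖ * ‖k n m‖ ≤ ‖a n‖ * (D * (1 + (deg n : ℝ)) ^ q) := by
        gcongr; exact IsKernel.norm_apply_le n (hD n) m
    _ = _ := by ring

/-! ### Coefficients -/

/-- The coefficients of a function in a rapidly convergent expansion. -/
def coeffs (deg : ι → ℕ) (e : ι → X → ℝ) (f : X → ℂ) : ι → ℂ :=
  open Classical in
  if h : ∃ a, RapidDecay deg a ∧ Expands e a f then h.choose else 0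

theorem Expands.add {e : ι → X → ℝ} {a b : ι → ℂ} {f g : X → ℂ} (ha : Expands e a f)
    (hb : Expands e b g) : Expands e (a + b) (f + g) := fun x => by
  simpa [add_mul] using (ha x).add (hb x)

theorem Expands.smul {e : ι → X → ℝ} {a : ι → ℂ} {f : X → ℂ} (c : ℂ) (ha : Expands e a f) :
    Expands e (c • a) (c • f) := fun x => by
  simpa [mul_assoc] using (ha x).mul_left c

theorem IsSystem.unique {deg : ι → ℕ} {e : ι → X → ℝ} (hs : IsSystem deg e) {a b : ι → ℂ}
    {f : X → ℂ} (ha : RapidDecay deg a) (hb : RapidDecay deg b) (haf : Expands e a f)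
    (hbf : Expands e b f) : a = b := by
  have h := hs.independent (a + (-1 : ℂ) • b) (ha.add (hb.smul _))
    (by simpa using haf.add (hbf.smul (-1)))
  have : a - b = 0 := by rw [← h]; simp [sub_eq_add_neg]
  exact sub_eq_zero.1 this

theorem IsSystem.coeffs_eq {deg : ι → ℕ} {e : ι → X → ℝ} (hs : IsSystem deg e) {a : ι → ℂ}
    {f : X → ℂ} (ha : RapidDecay deg a) (haf : Expands e a f) : coeffs deg e f = a := by
  have h : ∃ a, RapidDecay deg a ∧ Expands e a f := ⟨a, ha, haf⟩
  rw [coeffs, dif_pos h]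
  exact hs.unique h.choose_spec.1 ha h.choose_spec.2 haf

/-! ### Kernel operators on functions -/

/-- The operator that maps `e_n` to `∑_m k(n, m) e'_m`. -/
def kerOp (deg : ι → ℕ) (e : ι → X → ℝ) (e' : ι' → Y → ℝ) (k : ι → ι' →₀ ℂ) (f : X → ℂ) :
    Y → ℂ := fun y => ∑' m, kerCoeff k (coeffs deg e f) m * (e' m y : ℂ)

variable {deg : ι → ℕ} {deg' : ι' → ℕ} {e : ι → X → ℝ} {e' : ι' → Y → ℝ} {k : ι → ι' →₀ ℂ}

/-- This identifies the abstract operator with a concrete one: it suffices that the concrete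
operator acts term by term on an expansion with rapidly decreasing coefficients. -/
theorem kerOp_eq (hs : IsSystem deg e) (hs' : IsSystem deg' e') (hk : IsKernel deg deg' k)
    {f : X → ℂ} {g : Y → ℂ} {a : ι → ℂ} (ha : RapidDecay deg a) (haf : Expands e a f)
    (hg : ∀ y, HasSum (fun n => a n * ∑ m ∈ (k n).support, k n m * (e' m y : ℂ)) (g y)) :
    kerOp deg e e' k f = g := by
  obtain ⟨C, p, hC⟩ := hs'.bound
  funext y
  rw [kerOp, hs.coeffs_eq ha haf]
  exact (hk.hasSum hs.growth ha (E := fun m => (e' m y : ℂ))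
    (fun m => by rw [Complex.norm_real]; exact hC m y) (hg y)).tsum_eq

theorem IsKernel.summable_rows (hs : IsSystem deg e) (hs' : IsSystem deg' e')
    (hk : IsKernel deg deg' k) {a : ι → ℂ} (ha : RapidDecay deg a) (y : Y) :
    Summable fun n => a n * ∑ m ∈ (k n).support, k n m * (e' m y : ℂ) := by
  obtain ⟨C, p, hC⟩ := hs'.bound
  obtain ⟨D, q, hD⟩ := hk.bound
  obtain ⟨c, hc⟩ := hk.support
  refine Summable.of_norm_bounded
    ((ha.summable hs.growth (p + q)).mul_left (|C| * (1 + c) ^ p * D)) fun n => ?_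
  have hEn : ∀ m ∈ (k n).support,
      ‖(e' m y : ℂ)‖ ≤ |C| * (1 + c) ^ p * (1 + (deg n : ℝ)) ^ p := by
    intro m hm
    have h1 : (deg' m : ℝ) ≤ c * deg n := by
      exact_mod_cast hc n m (Finsupp.mem_support_iff.1 hm)
    have h2 : (0 : ℝ) ≤ deg n := by positivity
    have h3 : (0 : ℝ) ≤ c := by positivity
    rw [Complex.norm_real]
    calc ‖e' m y‖ ≤ |C| * (1 + (deg' m : ℝ)) ^ p := by
          refine (hC m y).trans ?_; gcongr; exact le_abs_self C
      _ ≤ |C| * ((1 + c) * (1 + (deg n : ℝ))) ^ p := by gcongr; nlinarith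
      _ = _ := by rw [mul_pow]; ring
  rw [norm_mul]
  calc ‖a n‖ * ‖∑ m ∈ (k n).support, k n m * (e' m y : ℂ)‖
      ≤ ‖a n‖ * ∑ m ∈ (k n).support,
          ‖k n m‖ * (|C| * (1 + c) ^ p * (1 + (deg n : ℝ)) ^ p) := by
        gcongr
        refine norm_sum_le_of_le _ fun m hm => ?_
        rw [norm_mul]
        gcongr
        exact hEn m hm
    _ = ‖a n‖ * ((∑ m ∈ (k n).support, ‖k n m‖)
          * (|C| * (1 + c) ^ p * (1 + (deg n : ℝ)) ^ p)) := by rw [Finset.sum_mul]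
    _ ≤ ‖a n‖ * ((D * (1 + (deg n : ℝ)) ^ q)
          * (|C| * (1 + c) ^ p * (1 + (deg n : ℝ)) ^ p)) := by gcongr; exact hD n
    _ = _ := by rw [pow_add]; ring

theorem kerOp_expands (hs : IsSystem deg e) (hs' : IsSystem deg' e')
    (hk : IsKernel deg deg' k) {f : X → ℂ} {a : ι → ℂ} (ha : RapidDecay deg a)
    (haf : Expands e a f) : Expands e' (kerCoeff k a) (kerOp deg e e' k f) := fun y => by
  obtain ⟨C, p, hC⟩ := hs'.bound
  rw [kerOp, hs.coeffs_eq ha haf]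
  exact (hk.hasSum hs.growth ha (E := fun m => (e' m y : ℂ))
    (fun m => by rw [Complex.norm_real]; exact hC m y)
    (hk.summable_rows hs hs' ha y).hasSum).summable.hasSum

theorem kerOp_mem (hs : IsSystem deg e) (hs' : IsSystem deg' e') (hk : IsKernel deg deg' k)
    {K : Scale} (hK : K.Pos) {f : X → ℂ} (hf : f ∈ K.testSpace deg e) :
    kerOp deg e e' k f ∈ K.testSpace deg' e' := by
  obtain ⟨a, ha, haf⟩ := hf
  exact ⟨_, hk.admissible hs.growth hK ha, kerOp_expands hs hs' hk (ha.rapidDecay hK) haf⟩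

theorem kerCoeff_add (hd : PolynomialGrowth deg) (hk : IsKernel deg deg' k) {a b : ι → ℂ}
    (ha : RapidDecay deg a) (hb : RapidDecay deg b) :
    kerCoeff k (a + b) = kerCoeff k a + kerCoeff k b := by
  funext m
  simp only [kerCoeff, Pi.add_apply, add_mul]
  exact (hk.hasSum_coeff hd ha m).tsum_add (hk.hasSum_coeff hd hb m)

theorem kerCoeff_smul (c : ℂ) (a : ι → ℂ) : kerCoeff k (c • a) = c • kerCoeff k a := by
  funext m
  simp only [kerCoeff, Pi.smul_apply, smul_eq_mul, mul_assoc]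
  exact tsum_mul_left

theorem Expands.eq {e : ι → X → ℝ} {a : ι → ℂ} {f g : X → ℂ} (hf : Expands e a f)
    (hg : Expands e a g) : f = g := funext fun x => (hf x).unique (hg x)

/-- The kernel operator as a linear map between test spaces. -/
def kerMap (hs : IsSystem deg e) (hs' : IsSystem deg' e') (hk : IsKernel deg deg' k)
    {K : Scale} (hK : K.Pos) : K.testSpace deg e →ₗ[ℂ] K.testSpace deg' e' where
  toFun f := ⟨kerOp deg e e' k f.1, kerOp_mem hs hs' hk hK f.2⟩
  map_add' f g := by
    obtain ⟨f, a, ha, haf⟩ := f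
    obtain ⟨g, b, hb, hbg⟩ := g
    have ha' := ha.rapidDecay hK
    have hb' := hb.rapidDecay hK
    -- Both sides are functions with the same expansion, so linearity is inherited from the
    -- coefficients.
    refine Subtype.ext ((kerOp_expands hs hs' hk (ha'.add hb') (haf.add hbg)).eq ?_)
    rw [kerCoeff_add hs.growth hk ha' hb']
    exact (kerOp_expands hs hs' hk ha' haf).add (kerOp_expands hs hs' hk hb' hbg)
  map_smul' c f := by
    obtain ⟨f, a, ha, haf⟩ := f
    have ha' := ha.rapidDecay hK
    refine Subtype.ext ((kerOp_expands hs hs' hk (ha'.smul c) (haf.smul c)).eq ?_)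
    rw [kerCoeff_smul]
    exact (kerOp_expands hs hs' hk ha' haf).smul c

@[simp]
theorem kerMap_coe (hs : IsSystem deg e) (hs' : IsSystem deg' e') (hk : IsKernel deg deg' k)
    {K : Scale} (hK : K.Pos) (f : K.testSpace deg e) :
    (kerMap hs hs' hk hK f : Y → ℂ) = kerOp deg e e' k f.1 := rfl

/-- The kernel maps the norm with parameter `h` boundedly into the one with `κ h`. In the Beurling
case a functional controlled by the `h`-norm therefore pulls back to one controlled by the `h /
κ`-norm. -/
theorem Scale.IsContinuous.comp_kerMap (hs : IsSystem deg e) (hs' : IsSystem deg' e')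
    (hk : IsKernel deg deg' k) {K : Scale} (hK : K.Pos) {u : K.testSpace deg' e' →ₗ[ℂ] ℂ}
    (hu : K.IsContinuous deg' e' _ u) :
    K.IsContinuous deg e _ (u ∘ₗ kerMap hs hs' hk hK) := by
  cases K with
  | finite => trivial
  | roumieu α =>
    obtain ⟨κ, hκ, H⟩ := hk.weightBound hs.growth hK
    intro h hh
    obtain ⟨C, hC⟩ := H h hh
    obtain ⟨D, hD⟩ := hu (κ * h) (by positivity)
    refine ⟨D * C, fun f a M haf ha => ?_⟩
    rw [mul_assoc]
    exact hD _ _ _ (kerOp_expands hs hs' hk (ha.rapidDecay hK hh) haf) (hC a M ha)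
  | beurling α =>
    obtain ⟨κ, hκ, H⟩ := hk.weightBound hs.growth hK
    obtain ⟨h, hh, D, hD⟩ := hu
    obtain ⟨C, hC⟩ := H (h / κ) (by positivity)
    refine ⟨h / κ, by positivity, D * C, fun f a M haf hadm ha => ?_⟩
    have hb := hC a M ha
    rw [mul_div_cancel₀ _ hκ.ne'] at hb
    rw [mul_assoc]
    exact hD _ _ _ (kerOp_expands hs hs' hk (ha.rapidDecay hK (by positivity)) haf)
      (hk.admissible hs.growth hK hadm) hb

/-! ### Basis vectors and density -/

theorem expands_single (e : ι → X → ℝ) [DecidableEq ι] (n : ι) :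
    Expands e (Pi.single n 1) (fun x => (e n x : ℂ)) := fun x => by
  have := hasSum_single (f := fun m => (Pi.single n (1 : ℂ) : ι → ℂ) m * (e m x : ℂ)) n
    (fun m hm => by simp [hm])
  simpa using this

theorem finite_support_single [DecidableEq ι] (n : ι) :
    (Pi.single n (1 : ℂ) : ι → ℂ).support.Finite :=
  (Set.finite_singleton n).subset Pi.support_single_subset

/-- The function `e_n` as an element of a test space. -/
def basisVec (K : Scale) (deg : ι → ℕ) (e : ι → X → ℝ) (n : ι) : K.testSpace deg e :=
  ⟨fun x => (e n x : ℂ), by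
    classical
    exact ⟨Pi.single n 1, .of_finite_support (finite_support_single n), expands_single e n⟩⟩

theorem kerOp_basis (hs : IsSystem deg e) (hs' : IsSystem deg' e') (hk : IsKernel deg deg' k)
    (n : ι) : kerOp deg e e' k (fun x => (e n x : ℂ)) =
      fun y => ∑ m ∈ (k n).support, k n m * (e' m y : ℂ) := by
  classical
  refine kerOp_eq hs hs' hk (.of_finite_support (finite_support_single n))
    (expands_single e n) fun y => ?_
  have := hasSum_single (f := fun m => (Pi.single n (1 : ℂ) : ι → ℂ) m
    * ∑ l ∈ (k m).support, k m l * (e' l y : ℂ)) n (fun m hm => by simp [hm])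
  simpa using this

theorem kerMap_basisVec (hs : IsSystem deg e) (hs' : IsSystem deg' e')
    (hk : IsKernel deg deg' k) {K : Scale} (hK : K.Pos) (n : ι) :
    kerMap hs hs' hk hK (basisVec K deg e n) =
      (k n).sum fun m c => c • basisVec K deg' e' m := by
  refine Subtype.ext ?_
  rw [kerMap_coe, basisVec, kerOp_basis hs hs' hk, Finsupp.sum]
  funext y
  simp [basisVec]

theorem Scale.IsContinuous.add {V : Submodule ℂ (X → ℂ)} {K : Scale} {u v : V →ₗ[ℂ] ℂ}
    (hu : K.IsContinuous deg e V u) (hv : K.IsContinuous deg e V v) [Nonempty ι] :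
    K.IsContinuous deg e V (u + v) := by
  cases K with
  | finite => trivial
  | roumieu α =>
    intro h hh
    obtain ⟨C, hC⟩ := hu h hh
    obtain ⟨D, hD⟩ := hv h hh
    refine ⟨C + D, fun f a M haf ha => (norm_add_le _ _).trans ?_⟩
    rw [add_mul]
    exact add_le_add (hC f a M haf ha) (hD f a M haf ha)
  | beurling α =>
    obtain ⟨h, hh, C, hC⟩ := hu
    obtain ⟨h', hh', D, hD⟩ := hv
    refine ⟨max h h', lt_max_of_lt_left hh, C + D, fun f a M haf hadm ha =>
      (norm_add_le _ _).trans ?_⟩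
    rw [add_mul]
    exact add_le_add (hC f a M haf hadm (ha.mono (le_max_left _ _)))
      (hD f a M haf hadm (ha.mono (le_max_right _ _)))

theorem Scale.IsContinuous.neg {V : Submodule ℂ (X → ℂ)} {K : Scale} {u : V →ₗ[ℂ] ℂ}
    (hu : K.IsContinuous deg e V u) : K.IsContinuous deg e V (-u) := by
  cases K with
  | finite => trivial
  | roumieu α => simpa [Scale.IsContinuous] using hu
  | beurling α => simpa [Scale.IsContinuous] using hu

/-- Giving up half of the exponent makes the weighted coefficients summable, so they become small
outside a finite set. -/
theorem exists_finite_weight_le (hd : PolynomialGrowth deg) {α h M : ℝ} (hα : 0 < α)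
    (hh : 0 < h) {a : ι → ℂ} (ha : WeightBound deg α (2 * h) M a) {ε : ℝ} (hε : 0 < ε) :
    ∃ F : Finset ι, ∀ n ∉ F, ‖a n‖ * Real.exp (h * (deg n : ℝ) ^ (1 / α)) ≤ ε := by
  have hsum : Summable fun n => ‖a n‖ * Real.exp (h * (deg n : ℝ) ^ (1 / α)) := by
    refine Summable.of_nonneg_of_le (fun _ => by positivity) (fun n => ?_)
      ((hd.summable_weight hα hh 0).mul_left M)
    have := ha n
    rw [pow_zero, one_mul, Real.exp_neg, ← div_eq_mul_inv, le_div_iff₀ (Real.exp_pos _), mul_assoc,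
      ← Real.exp_add, ← add_mul, ← two_mul]
    exact this
  have h1 := hsum.tendsto_cofinite_zero.eventually (ge_mem_nhds hε)
  rw [Filter.eventually_cofinite] at h1
  exact ⟨h1.toFinset, fun n hn => by simpa using hn⟩

/-- Density of finite sums: removing finitely many terms from `f` does not change `u f`, while the
remaining tail is arbitrarily small in a norm that controls `u`. For the Roumieu type this norm has
half the exponent of `f`; for the Beurling type `f` is used with twice the exponent of the norm. -/
theorem eq_zero_of_basisVec (hs : IsSystem deg e) {K : Scale} (hK : K.Pos)
    {u : K.testSpace deg e →ₗ[ℂ] ℂ} (hu : K.IsContinuous deg e _ u)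
    (h0 : ∀ n, u (basisVec K deg e n) = 0) : u = 0 := by
  classical
  refine LinearMap.ext fun f => ?_
  obtain ⟨f, a, ha, haf⟩ := f
  set f' : K.testSpace deg e := ⟨f, a, ha, haf⟩ with hf'
  have hcoe : ∀ (F : Finset ι) (x : X),
      (f' - ∑ n ∈ F, a n • basisVec K deg e n : K.testSpace deg e).1 x
        = f x - ∑ n ∈ F, a n * (e n x : ℂ) := by
    intro F x
    simp [hf', basisVec, Finset.sum_apply]
  have hpart : ∀ F : Finset ι, Expands e (fun n => if n ∈ F then 0 else a n)
      (f' - ∑ n ∈ F, a n • basisVec K deg e n : K.testSpace deg e).1 := by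
    intro F x
    have h1 : HasSum (fun n => if n ∈ F then a n * (e n x : ℂ) else 0)
        (∑ n ∈ F, a n * (e n x : ℂ)) := by
      rw [← Finset.sum_congr rfl fun n hn => if_pos hn]
      exact hasSum_sum_of_ne_finset_zero fun n hn => if_neg hn
    rw [hcoe]
    refine ((haf x).sub h1).congr_fun ?_
    intro n
    by_cases hn : n ∈ F <;> simp [hn]
  have hval : ∀ F : Finset ι, u (f' - ∑ n ∈ F, a n • basisVec K deg e n) = u f' := by
    intro F
    simp [h0]
  have hsub : ∀ F : Finset ι, ∀ n, ‖(if n ∈ F then 0 else a n : ℂ)‖ ≤ ‖a n‖ := by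
    intro F n; split_ifs <;> simp
  have hclose : ∀ C : ℝ, (∀ ε > 0, ‖u f'‖ ≤ C * ε) → u f' = 0 := by
    intro C hC
    rw [← norm_le_zero_iff]
    refine le_of_forall_pos_le_add fun δ hδ => ?_
    -- The sign of `C` is unknown, hence `|C| + 1` as a positive divisor.
    have hpos : 0 < |C| + 1 := by positivity
    refine (hC (δ / (|C| + 1)) (by positivity)).trans ?_
    rw [zero_add, ← mul_div_assoc, div_le_iff₀ hpos]
    nlinarith [le_abs_self C]
  cases K with
  | finite =>
    have h1 : f' - ∑ n ∈ (show a.support.Finite from ha).toFinset,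
        a n • basisVec Scale.finite deg e n = 0 := by
      have h2 := hpart (show a.support.Finite from ha).toFinset
      refine Subtype.ext (h2.eq fun x => ?_)
      have h4 : (fun n => (if n ∈ (show a.support.Finite from ha).toFinset then 0 else a n)
          * (e n x : ℂ)) = fun _ => 0 := by
        funext n
        by_cases h : a n = 0 <;> simp [h]
      rw [h4]
      exact hasSum_zero
    have h3 := hval (show a.support.Finite from ha).toFinset
    rw [h1, map_zero] at h3
    exact h3.symm
  | roumieu α =>
    obtain ⟨h, hh, M, hM⟩ := ha
    obtain ⟨C, hC⟩ := hu (h / 2) (by positivity)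
    refine hclose C fun ε hε => ?_
    obtain ⟨F, hF⟩ := exists_finite_weight_le hs.growth hK (half_pos hh)
      (by rwa [mul_div_cancel₀ _ two_ne_zero]) hε
    rw [← hval F]
    refine hC _ _ _ (hpart F) fun n => ?_
    by_cases hn : n ∈ F
    · simpa [hn] using hε.le
    · simpa [hn] using hF n hn
  | beurling α =>
    obtain ⟨h, hh, C, hC⟩ := hu
    refine hclose C fun ε hε => ?_
    obtain ⟨M, hM⟩ := ha (2 * h) (by positivity)
    obtain ⟨F, hF⟩ := exists_finite_weight_le hs.growth hK hh hM hε
    rw [← hval F]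
    refine hC _ _ _ (hpart F) (fun h' hh' => ?_) fun n => ?_
    · obtain ⟨M, hM⟩ := ha h' hh'
      exact ⟨M, fun n => (mul_le_mul_of_nonneg_right (hsub F n) (Real.exp_pos _).le).trans (hM n)⟩
    · by_cases hn : n ∈ F
      · simpa [hn] using hε.le
      · simpa [hn] using hF n hn

theorem ext_of_basisVec [Nonempty ι] (hs : IsSystem deg e) {K : Scale} (hK : K.Pos)
    {u v : K.testSpace deg e →ₗ[ℂ] ℂ} (hu : K.IsContinuous deg e _ u)
    (hv : K.IsContinuous deg e _ v)
    (h : ∀ n, u (basisVec K deg e n) = v (basisVec K deg e n)) : u = v := by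
  have := eq_zero_of_basisVec hs hK (hu.add hv.neg) (fun n => by simp [h n])
  rwa [← sub_eq_add_neg, sub_eq_zero] at this

end Abstract

/-! ### Hermite functions of one variable -/

open Polynomial in
theorem derivative_hermite_succ (n : ℕ) :
    derivative (hermite (n + 1)) = (n + 1 : ℤ[X]) * hermite n := by
  induction n with
  | zero => simp
  | succ n ih =>
    rw [hermite_succ (n + 1), derivative_sub, derivative_mul, ih, derivative_mul, derivative_X]
    have : derivative (n + 1 : ℤ[X]) = 0 := by simp
    rw [this, hermite_succ n]
    push_cast
    ring

/-- The physicists' Hermite polynomials up to normalization, as functions. -/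
def hermiteVal (n : ℕ) (x : ℝ) : ℝ := Polynomial.aeval (Real.sqrt 2 * x) (Polynomial.hermite n)

theorem hermiteVal_zero (x : ℝ) : hermiteVal 0 x = 1 := by simp [hermiteVal]

theorem hermiteVal_one (x : ℝ) : hermiteVal 1 x = Real.sqrt 2 * x := by
  simp [hermiteVal]

theorem hermiteVal_succ_succ (n : ℕ) (x : ℝ) :
    hermiteVal (n + 2) x = Real.sqrt 2 * x * hermiteVal (n + 1) x - (n + 1) * hermiteVal n x := by
  rw [hermiteVal, Polynomial.hermite_succ (n + 1), derivative_hermite_succ]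
  simp only [hermiteVal, map_sub, map_mul, map_add, map_one, map_natCast, Polynomial.aeval_X]

theorem hasDerivAt_hermiteVal (n : ℕ) (x : ℝ) :
    HasDerivAt (hermiteVal n) (Real.sqrt 2 * n * hermiteVal (n - 1) x) x := by
  have h1 := ((Polynomial.hermite n).hasDerivAt_aeval (Real.sqrt 2 * x)).comp x
    ((hasDerivAt_id x).const_mul (Real.sqrt 2))
  refine h1.congr_deriv ?_
  cases n with
  | zero => simp
  | succ n =>
    rw [derivative_hermite_succ]
    simp [hermiteVal]
    ring

/-- The coefficients `√(n/2)` of the ladder relations. -/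
def ladder (n : ℕ) : ℝ := Real.sqrt (n / 2)

theorem ladder_zero : ladder 0 = 0 := by simp [ladder]

theorem ladder_pos (n : ℕ) : 0 < ladder (n + 1) := by
  unfold ladder; positivity

theorem ladder_nonneg (n : ℕ) : 0 ≤ ladder n := Real.sqrt_nonneg _

theorem ladder_sq (n : ℕ) : ladder n ^ 2 = n / 2 := Real.sq_sqrt (by positivity)

/-- The normalization constant of the Hermite functions. -/
def hermiteNorm (n : ℕ) : ℝ := (Real.sqrt ((n.factorial : ℝ) * Real.sqrt Real.pi))⁻¹

theorem hermiteNorm_pos (n : ℕ) : 0 < hermiteNorm n := by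
  unfold hermiteNorm; positivity

theorem hermiteFun_eq (n : ℕ) (x : ℝ) :
    hermiteFun n x = hermiteNorm n * Real.exp (-x ^ 2 / 2) * hermiteVal n x := rfl

theorem hermiteNorm_succ (n : ℕ) :
    hermiteNorm n = Real.sqrt 2 * ladder (n + 1) * hermiteNorm (n + 1) := by
  unfold hermiteNorm ladder
  rw [← Real.sqrt_mul (by positivity), ← Real.sqrt_inv, ← Real.sqrt_inv,
    ← Real.sqrt_mul (by positivity), Nat.factorial_succ]
  congr 1
  push_cast
  field_simp

theorem mul_hermiteNorm_succ (n : ℕ) :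
    (n + 1) * hermiteNorm (n + 1) = Real.sqrt 2 * ladder (n + 1) * hermiteNorm n := by
  rw [hermiteNorm_succ n]
  have h1 : Real.sqrt 2 ^ 2 = 2 := Real.sq_sqrt (by positivity)
  have h2 := ladder_sq (n + 1)
  push_cast at h2
  linear_combination (-2 * hermiteNorm (n + 1)) * h2
    - ladder (n + 1) ^ 2 * hermiteNorm (n + 1) * h1

/-- The recurrence of the Hermite polynomials after normalization. At `n = 0` the truncated index `n
- 1` is harmless because `ladder 0 = 0`. -/
theorem mul_hermiteFun (n : ℕ) (x : ℝ) :
    x * hermiteFun n x = ladder n * hermiteFun (n - 1) x + ladder (n + 1) * hermiteFun (n + 1) x := by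
  have h2 : Real.sqrt 2 ^ 2 = 2 := Real.sq_sqrt (by positivity)
  have h3 : Real.sqrt 2 * hermiteNorm n = 2 * ladder (n + 1) * hermiteNorm (n + 1) := by
    rw [hermiteNorm_succ n]
    linear_combination ladder (n + 1) * hermiteNorm (n + 1) * h2
  simp only [hermiteFun_eq]
  cases n with
  | zero =>
    simp only [ladder_zero, hermiteVal_zero, hermiteVal_one, zero_add] at *
    linear_combination (Real.exp (-x ^ 2 / 2) * x * Real.sqrt 2 / 2) * h3
      - (Real.exp (-x ^ 2 / 2) * x * hermiteNorm 0 / 2) * h2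
  | succ n =>
    have h4 := mul_hermiteNorm_succ n
    rw [Nat.add_sub_cancel, hermiteVal_succ_succ]
    set E := Real.exp (-x ^ 2 / 2)
    linear_combination (E * Real.sqrt 2 * x * hermiteVal (n + 1) x / 2
        - E * (n + 1) * hermiteVal n x / 2) * h3
      - (E * x * hermiteNorm (n + 1) * hermiteVal (n + 1) x / 2) * h2
      + (E * hermiteVal n x * Real.sqrt 2 / 2) * h4
      + (E * hermiteVal n x * ladder (n + 1) * hermiteNorm n / 2) * h2

/-- The product rule gives `h_n' = 2 ladder n h_{n-1} - x h_n`, and the recurrence eliminates `x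
h_n`. -/
theorem hasDerivAt_hermiteFun (n : ℕ) (x : ℝ) :
    HasDerivAt (hermiteFun n)
      (ladder n * hermiteFun (n - 1) x - ladder (n + 1) * hermiteFun (n + 1) x) x := by
  have h1 : HasDerivAt (fun x : ℝ => Real.exp (-x ^ 2 / 2)) (Real.exp (-x ^ 2 / 2) * (-x)) x := by
    refine HasDerivAt.exp ?_
    refine (((hasDerivAt_pow 2 x).neg).div_const 2).congr_deriv ?_
    simp; ring
  have h2 := (h1.const_mul (hermiteNorm n)).mul (hasDerivAt_hermiteVal n x)
  refine h2.congr_deriv ?_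
  have h3 := mul_hermiteFun n x
  have h4 : Real.sqrt 2 * n * hermiteNorm n * hermiteVal (n - 1) x * Real.exp (-x ^ 2 / 2)
      = 2 * ladder n * hermiteFun (n - 1) x := by
    cases n with
    | zero => simp [ladder_zero]
    | succ n =>
      have h5 := mul_hermiteNorm_succ n
      have h6 : Real.sqrt 2 ^ 2 = 2 := Real.sq_sqrt (by positivity)
      rw [Nat.add_sub_cancel, hermiteFun_eq]
      push_cast
      linear_combination (Real.sqrt 2 * hermiteVal n x * Real.exp (-x ^ 2 / 2)) * h5
        + (ladder (n + 1) * hermiteNorm n * hermiteVal n x * Real.exp (-x ^ 2 / 2)) * h6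
  rw [hermiteFun_eq n] at h3
  linear_combination h4 - h3

/-! ### Orthonormality and the uniform bound -/

open MeasureTheory

theorem integrable_pow_mul_exp (n : ℕ) :
    Integrable fun x : ℝ => x ^ n * Real.exp (-x ^ 2) := by
  have := integrable_rpow_mul_exp_neg_mul_sq (b := 1) one_pos (s := n)
    (by have : (0 : ℝ) ≤ n := by positivity
        linarith)
  simpa [Real.rpow_natCast] using this

theorem integrable_polynomial_mul_exp (p : Polynomial ℝ) :
    Integrable fun x : ℝ => p.eval x * Real.exp (-x ^ 2) := by
  simp only [Polynomial.eval_eq_sum_range, Finset.sum_mul, mul_assoc]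
  exact integrable_finsetSum _ fun i _ => (integrable_pow_mul_exp i).const_mul _

theorem exists_hermiteFun_eq (n : ℕ) :
    ∃ p : Polynomial ℝ, ∀ x, hermiteFun n x = p.eval x * Real.exp (-x ^ 2 / 2) := by
  refine ⟨Polynomial.C (hermiteNorm n) *
    ((Polynomial.hermite n).map (Int.castRingHom ℝ)).comp
      (Polynomial.C (Real.sqrt 2) * Polynomial.X), fun x => ?_⟩
  rw [hermiteFun_eq, hermiteVal, Polynomial.aeval_def, Polynomial.eval_mul, Polynomial.eval_comp,
    Polynomial.eval_map]
  simp
  ring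

theorem integrable_hermiteFun_mul (m n : ℕ) :
    Integrable fun x => hermiteFun m x * hermiteFun n x := by
  obtain ⟨p, hp⟩ := exists_hermiteFun_eq m
  obtain ⟨q, hq⟩ := exists_hermiteFun_eq n
  refine (integrable_polynomial_mul_exp (p * q)).congr (Filter.Eventually.of_forall fun x => ?_)
  simp only [hp, hq, Polynomial.eval_mul]
  have : Real.exp (-x ^ 2) = Real.exp (-x ^ 2 / 2) * Real.exp (-x ^ 2 / 2) := by
    rw [← Real.exp_add]; ring_nf
  rw [this]; ring

/-- The `L²` inner products of the Hermite functions. -/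
def hermiteInner (m n : ℕ) : ℝ := ∫ x, hermiteFun m x * hermiteFun n x

theorem hermiteInner_zero_zero : hermiteInner 0 0 = 1 := by
  have h := integral_gaussian 1
  rw [div_one] at h
  have : ∀ x : ℝ, hermiteFun 0 x * hermiteFun 0 x
      = (Real.sqrt Real.pi)⁻¹ * Real.exp (-1 * x ^ 2) := by
    intro x
    have h1 : Real.exp (-1 * x ^ 2) = Real.exp (-x ^ 2 / 2) * Real.exp (-x ^ 2 / 2) := by
      rw [← Real.exp_add]; ring_nf
    have h2 : hermiteNorm 0 * hermiteNorm 0 = (Real.sqrt Real.pi)⁻¹ := by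
      rw [hermiteNorm, ← mul_inv, Real.mul_self_sqrt (by positivity)]; simp
    rw [hermiteFun_eq, hermiteVal_zero, h1, ← h2]; ring
  simp only [hermiteInner, this]
  rw [integral_const_mul, h, inv_mul_cancel₀ (by positivity)]

/-- Bookkeeping: the integrals needed below are combinations of at most four products of Hermite
functions, and empty slots receive coefficient zero. -/
theorem integral_ladder (a b c d : ℝ) (i j k l i' j' k' l' : ℕ) (f : ℝ → ℝ)
    (hf : ∀ x, f x = (a * (hermiteFun i x * hermiteFun i' x)
        + b * (hermiteFun j x * hermiteFun j' x))
      + (c * (hermiteFun k x * hermiteFun k' x) + d * (hermiteFun l x * hermiteFun l' x))) :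
    Integrable f ∧ ∫ x, f x = (a * hermiteInner i i' + b * hermiteInner j j')
      + (c * hermiteInner k k' + d * hermiteInner l l') := by
  have e : f = _ := funext hf
  have h1 := (integrable_hermiteFun_mul i i').const_mul a
  have h2 := (integrable_hermiteFun_mul j j').const_mul b
  have h3 := (integrable_hermiteFun_mul k k').const_mul c
  have h4 := (integrable_hermiteFun_mul l l').const_mul d
  constructor
  · rw [e]; exact (h1.add h2).add (h3.add h4)
  · have h5 := integral_add (h1.add h2) (h3.add h4)
    simp only [Pi.add_apply] at h5
    simp only [hf]
    rw [h5, integral_add h1 h2, integral_add h3 h4]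
    simp only [integral_const_mul, hermiteInner]

/-- Multiplication by `x` is symmetric; both sides evaluate `∫ x h_m h_n`. -/
theorem hermiteInner_mul_symm (m n : ℕ) :
    ladder n * hermiteInner m (n - 1) + ladder (n + 1) * hermiteInner m (n + 1)
      = ladder m * hermiteInner (m - 1) n + ladder (m + 1) * hermiteInner (m + 1) n := by
  have h1 := (integral_ladder (ladder n) (ladder (n + 1)) 0 0 m m 0 0 (n - 1) (n + 1) 0 0
    (fun x => x * (hermiteFun m x * hermiteFun n x))
    (fun x => by linear_combination hermiteFun m x * mul_hermiteFun n x)).2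
  have h2 := (integral_ladder (ladder m) (ladder (m + 1)) 0 0 (m - 1) (m + 1) 0 0 n n 0 0
    (fun x => x * (hermiteFun m x * hermiteFun n x))
    (fun x => by linear_combination hermiteFun n x * mul_hermiteFun m x)).2
  linarith

/-- Integration by parts; integrability of the product removes the boundary terms. -/
theorem hermiteInner_deriv_antisymm (m n : ℕ) :
    ladder n * hermiteInner m (n - 1) - ladder (n + 1) * hermiteInner m (n + 1)
      = -(ladder m * hermiteInner (m - 1) n - ladder (m + 1) * hermiteInner (m + 1) n) := by
  have h1 := integral_ladder (ladder n) (-ladder (n + 1)) 0 0 m m 0 0 (n - 1) (n + 1) 0 0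
    (fun x => hermiteFun m x *
      (ladder n * hermiteFun (n - 1) x - ladder (n + 1) * hermiteFun (n + 1) x))
    (fun x => by ring)
  have h2 := integral_ladder (ladder m) (-ladder (m + 1)) 0 0 (m - 1) (m + 1) 0 0 n n 0 0
    (fun x => (ladder m * hermiteFun (m - 1) x - ladder (m + 1) * hermiteFun (m + 1) x)
      * hermiteFun n x)
    (fun x => by ring)
  have h3 := integral_mul_deriv_eq_deriv_mul_of_integrable
    (fun x _ => hasDerivAt_hermiteFun m x) (fun x _ => hasDerivAt_hermiteFun n x) h1.1 h2.1
    (integrable_hermiteFun_mul m n)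
  linarith [h1.2, h2.2, h3]

/-- Adding the symmetry of `x` and the antisymmetry of `d/dx` shows that raising is adjoint to
lowering: `ladder (m+1) ⟨h_{m+1}, h_n⟩ = ladder n ⟨h_m, h_{n-1}⟩`. This lowers both indices at once.
-/
theorem hermiteInner_eq (m n : ℕ) : hermiteInner m n = if m = n then 1 else 0 := by
  induction m generalizing n with
  | zero =>
    cases n with
    | zero => simpa using hermiteInner_zero_zero
    | succ n =>
      have h1 := hermiteInner_mul_symm 0 n
      have h2 := hermiteInner_deriv_antisymm 0 n
      rw [ladder_zero] at h1 h2
      have h3 : ladder (n + 1) * hermiteInner 0 (n + 1) = 0 := by linarith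
      simpa [(ladder_pos n).ne'] using h3
  | succ m ih =>
    have h1 := hermiteInner_mul_symm m n
    have h2 := hermiteInner_deriv_antisymm m n
    have h3 : ladder (m + 1) * hermiteInner (m + 1) n = ladder n * hermiteInner m (n - 1) := by
      linarith
    cases n with
    | zero =>
      rw [ladder_zero, zero_mul] at h3
      simpa [(ladder_pos m).ne'] using h3
    | succ n =>
      rw [Nat.add_sub_cancel, ih] at h3
      by_cases h : m = n
      · subst h
        simpa [(ladder_pos m).ne'] using h3
      · simpa [(ladder_pos m).ne', h] using h3

/-- One has `h_n(x)² = ∫_{-∞}^x 2 h_n h_n' ≤ ∫ (h_n² + h_n'²)`, and the last integral equals `1 +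
n/2 + (n+1)/2` by orthonormality. -/
theorem sq_hermiteFun_le (n : ℕ) (x : ℝ) : hermiteFun n x ^ 2 ≤ n + 3 / 2 := by
  set d : ℝ → ℝ := fun x =>
    ladder n * hermiteFun (n - 1) x - ladder (n + 1) * hermiteFun (n + 1) x with hd
  have hD : ∀ x, HasDerivAt (fun x => hermiteFun n x * hermiteFun n x)
      (2 * (hermiteFun n x * d x)) x := fun x => by
    refine ((hasDerivAt_hermiteFun n x).mul (hasDerivAt_hermiteFun n x)).congr_deriv ?_
    simp only [hd]; ring
  have hdi := integral_ladder (2 * ladder n) (-2 * ladder (n + 1)) 0 0 n n 0 0 (n - 1) (n + 1) 0 0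
    (fun x => 2 * (hermiteFun n x * d x)) (fun x => by simp only [hd]; ring)
  have hq := integral_ladder 1 (ladder n ^ 2) (ladder (n + 1) ^ 2)
    (-2 * ladder n * ladder (n + 1)) n (n - 1) (n + 1) (n - 1) n (n - 1) (n + 1) (n + 1)
    (fun x => hermiteFun n x ^ 2 + d x ^ 2) (fun x => by simp only [hd]; ring)
  have hq2 : ∫ x, hermiteFun n x ^ 2 + d x ^ 2 = n + 3 / 2 := by
    rw [hq.2]
    simp only [hermiteInner_eq, ladder_sq]
    have : n - 1 ≠ n + 1 := by omega
    simp [this]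
    ring
  have hlim := tendsto_zero_of_hasDerivAt_of_integrableOn_Iic (a := x)
    (fun y _ => hD y) hdi.1.integrableOn (integrable_hermiteFun_mul n n).integrableOn
  have hint := integral_Iic_of_hasDerivAt_of_tendsto' (a := x) (fun y _ => hD y)
    hdi.1.integrableOn hlim
  rw [sub_zero] at hint
  rw [sq, ← hint, ← hq2]
  calc ∫ y in Set.Iic x, 2 * (hermiteFun n y * d y)
      ≤ ∫ y in Set.Iic x, (hermiteFun n y ^ 2 + d y ^ 2) := by
        refine integral_mono hdi.1.integrableOn hq.1.integrableOn fun y => ?_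
        simp only
        nlinarith [sq_nonneg (hermiteFun n y - d y)]
    _ ≤ _ := setIntegral_le_integral hq.1
        (Filter.Eventually.of_forall fun y => by simp only [Pi.zero_apply]; positivity)

theorem abs_hermiteFun_le (n : ℕ) (x : ℝ) : |hermiteFun n x| ≤ 2 * (1 + n) := by
  have h := sq_hermiteFun_le n x
  refine abs_le_of_sq_le_sq (h.trans ?_) (by positivity)
  have : (0 : ℝ) ≤ n := by positivity
  nlinarith

/-- Multiply by `h_k` and integrate term by term, which is legitimate because `∫ |h_n h_k| ≤ 1`;
orthonormality leaves only `a k`. -/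
theorem hermiteFun_independent {a : ℕ → ℂ} (ha : Summable fun n => ‖a n‖)
    (h : ∀ x, HasSum (fun n => a n * (hermiteFun n x : ℂ)) 0) : a = 0 := by
  funext k
  set F : ℕ → ℝ → ℂ := fun n x => a n * ((hermiteFun n x * hermiteFun k x : ℝ) : ℂ) with hF
  have hint : ∀ n, Integrable (F n) := fun n =>
    ((integrable_hermiteFun_mul n k).ofReal).const_mul _
  have hnorm : ∀ n, ∫ x, ‖F n x‖ ≤ ‖a n‖ := by
    intro n
    have hq := integral_ladder (1 / 2) (1 / 2) 0 0 n k 0 0 n k 0 0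
      (fun x => (hermiteFun n x ^ 2 + hermiteFun k x ^ 2) / 2) (fun x => by ring)
    have h1 : ∫ x, (hermiteFun n x ^ 2 + hermiteFun k x ^ 2) / 2 = 1 := by
      rw [hq.2]; simp [hermiteInner_eq]; norm_num
    calc ∫ x, ‖F n x‖ ≤ ∫ x, ‖a n‖ * ((hermiteFun n x ^ 2 + hermiteFun k x ^ 2) / 2) := by
          refine integral_mono (hint n).norm (hq.1.const_mul _) fun x => ?_
          simp only [hF]
          rw [norm_mul, Complex.norm_real]
          gcongr
          rw [Real.norm_eq_abs, abs_le]
          constructor <;> nlinarith [sq_nonneg (hermiteFun n x - hermiteFun k x),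
            sq_nonneg (hermiteFun n x + hermiteFun k x)]
      _ = ‖a n‖ := by rw [integral_const_mul, h1, mul_one]
  have hs := hasSum_integral_of_summable_integral_norm hint
    (Summable.of_nonneg_of_le (fun n => integral_nonneg fun _ => norm_nonneg _) hnorm ha)
  have hz : ∀ x, ∑' n, F n x = 0 := by
    intro x
    have := (h x).mul_right (hermiteFun k x : ℂ)
    rw [zero_mul] at this
    rw [← this.tsum_eq]
    exact tsum_congr fun n => by simp only [hF]; push_cast; ring
  have hv : ∀ n, ∫ x, F n x = a n * if n = k then 1 else 0 := by
    intro n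
    simp only [hF]
    rw [integral_const_mul, integral_complex_ofReal]
    change a n * (hermiteInner n k : ℂ) = _
    rw [hermiteInner_eq]
    split_ifs <;> simp
  simp only [hz, hv, integral_zero] at hs
  have h2 := hasSum_single (f := fun n => a n * if n = k then (1 : ℂ) else 0) k
    (fun n hn => by simp [hn])
  simpa using h2.unique hs

/-! ### The Hermite systems on the line and on the plane -/

theorem polynomialGrowth_nat : PolynomialGrowth fun n : ℕ => n := by
  refine ⟨2, ?_⟩
  have := (summable_nat_add_iff 1).2 (Real.summable_one_div_nat_pow.2 one_lt_two)
  refine this.congr fun n => ?_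
  push_cast
  rw [one_div, add_comm]

theorem polynomialGrowth_one : PolynomialGrowth (multiDeg 1) := by
  obtain ⟨q, hq⟩ := polynomialGrowth_nat
  refine ⟨q, ?_⟩
  refine ((Equiv.funUnique (Fin 1) ℕ).summable_iff.2 hq).congr fun n => ?_
  simp [multiDeg]

theorem polynomialGrowth_two : PolynomialGrowth (multiDeg 2) := by
  obtain ⟨q, hq⟩ := polynomialGrowth_nat
  -- Since `1 + i + j` dominates both `1 + i` and `1 + j`, the power `2q` dominates the product of
  -- two `q`-th powers.
  refine ⟨q + q, ?_⟩
  have h := hq.mul_of_nonneg hq (fun _ => by positivity) (fun _ => by positivity)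
  refine Summable.of_nonneg_of_le (fun _ => by positivity) (fun n => ?_)
    ((finTwoArrowEquiv ℕ).summable_iff.2 h)
  simp only [multiDeg, Fin.sum_univ_two, Function.comp_apply]
  have e0 : (finTwoArrowEquiv ℕ n).1 = n 0 := rfl
  have e1 : (finTwoArrowEquiv ℕ n).2 = n 1 := rfl
  rw [e0, e1, pow_add, mul_inv]
  push_cast
  have h0 : (0 : ℝ) ≤ n 0 := by positivity
  have h1 : (0 : ℝ) ≤ n 1 := by positivity
  gcongr <;> linarith

theorem hermiteFunD_one (n : Fin 1 → ℕ) (x : EuclideanSpace ℝ (Fin 1)) :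
    hermiteFunD 1 n x = hermiteFun (n 0) (x 0) := by simp [hermiteFunD]

theorem hermiteFunD_two (n : Fin 2 → ℕ) (x : EuclideanSpace ℝ (Fin 2)) :
    hermiteFunD 2 n x = hermiteFun (n 0) (x 0) * hermiteFun (n 1) (x 1) := by
  simp [hermiteFunD]

theorem isSystem_hermite_one : IsSystem (multiDeg 1) (hermiteFunD 1) where
  growth := polynomialGrowth_one
  bound := by
    refine ⟨2, 1, fun n x => ?_⟩
    rw [hermiteFunD_one, pow_one]
    simpa [multiDeg] using abs_hermiteFun_le (n 0) (x 0)
  independent := by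
    intro a ha h0
    set E := Equiv.funUnique (Fin 1) ℕ
    have h1 : (fun n => a (E.symm n)) = 0 := by
      refine hermiteFun_independent ?_ fun x => ?_
      · have := ha.summable polynomialGrowth_one 0
        simp only [pow_zero, mul_one] at this
        exact E.symm.summable_iff.2 this
      · have := E.symm.hasSum_iff.2 (h0 (WithLp.toLp 2 fun _ => x))
        refine this.congr_fun fun n => ?_
        simp [E, hermiteFunD_one]
    funext n
    have := congrFun h1 (E n)
    simpa using this

theorem isSystem_hermite_two : IsSystem (multiDeg 2) (hermiteFunD 2) where
  growth := polynomialGrowth_two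
  bound := by
    refine ⟨4, 2, fun n x => ?_⟩
    rw [hermiteFunD_two, abs_mul]
    have h0 := abs_hermiteFun_le (n 0) (x 0)
    have h1 := abs_hermiteFun_le (n 1) (x 1)
    have h2 : (0 : ℝ) ≤ n 0 := by positivity
    have h3 : (0 : ℝ) ≤ n 1 := by positivity
    refine (mul_le_mul h0 h1 (abs_nonneg _) (by positivity)).trans ?_
    simp only [multiDeg, Fin.sum_univ_two]
    push_cast
    nlinarith
  independent := by
    intro a ha h0
    set E := finTwoArrowEquiv ℕ
    set b : ℕ → ℕ → ℂ := fun i j => a (E.symm (i, j)) with hb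
    have hsum : Summable fun z : ℕ × ℕ => ‖b z.1 z.2‖ * (2 * (1 + z.2)) := by
      have h1 := (E.symm.summable_iff.2 (ha.summable polynomialGrowth_two 1)).mul_left 2
      refine Summable.of_nonneg_of_le (fun _ => by positivity) (fun z => ?_) h1
      simp only [hb, Function.comp_apply, multiDeg, Fin.sum_univ_two, pow_one]
      have h2 : (0 : ℝ) ≤ z.1 := by positivity
      have e0 : E.symm z 0 = z.1 := rfl
      have e1 : E.symm z 1 = z.2 := rfl
      rw [e0, e1]
      push_cast
      have h3 := norm_nonneg (a (E.symm z))
      change ‖a (E.symm z)‖ * _ ≤ _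
      nlinarith
    have hsumn : Summable fun z : ℕ × ℕ => ‖b z.1 z.2‖ :=
      Summable.of_nonneg_of_le (fun _ => norm_nonneg _) (fun z => by
        have h2 : (0 : ℝ) ≤ z.2 := by positivity
        nlinarith [norm_nonneg (b z.1 z.2)]) hsum
    have hsumy : ∀ y, Summable fun z : ℕ × ℕ => b z.1 z.2 * (hermiteFun z.2 y : ℂ) := fun y =>
      Summable.of_norm_bounded hsum fun z => by
        rw [norm_mul, Complex.norm_real]
        gcongr
        exact abs_hermiteFun_le _ _
    -- For fixed `y` the double series is a Hermite series in `x`, so its coefficients vanish. Each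
    -- coefficient is in turn a Hermite series in `y`.
    have hcol : ∀ y, (fun i => ∑' j, b i j * (hermiteFun j y : ℂ)) = 0 := by
      intro y
      refine hermiteFun_independent ?_ fun x => ?_
      · have h1 := (hsumy y).norm
        rw [summable_prod_of_nonneg (fun _ => norm_nonneg _)] at h1
        refine Summable.of_nonneg_of_le (fun _ => norm_nonneg _) (fun i => ?_) h1.2
        exact norm_tsum_le_tsum_norm (h1.1 i)
      · have h1 := E.symm.hasSum_iff.2 (h0 (WithLp.toLp 2 ![x, y]))
        refine h1.prod_fiberwise fun i => ?_
        have h2 := (((hsumy y).prod_factor i).hasSum).mul_right (hermiteFun i x : ℂ)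
        refine h2.congr_fun fun j => ?_
        simp only [Function.comp_apply, hermiteFunD_two, hb]
        have e0 : E.symm (i, j) 0 = i := rfl
        have e1 : E.symm (i, j) 1 = j := rfl
        rw [e0, e1]
        simp
        ring
    have hrow : ∀ i, b i = 0 := fun i => by
      refine hermiteFun_independent (hsumn.prod_factor i) fun y => ?_
      have h1 := ((hsumy y).prod_factor i).hasSum
      have h2 := congrFun (hcol y) i
      simp only [Pi.zero_apply] at h2
      rwa [h2] at h1
    funext n
    have := congrFun (hrow (n 0)) (n 1)
    have e : E.symm (n 0, n 1) = n := E.symm_apply_apply n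
    simpa [hb, e] using this

/-! ### Laguerre polynomials -/

/-- The difference of two consecutive Laguerre polynomials. -/
def laguerreDiff (n : ℕ) (x : ℝ) : ℝ :=
  ∑ k ∈ Finset.range (n + 1),
    (-1) ^ (k + 1) * (n.choose k : ℝ) * x ^ (k + 1) / ((k + 1).factorial : ℝ)

theorem laguerrePoly_zero (x : ℝ) : laguerrePoly 0 x = 1 := by simp [laguerrePoly]

theorem laguerrePoly_at_zero (n : ℕ) : laguerrePoly n 0 = 1 := by
  rw [laguerrePoly, Finset.sum_eq_single 0]
  · simp
  · intro k _ hk; simp [hk]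
  · simp

/-- Pascal's rule for the binomial coefficients. -/
theorem laguerrePoly_succ (n : ℕ) (x : ℝ) :
    laguerrePoly (n + 1) x = laguerrePoly n x + laguerreDiff n x := by
  have h : laguerrePoly n x = ∑ k ∈ Finset.range (n + 1 + 1),
      (-1) ^ k * (n.choose k : ℝ) * x ^ k / (k.factorial : ℝ) := by
    rw [Finset.sum_range_succ, laguerrePoly]; simp
  rw [h, laguerrePoly, laguerreDiff, Finset.sum_range_succ', Finset.sum_range_succ' _ (n + 1),
    add_right_comm, ← Finset.sum_add_distrib]
  simp only [Nat.choose_succ_succ]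
  congr 1
  · refine Finset.sum_congr rfl fun k _ => ?_
    push_cast
    ring
  · simp

theorem hasDerivAt_pow_div_factorial (k : ℕ) (c x : ℝ) :
    HasDerivAt (fun x : ℝ => c * x ^ (k + 1) / ((k + 1).factorial : ℝ))
      (c * x ^ k / (k.factorial : ℝ)) x := by
  refine (((hasDerivAt_pow (k + 1) x).const_mul c).div_const _).congr_deriv ?_
  rw [Nat.factorial_succ, Nat.add_sub_cancel]
  push_cast
  field_simp

theorem hasDerivAt_laguerreDiff (n : ℕ) (x : ℝ) :
    HasDerivAt (laguerreDiff n) (-laguerrePoly n x) x := by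
  have := HasDerivAt.fun_sum (u := Finset.range (n + 1)) fun k _ =>
    hasDerivAt_pow_div_factorial k ((-1) ^ (k + 1) * (n.choose k : ℝ)) x
  refine this.congr_deriv ?_
  rw [laguerrePoly, ← Finset.sum_neg_distrib]
  exact Finset.sum_congr rfl fun k _ => by ring

theorem hasDerivAt_laguerrePoly (n : ℕ) (x : ℝ) :
    HasDerivAt (laguerrePoly n) (-∑ j ∈ Finset.range n, laguerrePoly j x) x := by
  induction n with
  | zero =>
    have : laguerrePoly 0 = fun _ => 1 := funext laguerrePoly_zero
    rw [this]
    simpa using hasDerivAt_const x (1 : ℝ)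
  | succ n ih =>
    have : laguerrePoly (n + 1) = fun x => laguerrePoly n x + laguerreDiff n x :=
      funext (laguerrePoly_succ n)
    rw [this]
    refine (ih.add (hasDerivAt_laguerreDiff n x)).congr_deriv ?_
    rw [Finset.sum_range_succ]; ring

/-- Two expressions for `L_{n+1}'` are compared: minus the sum of the lower polynomials, and the
derivative of the explicit sum, whose multiple by `x` is reduced by `(k+1) binom(n+1, k+1) = (n+1)
binom(n, k)`. -/
theorem mul_sum_laguerrePoly (n : ℕ) (x : ℝ) :
    x * ∑ j ∈ Finset.range (n + 1), laguerrePoly j x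
      = (n + 1) * (laguerrePoly n x - laguerrePoly (n + 1) x) := by
  have h1 : HasDerivAt (laguerrePoly (n + 1)) (∑ k ∈ Finset.range (n + 1),
      (-1) ^ (k + 1) * ((n + 1).choose (k + 1) : ℝ) * x ^ k / (k.factorial : ℝ)) x := by
    have h2 := (HasDerivAt.fun_sum (u := Finset.range (n + 1)) fun k _ =>
      hasDerivAt_pow_div_factorial k ((-1) ^ (k + 1) * ((n + 1).choose (k + 1) : ℝ)) x).add_const 1
    refine h2.congr_of_eventuallyEq (Filter.Eventually.of_forall fun y => ?_)
    rw [laguerrePoly, Finset.sum_range_succ']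
    simp
  have h3 := (hasDerivAt_laguerrePoly (n + 1) x).unique h1
  have h4 : x * (∑ k ∈ Finset.range (n + 1),
      (-1) ^ (k + 1) * ((n + 1).choose (k + 1) : ℝ) * x ^ k / (k.factorial : ℝ))
      = (n + 1) * laguerreDiff n x := by
    rw [laguerreDiff, Finset.mul_sum, Finset.mul_sum]
    refine Finset.sum_congr rfl fun k _ => ?_
    have h5 : ((n + 1).choose (k + 1) : ℝ) * (k + 1) = (n + 1) * n.choose k := by
      exact_mod_cast (Nat.add_one_mul_choose_eq n k).symm
    rw [Nat.factorial_succ, pow_succ x]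
    push_cast
    field_simp
    linear_combination x * x ^ k * h5
  rw [laguerrePoly_succ]
  linear_combination -x * h3 - h4

/-! ### Three-term recurrences -/

/-- The recurrence satisfied by the Laguerre polynomials of parameter `β - 1`. -/
def LaguerreRec (β x : ℝ) (f : ℕ → ℝ) : Prop :=
  f 1 = (β - x) * f 0 ∧
    ∀ n : ℕ, (n + 2) * f (n + 2) = (2 * (n + 1) + β - x) * f (n + 1) - (n + β) * f n

theorem laguerreRec_laguerrePoly (x : ℝ) : LaguerreRec 1 x fun n => laguerrePoly n x := by
  have key := fun n => mul_sum_laguerrePoly n x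
  constructor
  · have := key 0
    simp [laguerrePoly_zero] at this ⊢
    linarith
  · intro n
    have h1 := key n
    have h2 := key (n + 1)
    rw [Finset.sum_range_succ] at h2
    push_cast at h2
    linear_combination h2 - h1

-- The recurrence is the coefficientwise form of the differential equation of the generating
-- function `(1 - t)^{-β} exp(-x t / (1 - t))`. No closed form is needed, only that the equation is
-- multiplicative in its solutions.
open PowerSeries in
theorem laguerreRec_iff (β x : ℝ) (f : ℕ → ℝ) : LaguerreRec β x f ↔
    (1 - X) ^ 2 * d⁄dX ℝ (mk f) = (C β * (1 - X) - C x) * mk f := by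
  have e1 : (1 - X) ^ 2 * d⁄dX ℝ (mk f)
      = d⁄dX ℝ (mk f) - C 2 * (X * d⁄dX ℝ (mk f)) + X * (X * d⁄dX ℝ (mk f)) := by
    rw [map_ofNat]; ring
  have e2 : (C β * (1 - X) - C x) * mk f = C β * mk f - C x * mk f - C β * (X * mk f) := by
    ring
  rw [e1, e2]
  constructor
  · rintro ⟨h0, h⟩
    ext n
    match n with
    | 0 =>
      simp only [map_add, map_sub, coeff_C_mul, coeff_zero_X_mul, coeff_derivative, coeff_mk]
      push_cast
      linear_combination h0
    | 1 =>
      have := h 0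
      simp only [map_add, map_sub, coeff_C_mul, coeff_zero_X_mul, coeff_succ_X_mul,
        coeff_derivative, coeff_mk]
      push_cast at this ⊢
      linear_combination this
    | n + 2 =>
      have := h (n + 1)
      simp only [map_add, map_sub, coeff_C_mul, coeff_succ_X_mul, coeff_derivative, coeff_mk]
      push_cast at this ⊢
      linear_combination this
  · intro h
    have hc := fun n => congrArg (coeff n) h
    refine ⟨?_, fun n => ?_⟩
    · have := hc 0
      simp only [map_add, map_sub, coeff_C_mul, coeff_zero_X_mul, coeff_derivative, coeff_mk] at this
      push_cast at this
      linear_combination this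
    · match n with
      | 0 =>
        have := hc 1
        simp only [map_add, map_sub, coeff_C_mul, coeff_zero_X_mul, coeff_succ_X_mul,
          coeff_derivative, coeff_mk] at this
        push_cast at this ⊢
        linear_combination this
      | n + 1 =>
        have := hc (n + 2)
        simp only [map_add, map_sub, coeff_C_mul, coeff_succ_X_mul, coeff_derivative,
          coeff_mk] at this
        push_cast at this ⊢
        linear_combination this

theorem LaguerreRec.ext {β x : ℝ} {f g : ℕ → ℝ} (hf : LaguerreRec β x f)
    (hg : LaguerreRec β x g) (h0 : f 0 = g 0) (n : ℕ) : f n = g n := by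
  induction n using Nat.strong_induction_on with
  | _ n ih =>
    match n with
    | 0 => exact h0
    | 1 => rw [hf.1, hg.1, h0]
    | n + 2 =>
      have h1 := hf.2 n
      rw [ih n (by omega), ih (n + 1) (by omega), ← hg.2 n] at h1
      exact mul_left_cancel₀ (by positivity) h1

-- Logarithmic derivatives add, so a product of two generating functions solves the equation with
-- parameters `β + γ` and `x + y`. This is the addition theorem for Laguerre polynomials.
open PowerSeries in
theorem LaguerreRec.mul {β x γ y : ℝ} {f g : ℕ → ℝ} (hf : LaguerreRec β x f)
    (hg : LaguerreRec γ y g) :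
    LaguerreRec (β + γ) (x + y) fun n => ∑ z ∈ antidiagonal n, f z.1 * g z.2 := by
  rw [laguerreRec_iff] at *
  have h : (mk fun n => ∑ z ∈ antidiagonal n, f z.1 * g z.2) = mk f * mk g := by
    ext n
    simp [coeff_mul]
  rw [h, Derivation.leibniz, smul_eq_mul, smul_eq_mul, map_add, map_add]
  linear_combination mk g * hf + mk f * hg

/-! ### Even Hermite functions -/

/-- The value `(-1)^i H_{2i}(x) / (4^i i!)`, i.e. `L_i^{(-1/2)}(x²)`. -/
def hermiteEvenVal (i : ℕ) (x : ℝ) : ℝ :=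
  (-1) ^ i / (2 ^ i * (i.factorial : ℝ)) * hermiteVal (2 * i) x

theorem hermiteEvenVal_zero (x : ℝ) : hermiteEvenVal 0 x = 1 := by
  simp [hermiteEvenVal, hermiteVal_zero]

theorem laguerreRec_hermiteEvenVal (x : ℝ) :
    LaguerreRec (1 / 2) (x ^ 2) fun i => hermiteEvenVal i x := by
  have h2 : Real.sqrt 2 ^ 2 = 2 := Real.sq_sqrt (by positivity)
  constructor
  · have h := hermiteVal_succ_succ 0 x
    rw [zero_add, zero_add, hermiteVal_one, hermiteVal_zero] at h
    simp [hermiteEvenVal, h, hermiteVal_zero]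
    linear_combination (-x ^ 2 / 2) * h2
  · intro n
    have h3 := hermiteVal_succ_succ (2 * n + 2) x
    have h4 := hermiteVal_succ_succ (2 * n + 1) x
    have h5 := hermiteVal_succ_succ (2 * n) x
    push_cast at h3 h4 h5
    -- Three consecutive steps of the Hermite recurrence are combined to eliminate the odd indices.
    have h6 : hermiteVal (2 * n + 2 + 2) x = (2 * x ^ 2 - 4 * n - 5) * hermiteVal (2 * n + 2) x
        - (2 * n + 2) * (2 * n + 1) * hermiteVal (2 * n) x := by
      linear_combination h3 + Real.sqrt 2 * x * h4 + (2 * n + 2) * h5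
        + x ^ 2 * hermiteVal (2 * n + 2) x * h2
    have e1 : 2 * (n + 2) = 2 * n + 2 + 2 := by ring
    have e2 : 2 * (n + 1) = 2 * n + 2 := by ring
    simp only [hermiteEvenVal, e1, e2, h6, Nat.factorial_succ, pow_succ]
    push_cast
    field_simp
    ring

/-- The addition theorem with `β = γ = 1/2`: two factors of Laguerre parameter `-1/2`, the even
Hermite polynomials, multiply to parameter `0`. -/
theorem laguerrePoly_sq_add_sq (n : ℕ) (x y : ℝ) : laguerrePoly n (x ^ 2 + y ^ 2) =
    ∑ z ∈ antidiagonal n, hermiteEvenVal z.1 x * hermiteEvenVal z.2 y := by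
  have h := (laguerreRec_hermiteEvenVal x).mul (laguerreRec_hermiteEvenVal y)
  rw [add_halves] at h
  exact (laguerreRec_laguerrePoly (x ^ 2 + y ^ 2)).ext h
    (by simp [laguerrePoly_zero, hermiteEvenVal_zero]) n

/-! ### Normalizing constants of the even Hermite functions -/

/-- The values at the origin, `binom(2i, i) / 4^i`. -/
def evenOrigin (i : ℕ) : ℝ := hermiteEvenVal i 0

theorem evenOrigin_succ (i : ℕ) : (2 * (i + 1)) * evenOrigin (i + 1) = (2 * i + 1) * evenOrigin i := by
  have h := hermiteVal_succ_succ (2 * i) 0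
  have e2 : 2 * (i + 1) = 2 * i + 2 := by ring
  simp only [evenOrigin, hermiteEvenVal, e2, h, Nat.factorial_succ, pow_succ]
  push_cast
  field_simp
  ring

theorem evenOrigin_zero : evenOrigin 0 = 1 := hermiteEvenVal_zero 0

theorem evenOrigin_pos (i : ℕ) : 0 < evenOrigin i := by
  induction i with
  | zero => rw [evenOrigin_zero]; exact one_pos
  | succ i ih =>
    have h := evenOrigin_succ i
    have h1 : 0 < (2 * (i : ℝ) + 1) * evenOrigin i := by positivity
    rw [← h] at h1
    exact pos_of_mul_pos_right h1 (by positivity)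

theorem evenOrigin_succ_le (i : ℕ) : evenOrigin (i + 1) ≤ evenOrigin i := by
  have h := evenOrigin_succ i
  have h0 : (0 : ℝ) ≤ i := by positivity
  nlinarith [evenOrigin_pos i, evenOrigin_pos (i + 1)]

theorem evenOrigin_le_one (i : ℕ) : evenOrigin i ≤ 1 := by
  induction i with
  | zero => rw [evenOrigin_zero]
  | succ i ih => exact (evenOrigin_succ_le i).trans ih

/-- The central binomial ratio decays only polynomially; this keeps the inverses of the normalizing
factors polynomially bounded. -/
theorem one_le_mul_evenOrigin (i : ℕ) : 1 ≤ (2 * i + 1) * evenOrigin i := by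
  induction i with
  | zero => rw [evenOrigin_zero]; simp
  | succ i ih =>
    have h := evenOrigin_succ i
    have := evenOrigin_pos (i + 1)
    push_cast
    nlinarith

/-- The addition formula at the origin, where every `L_n` equals `1`. -/
theorem sum_evenOrigin (n : ℕ) :
    ∑ z ∈ antidiagonal n, evenOrigin z.1 * evenOrigin z.2 = 1 := by
  have := laguerrePoly_sq_add_sq n 0 0
  simpa [laguerrePoly_at_zero, evenOrigin] using this.symm

/-- The factors relating `h_{2i}` to `L_i^{(-1/2)}`. -/
def evenCoeff (i : ℕ) : ℝ := (-1) ^ i / (2 ^ i * (i.factorial : ℝ) * hermiteNorm (2 * i))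

theorem evenCoeff_mul_hermiteFun (i : ℕ) (x : ℝ) :
    evenCoeff i * hermiteFun (2 * i) x = hermiteEvenVal i x * Real.exp (-x ^ 2 / 2) := by
  have := (hermiteNorm_pos (2 * i)).ne'
  rw [evenCoeff, hermiteFun_eq, hermiteEvenVal]
  field_simp

theorem evenCoeff_mul_hermiteFun_zero (i : ℕ) :
    evenCoeff i * hermiteFun (2 * i) 0 = evenOrigin i := by
  rw [evenCoeff_mul_hermiteFun, evenOrigin]; simp

/-- This ratio of consecutive factors is what makes the radial vectors solve the kernel equation of
the generator of rotations. -/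
theorem evenCoeff_succ (i : ℕ) :
    ladder (2 * i + 2) * evenCoeff (i + 1) = -(ladder (2 * i + 1) * evenCoeff i) := by
  have h1 := hermiteNorm_succ (2 * i)
  have h2 := hermiteNorm_succ (2 * i + 1)
  have p1 := hermiteNorm_pos (2 * i + 2)
  have p2 := ladder_pos (2 * i)
  have p3 := ladder_pos (2 * i + 1)
  have s2 : Real.sqrt 2 ^ 2 = 2 := Real.sq_sqrt (by positivity)
  have s3 := ladder_sq (2 * i + 2)
  have e2 : 2 * (i + 1) = 2 * i + 2 := by ring
  have h3 : hermiteNorm (2 * i) = 2 * ladder (2 * i + 1) * ladder (2 * i + 2)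
      * hermiteNorm (2 * i + 2) := by
    rw [h1, h2]
    linear_combination ladder (2 * i + 1) * ladder (2 * i + 2) * hermiteNorm (2 * i + 2) * s2
  have p4 : 0 < Real.sqrt 2 := by positivity
  push_cast at s3
  simp only [evenCoeff, e2, h3, Nat.factorial_succ, pow_succ]
  push_cast
  rw [mul_div_assoc', mul_div_assoc', neg_div', div_eq_div_iff (by positivity) (by positivity)]
  linear_combination (-1) ^ (i + 1) * 2 * ladder (2 * i + 1) * hermiteNorm (2 * i + 2)
    * 2 ^ i * i.factorial * s3

theorem evenCoeff_sq (i : ℕ) : evenCoeff i ^ 2 = Real.sqrt Real.pi * evenOrigin i := by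
  induction i with
  | zero =>
    rw [evenOrigin_zero, evenCoeff, hermiteNorm]
    simp
  | succ i ih =>
    have h1 := evenCoeff_succ i
    have h2 := evenOrigin_succ i
    have h3 := ladder_sq (2 * i + 1)
    have h4 := ladder_sq (2 * i + 2)
    push_cast at h3 h4
    have h5 : ladder (2 * i + 2) ^ 2 * evenCoeff (i + 1) ^ 2
        = ladder (2 * i + 1) ^ 2 * evenCoeff i ^ 2 := by
      rw [← mul_pow, h1]; ring
    rw [h3, h4, ih] at h5
    have h6 : (2 * (i : ℝ) + 2) ≠ 0 := by positivity
    apply mul_left_cancel₀ h6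
    linear_combination 2 * h5 - Real.sqrt Real.pi * h2

theorem sqrt_pi_le : Real.sqrt Real.pi ≤ 2 := by
  rw [Real.sqrt_le_left (by norm_num)]
  linarith [Real.pi_le_four]

theorem one_le_sqrt_pi : 1 ≤ Real.sqrt Real.pi := by
  rw [Real.one_le_sqrt]
  linarith [Real.pi_gt_three]

theorem evenCoeff_ne_zero (i : ℕ) : evenCoeff i ≠ 0 := by
  intro h
  have := evenCoeff_sq i
  rw [h] at this
  have h1 := evenOrigin_pos i
  have h2 : 0 < Real.sqrt Real.pi * evenOrigin i := by positivity
  simp at this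
  rcases this with h | h <;> linarith [one_le_sqrt_pi]

theorem abs_evenCoeff_le (i : ℕ) : |evenCoeff i| ≤ 2 := by
  refine abs_le_of_sq_le_sq ?_ (by norm_num)
  rw [evenCoeff_sq]
  nlinarith [evenOrigin_le_one i, evenOrigin_pos i, sqrt_pi_le, one_le_sqrt_pi]

theorem abs_inv_evenCoeff_le (i : ℕ) : |(evenCoeff i)⁻¹| ≤ 2 * i + 1 := by
  refine abs_le_of_sq_le_sq ?_ (by positivity)
  have h0 := evenOrigin_pos i
  have h1 := one_le_mul_evenOrigin i
  have h2 : (0 : ℝ) ≤ i := by positivity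
  have h3 := one_le_sqrt_pi
  have h4 : evenOrigin i ≤ Real.sqrt Real.pi * evenOrigin i := by nlinarith
  rw [inv_pow, evenCoeff_sq, inv_le_comm₀ (by positivity) (by positivity)]
  refine le_trans ?_ h4
  rw [inv_le_iff_one_le_mul₀ (by positivity)]
  nlinarith

/-- The squared `L²` norm of `l_n(|x|²)` on the plane, read off from its Hermite coefficients; it
explains the factor `1/π` in the radial projection. -/
theorem sum_evenCoeff_sq (n : ℕ) :
    ∑ z ∈ antidiagonal n, (evenCoeff z.1 * evenCoeff z.2) ^ 2 = Real.pi := by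
  have h : ∀ z ∈ antidiagonal n, (evenCoeff z.1 * evenCoeff z.2) ^ 2
      = Real.pi * (evenOrigin z.1 * evenOrigin z.2) := fun z _ => by
    rw [mul_pow, evenCoeff_sq, evenCoeff_sq]
    linear_combination evenOrigin z.1 * evenOrigin z.2 * Real.sq_sqrt Real.pi_nonneg
  rw [Finset.sum_congr rfl h, ← Finset.mul_sum, sum_evenOrigin, mul_one]

/-- The Laguerre functions in terms of products of even Hermite functions. -/
theorem laguerreFun_eq_sum (n : ℕ) (r : ℝ≥0) (x y : ℝ) (h : (r : ℝ) = x ^ 2 + y ^ 2) :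
    laguerreFun n r = ∑ z ∈ antidiagonal n,
      (evenCoeff z.1 * evenCoeff z.2) * (hermiteFun (2 * z.1) x * hermiteFun (2 * z.2) y) := by
  rw [laguerreFun, h, laguerrePoly_sq_add_sq, Finset.sum_mul]
  refine Finset.sum_congr rfl fun z _ => ?_
  have e : Real.exp (-(x ^ 2 + y ^ 2) / 2) = Real.exp (-x ^ 2 / 2) * Real.exp (-y ^ 2 / 2) := by
    rw [← Real.exp_add]; ring_nf
  have h1 := evenCoeff_mul_hermiteFun z.1 x
  have h2 := evenCoeff_mul_hermiteFun z.2 y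
  rw [e, mul_mul_mul_comm (evenCoeff z.1), h1, h2]
  ring

theorem laguerreFun_eq_sum_one (n : ℕ) (r : ℝ≥0) (x : ℝ) (h : (r : ℝ) = x ^ 2) :
    laguerreFun n r = ∑ z ∈ antidiagonal n,
      evenOrigin z.2 * evenCoeff z.1 * hermiteFun (2 * z.1) x := by
  rw [laguerreFun_eq_sum n r x 0 (by rw [h]; ring)]
  refine Finset.sum_congr rfl fun z _ => ?_
  rw [← evenCoeff_mul_hermiteFun_zero z.2]
  ring

/-! ### Even Hermite functions in terms of Laguerre functions -/

/-- The convolution inverse of `evenOrigin`. -/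
def evenOriginInv : ℕ → ℝ
  | 0 => 1
  | n + 1 => evenOrigin (n + 1) - evenOrigin n

theorem abs_evenOriginInv_le (n : ℕ) : |evenOriginInv n| ≤ 1 := by
  cases n with
  | zero => simp [evenOriginInv]
  | succ n =>
    rw [evenOriginInv, abs_le]
    constructor <;> linarith [evenOrigin_pos n, evenOrigin_pos (n + 1), evenOrigin_le_one n,
      evenOrigin_le_one (n + 1)]

-- Let `B` be the generating function of `evenOrigin`. Then `B² = 1/(1 - t)`, so the inverse of `B`
-- is `(1 - t) B`, whose coefficients are successive differences.
open PowerSeries in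
theorem evenOriginInv_mul : mk evenOriginInv * mk evenOrigin = 1 := by
  have h1 : mk evenOriginInv = (1 - X) * mk evenOrigin := by
    ext n
    rw [sub_mul, one_mul, map_sub]
    cases n with
    | zero => simp [evenOriginInv, evenOrigin_zero]
    | succ n => simp [evenOriginInv, coeff_succ_X_mul]
  have h2 : mk evenOrigin * mk evenOrigin = mk 1 := by
    ext n
    simpa [coeff_mul] using sum_evenOrigin n
  rw [h1, mul_assoc, h2, mul_comm]
  exact PowerSeries.mk_one_mul_one_sub_eq_one ℝ

-- On the axis `y = 0` the Laguerre functions are the convolution of the scaled even Hermite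
-- functions with `evenOrigin`; convolving with the inverse sequence solves for the latter.
open PowerSeries in
theorem hermiteFun_eq_sum (n : ℕ) (r : ℝ≥0) (x : ℝ) (h : (r : ℝ) = x ^ 2) :
    hermiteFun (2 * n) x = ∑ z ∈ antidiagonal n,
      (evenCoeff n)⁻¹ * evenOriginInv z.2 * laguerreFun z.1 r := by
  have h1 : (mk fun n => laguerreFun n r)
      = (mk fun i => evenCoeff i * hermiteFun (2 * i) x) * mk evenOrigin := by
    ext n
    rw [coeff_mk, coeff_mul, laguerreFun_eq_sum_one n r x h]
    exact Finset.sum_congr rfl fun z _ => by simp only [coeff_mk]; ring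
  have h2 : (mk fun n => laguerreFun n r) * mk evenOriginInv
      = mk fun i => evenCoeff i * hermiteFun (2 * i) x := by
    rw [h1, mul_assoc, mul_comm (mk evenOrigin), evenOriginInv_mul, mul_one]
  have h3 := congrArg (coeff n) h2
  rw [coeff_mk, coeff_mul] at h3
  simp only [coeff_mk] at h3
  rw [← inv_mul_cancel_left₀ (evenCoeff_ne_zero n) (hermiteFun (2 * n) x), ← h3, Finset.mul_sum]
  exact Finset.sum_congr rfl fun z _ => by ring

/-! ### Kernels given by finite sums -/

section SumKernel

variable {ι ι' σ : Type*}

/-- The kernel whose row `n` is `∑_{s ∈ S n} c n s δ_{f n s}`. -/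
def sumKernel (S : ι → Finset σ) (f : ι → σ → ι') (c : ι → σ → ℂ) : ι → ι' →₀ ℂ := fun n =>
  ∑ s ∈ S n, Finsupp.single (f n s) (c n s)

variable {S : ι → Finset σ} {f : ι → σ → ι'} {c : ι → σ → ℂ}

theorem sumKernel_sum_smul {M : Type*} [AddCommGroup M] [Module ℂ M] (n : ι) (v : ι' → M) :
    ((sumKernel S f c n).sum fun m a => a • v m) = ∑ s ∈ S n, c n s • v (f n s) := by
  rw [← Finsupp.linearCombination_apply, sumKernel, map_sum]
  simp

theorem sumKernel_sum (n : ι) (E : ι' → ℂ) :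
    ∑ m ∈ (sumKernel S f c n).support, sumKernel S f c n m * E m
      = ∑ s ∈ S n, c n s * E (f n s) := by
  have := sumKernel_sum_smul (S := S) (f := f) (c := c) n E
  simpa [Finsupp.sum] using this

/-- The targets `f n s` need not be distinct for fixed `n`; collisions can only decrease the sum of
absolute values of the row. -/
theorem isKernel_sumKernel {deg : ι → ℕ} {deg' : ι' → ℕ} (C : ℝ) (p : ℕ)
    (hC : ∀ n, ∑ s ∈ S n, ‖c n s‖ ≤ C * (1 + (deg n : ℝ)) ^ p) (D : ℕ)
    (hD : ∀ n, ∀ s ∈ S n, c n s ≠ 0 → deg' (f n s) ≤ D * deg n) :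
    IsKernel deg deg' (sumKernel S f c) where
  bound := by
    classical
    refine ⟨C, p, fun n => le_trans ?_ (hC n)⟩
    calc ∑ m ∈ (sumKernel S f c n).support, ‖sumKernel S f c n m‖
        ≤ ∑ m ∈ (sumKernel S f c n).support, ∑ s ∈ S n, if f n s = m then ‖c n s‖ else 0 := by
          refine Finset.sum_le_sum fun m _ => ?_
          rw [sumKernel, Finsupp.finsetSum_apply]
          refine norm_sum_le_of_le _ fun s _ => ?_
          rw [Finsupp.single_apply]
          split_ifs <;> simp
      _ = ∑ s ∈ S n, ∑ m ∈ (sumKernel S f c n).support, if f n s = m then ‖c n s‖ else 0 :=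
          Finset.sum_comm
      _ ≤ ∑ s ∈ S n, ‖c n s‖ := by
          refine Finset.sum_le_sum fun s _ => ?_
          rw [Finset.sum_ite_eq]
          split_ifs <;> simp
  support := by
    classical
    refine ⟨D, fun n m hm => ?_⟩
    rw [sumKernel, Finsupp.finsetSum_apply] at hm
    obtain ⟨s, hs, h⟩ := Finset.exists_ne_zero_of_sum_ne_zero hm
    rw [Finsupp.single_apply] at h
    split_ifs at h with he
    · exact he ▸ hD n s hs h
    · exact absurd rfl h

/-- Diagonal kernels. -/
def diagKernel (l : ι → ℂ) : ι → ι →₀ ℂ :=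
  sumKernel (fun _ => {()}) (fun n _ => n) fun n _ => l n

theorem isKernel_diagKernel {deg : ι → ℕ} {l : ι → ℂ} (C : ℝ) (p : ℕ)
    (hC : ∀ n, ‖l n‖ ≤ C * (1 + (deg n : ℝ)) ^ p) : IsKernel deg deg (diagKernel l) :=
  isKernel_sumKernel C p (fun n => by simpa using hC n) 1 (fun n s _ _ => by simp)

theorem diagKernel_sum (l : ι → ℂ) (n : ι) (E : ι → ℂ) :
    ∑ m ∈ (diagKernel l n).support, diagKernel l n m * E m = l n * E n := by
  rw [diagKernel, sumKernel_sum, Finset.sum_singleton]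

theorem diagKernel_sum_smul {M : Type*} [AddCommGroup M] [Module ℂ M] (l : ι → ℂ) (n : ι)
    (v : ι → M) : ((diagKernel l n).sum fun m a => a • v m) = l n • v n := by
  rw [diagKernel, sumKernel_sum_smul, Finset.sum_singleton]

end SumKernel

/-! ### The Laguerre system and the radial lift -/

/-- The kernel of `φ ↦ φ(|x|²)` from the half line to the plane. -/
def liftKernel : ℕ → (Fin 2 → ℕ) →₀ ℂ :=
  sumKernel antidiagonal (fun _ z => ![2 * z.1, 2 * z.2])
    fun _ z => ((evenCoeff z.1 * evenCoeff z.2 : ℝ) : ℂ)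

theorem abs_evenCoeff_mul_le (i j : ℕ) : |evenCoeff i * evenCoeff j| ≤ 4 := by
  rw [abs_mul]
  nlinarith [abs_evenCoeff_le i, abs_evenCoeff_le j, abs_nonneg (evenCoeff i),
    abs_nonneg (evenCoeff j)]

theorem isKernel_liftKernel : IsKernel (fun n : ℕ => n) (multiDeg 2) liftKernel := by
  refine isKernel_sumKernel 4 1 (fun n => ?_) 2 fun n s hs _ => ?_
  · refine (Finset.sum_le_card_nsmul _ _ 4 fun z _ => ?_).trans ?_
    · rw [Complex.norm_real]
      exact abs_evenCoeff_mul_le _ _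
    · rw [Finset.Nat.card_antidiagonal, nsmul_eq_mul]
      push_cast
      linarith
  · have := Finset.HasAntidiagonal.mem_antidiagonal.1 hs
    simp only [multiDeg, Fin.sum_univ_two, Matrix.cons_val_zero, Matrix.cons_val_one]
    omega

theorem liftKernel_sum (n : ℕ) (x : EuclideanSpace ℝ (Fin 2)) :
    ∑ m ∈ (liftKernel n).support, liftKernel n m * (hermiteFunD 2 m x : ℂ)
      = (laguerreFun n (‖x‖₊ ^ 2) : ℂ) := by
  rw [liftKernel, sumKernel_sum, laguerreFun_eq_sum n _ (x 0) (x 1)]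
  · push_cast
    simp [hermiteFunD_two]
  · push_cast
    rw [EuclideanSpace.norm_sq_eq]
    simp

/-- A crude bound from the expansion on the axis `y = 0`: `n + 1` terms, each quadratic in `n` at
most. Any polynomial bound would do. -/
theorem abs_laguerreFun_le (n : ℕ) (x : ℝ≥0) : |laguerreFun n x| ≤ 32 * (1 + n) ^ 3 := by
  rw [laguerreFun_eq_sum_one n x (Real.sqrt x) (Real.sq_sqrt x.2).symm]
  have hterm : ∀ z ∈ antidiagonal n,
      |evenOrigin z.2 * evenCoeff z.1 * hermiteFun (2 * z.1) (Real.sqrt x)| ≤ 32 * (1 + n) ^ 2 := by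
    intro z hz
    have hz' : (z.1 : ℝ) + z.2 = n := by
      exact_mod_cast Finset.HasAntidiagonal.mem_antidiagonal.1 hz
    have h0 : (0 : ℝ) ≤ z.1 := by positivity
    have h1 : (0 : ℝ) ≤ z.2 := by positivity
    have h2 := abs_hermiteFun_le (2 * z.1) (Real.sqrt x)
    push_cast at h2
    have h3 : |evenOrigin z.2| ≤ 1 := by
      rw [abs_of_pos (evenOrigin_pos _)]; exact evenOrigin_le_one _
    rw [abs_mul, abs_mul]
    calc |evenOrigin z.2| * |evenCoeff z.1| * |hermiteFun (2 * z.1) (Real.sqrt x)|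
        ≤ 1 * 2 * (2 * (1 + 2 * z.1)) := by
          gcongr
          exact abs_evenCoeff_le _
      _ ≤ 32 * (1 + n) ^ 2 := by nlinarith
  refine (Finset.abs_sum_le_sum_abs _ _).trans ((Finset.sum_le_card_nsmul _ _ _ hterm).trans ?_)
  rw [Finset.Nat.card_antidiagonal, nsmul_eq_mul]
  push_cast
  exact le_of_eq (by ring)

/-- The index `(2n, 0)` occurs only in row `n`, with a nonzero entry; it allows the Laguerre
coefficients to be read off from the lifted expansion. -/
theorem liftKernel_apply (k n : ℕ) :
    liftKernel k ![2 * n, 0] = if k = n then ((evenCoeff n * evenCoeff 0 : ℝ) : ℂ) else 0 := by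
  rw [liftKernel, sumKernel, Finsupp.finsetSum_apply]
  simp only [Finsupp.single_apply]
  split_ifs with h
  · subst h
    rw [Finset.sum_eq_single (k, 0)]
    · simp
    · intro z _ hz
      rw [if_neg]
      intro h
      apply hz
      have h0 := congrFun h 0
      have h1 := congrFun h 1
      simp at h0 h1
      exact Prod.ext h0 h1
    · simp
  · refine Finset.sum_eq_zero fun z hz => ?_
    rw [if_neg]
    intro h'
    have h0 := congrFun h' 0
    have h1 := congrFun h' 1
    simp at h0 h1
    have := Finset.HasAntidiagonal.mem_antidiagonal.1 hz
    omega

theorem isSystem_laguerre : IsSystem (fun n : ℕ => n) laguerreFun where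
  growth := polynomialGrowth_nat
  bound := ⟨32, 3, abs_laguerreFun_le⟩
  independent := by
    intro a ha h0
    obtain ⟨C, p, hC⟩ := isSystem_hermite_two.bound
    -- Independence is transferred from the plane: a vanishing Laguerre series lifts to a vanishing
    -- Hermite series, whose coefficients must be zero once they are known to decay rapidly.
    have hE : Expands (hermiteFunD 2) (kerCoeff liftKernel a) 0 := by
      intro x
      refine isKernel_liftKernel.hasSum polynomialGrowth_nat ha (E := fun m => (hermiteFunD 2 m x : ℂ))
        (fun m => by rw [Complex.norm_real]; exact hC m x) ?_
      simp only [liftKernel_sum]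
      exact h0 (‖x‖₊ ^ 2)
    have hb : RapidDecay (multiDeg 2) (kerCoeff liftKernel a) := by
      obtain ⟨c, hc⟩ := isKernel_liftKernel.support
      obtain ⟨D, q, hD⟩ := isKernel_liftKernel.bound
      intro r
      have hs := (ha.summable polynomialGrowth_nat (q + r)).mul_left (D * (1 + c) ^ r)
      refine ⟨∑' n : ℕ, D * (1 + c) ^ r * (‖a n‖ * (1 + (n : ℝ)) ^ (q + r)), fun m => ?_⟩
      rw [kerCoeff]
      have hw : (0 : ℝ) < (1 + (multiDeg 2 m : ℝ)) ^ r := by positivity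
      rw [← le_div_iff₀ hw, div_eq_mul_inv]
      refine tsum_of_norm_bounded (hs.mul_right _).hasSum (fun n => ?_) |>.trans_eq tsum_mul_right
      rw [← div_eq_mul_inv, le_div_iff₀ hw]
      have hrow := IsKernel.norm_apply_le n (hD n) m
      by_cases hz : liftKernel n m = 0
      · rw [hz, mul_zero, norm_zero, zero_mul]
        have : 0 ≤ D * (1 + (n : ℝ)) ^ q := le_trans (norm_nonneg _) hrow
        have hD0 : 0 ≤ D := by
          by_contra hneg
          push Not at hneg
          have : (0 : ℝ) < (1 + (n : ℝ)) ^ q := by positivity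
          nlinarith
        positivity
      · have h1 : (multiDeg 2 m : ℝ) ≤ c * n := by exact_mod_cast hc n m hz
        have h2 : (0 : ℝ) ≤ n := by positivity
        have h3 : (0 : ℝ) ≤ c := by positivity
        have hrow0 := le_trans (norm_nonneg _) hrow
        calc ‖a n * liftKernel n m‖ * (1 + (multiDeg 2 m : ℝ)) ^ r
            ≤ ‖a n‖ * (D * (1 + (n : ℝ)) ^ q) * ((1 + c) * (1 + (n : ℝ))) ^ r := by
              rw [norm_mul]
              gcongr
              nlinarith
          _ = _ := by rw [mul_pow, pow_add]; ring
    have hz := isSystem_hermite_two.independent _ hb hE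
    funext n
    have h1 := congrFun hz ![2 * n, 0]
    rw [kerCoeff] at h1
    simp only [liftKernel_apply, mul_ite, mul_zero] at h1
    rw [tsum_ite_eq] at h1
    have h2 : evenCoeff n * evenCoeff 0 ≠ 0 :=
      mul_ne_zero (evenCoeff_ne_zero n) (evenCoeff_ne_zero 0)
    rcases mul_eq_zero.1 h1 with h | h
    · exact h
    · exact absurd (by exact_mod_cast h) h2

/-- `x ↦ φ(|x|²)`. -/
def radialLift {d : ℕ} (φ : ℝ≥0 → ℂ) : EuclideanSpace ℝ (Fin d) → ℂ := fun x => φ (‖x‖₊ ^ 2)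

/-- The radial lift as a map of test spaces. -/
def liftMap {K : Scale} (hK : K.Pos) : LagTest K →ₗ[ℂ] HermTest K 2 :=
  kerMap isSystem_laguerre isSystem_hermite_two isKernel_liftKernel hK

theorem liftMap_coe {K : Scale} (hK : K.Pos) (φ : LagTest K) :
    (liftMap hK φ).1 = radialLift φ.1 := by
  obtain ⟨φ, a, ha, haf⟩ := φ
  refine kerOp_eq isSystem_laguerre isSystem_hermite_two isKernel_liftKernel
    (ha.rapidDecay hK) haf fun x => ?_
  simp only [liftKernel_sum]
  exact haf _

/-- The kernel of the projection onto the radial functions of the plane. -/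
def projKernel : (Fin 2 → ℕ) → ℕ →₀ ℂ :=
  sumKernel (fun _ => {()}) (fun m _ => (m 0 + m 1) / 2) fun m _ =>
    if Even (m 0) ∧ Even (m 1) then
      ((evenCoeff (m 0 / 2) * evenCoeff (m 1 / 2) / Real.pi : ℝ) : ℂ) else 0

theorem isKernel_projKernel : IsKernel (multiDeg 2) (fun n : ℕ => n) projKernel := by
  refine isKernel_sumKernel 4 0 (fun n => ?_) 1 fun n s _ _ => ?_
  · rw [Finset.sum_singleton, pow_zero, mul_one]
    split_ifs
    · rw [Complex.norm_real, norm_div, Real.norm_of_nonneg Real.pi_nonneg,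
        div_le_iff₀ Real.pi_pos]
      have h1 := abs_evenCoeff_mul_le (n 0 / 2) (n 1 / 2)
      rw [Real.norm_eq_abs]
      linarith [Real.pi_gt_three]
    · simp
  · simp only [multiDeg, Fin.sum_univ_two]
    omega

/-- The radial projection. -/
def projMap {K : Scale} (hK : K.Pos) : HermTest K 2 →ₗ[ℂ] LagTest K :=
  kerMap isSystem_hermite_two isSystem_laguerre isKernel_projKernel hK

/-! ### Even functions on the line -/

/-- The kernel of `φ ↦ φ(x²)` from the half line to the line. -/
def squareKernel : ℕ → (Fin 1 → ℕ) →₀ ℂ :=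
  sumKernel antidiagonal (fun _ z => ![2 * z.1])
    fun _ z => ((evenOrigin z.2 * evenCoeff z.1 : ℝ) : ℂ)

theorem isKernel_squareKernel : IsKernel (fun n : ℕ => n) (multiDeg 1) squareKernel := by
  refine isKernel_sumKernel 2 1 (fun n => ?_) 2 fun n s hs _ => ?_
  · refine (Finset.sum_le_card_nsmul _ _ 2 fun z _ => ?_).trans ?_
    · rw [Complex.norm_real, norm_mul, Real.norm_of_nonneg (evenOrigin_pos _).le,
        Real.norm_eq_abs]
      nlinarith [evenOrigin_pos z.2, evenOrigin_le_one z.2, abs_evenCoeff_le z.1,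
        abs_nonneg (evenCoeff z.1)]
    · rw [Finset.Nat.card_antidiagonal, nsmul_eq_mul]
      push_cast
      linarith
  · have := Finset.HasAntidiagonal.mem_antidiagonal.1 hs
    simp only [multiDeg, Fin.sum_univ_one, Matrix.cons_val_zero]
    omega

/-- In one variable this is `φ(x²)`, a preimage of `φ` under `𝒥`; hence `𝒥` is onto and `𝒥'` is
injective. -/
theorem radialLift_mem_one {K : Scale} (hK : K.Pos) {φ : ℝ≥0 → ℂ} (hφ : φ ∈ LagTest K) :
    radialLift φ ∈ HermTest K 1 := by
  have hmem := kerOp_mem isSystem_laguerre isSystem_hermite_one isKernel_squareKernel hK hφ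
  obtain ⟨a, ha, haf⟩ := hφ
  rw [kerOp_eq (g := radialLift φ) isSystem_laguerre isSystem_hermite_one isKernel_squareKernel
    (ha.rapidDecay hK) haf] at hmem
  · exact hmem
  · intro x
    refine (haf (‖x‖₊ ^ 2)).congr_fun fun n => ?_
    congr 1
    rw [squareKernel, sumKernel_sum, laguerreFun_eq_sum_one n _ (x 0)]
    · push_cast
      simp [hermiteFunD_one]
    · push_cast
      rw [EuclideanSpace.norm_sq_eq]
      simp

theorem hermiteFun_neg (n : ℕ) (x : ℝ) : hermiteFun n (-x) = (-1) ^ n * hermiteFun n x := by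
  have h : ∀ n, hermiteVal n (-x) = (-1) ^ n * hermiteVal n x ∧
      hermiteVal (n + 1) (-x) = (-1) ^ (n + 1) * hermiteVal (n + 1) x := by
    intro n
    induction n with
    | zero => simp [hermiteVal_zero, hermiteVal_one]
    | succ n ih =>
      refine ⟨ih.2, ?_⟩
      rw [hermiteVal_succ_succ, hermiteVal_succ_succ, ih.1, ih.2]
      ring
  rw [hermiteFun_eq, hermiteFun_eq, (h n).1, neg_sq]
  ring

/-- The kernel of `ψ ↦ ψ(√x)` on even functions. -/
def rootKernel : (Fin 1 → ℕ) → ℕ →₀ ℂ :=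
  sumKernel (fun n => antidiagonal (n 0 / 2)) (fun _ z => z.1) fun n z =>
    if Even (n 0) then (((evenCoeff (n 0 / 2))⁻¹ * evenOriginInv z.2 : ℝ) : ℂ) else 0

theorem isKernel_rootKernel : IsKernel (multiDeg 1) (fun n : ℕ => n) rootKernel := by
  refine isKernel_sumKernel 2 2 (fun n => ?_) 1 fun n s hs _ => ?_
  · have hm : ((n 0 / 2 : ℕ) : ℝ) * 2 ≤ n 0 := by exact_mod_cast Nat.div_mul_le_self _ _
    have h0 : (0 : ℝ) ≤ ((n 0 / 2 : ℕ) : ℝ) := by positivity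
    refine (Finset.sum_le_card_nsmul _ _ (2 * ((n 0 / 2 : ℕ) : ℝ) + 1) fun z _ => ?_).trans ?_
    · split_ifs
      · rw [Complex.norm_real, norm_mul, Real.norm_eq_abs, Real.norm_eq_abs]
        nlinarith [abs_inv_evenCoeff_le (n 0 / 2), abs_evenOriginInv_le z.2,
          abs_nonneg ((evenCoeff (n 0 / 2))⁻¹), abs_nonneg (evenOriginInv z.2)]
      · rw [norm_zero]; positivity
    · rw [Finset.Nat.card_antidiagonal, nsmul_eq_mul]
      simp only [multiDeg, Fin.sum_univ_one]
      push_cast at *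
      nlinarith
  · have := Finset.HasAntidiagonal.mem_antidiagonal.1 hs
    simp only [multiDeg, Fin.sum_univ_one]
    omega

/-- The map `𝒥`, extended by zero to odd functions. -/
def rootMap {K : Scale} (hK : K.Pos) : HermTest K 1 →ₗ[ℂ] LagTest K :=
  kerMap isSystem_hermite_one isSystem_laguerre isKernel_rootKernel hK

/-- On the whole Hermite basis the kernel takes the even part before substituting `√r`; this avoids
a separate system of even Hermite functions. -/
theorem rootKernel_sum (n : Fin 1 → ℕ) (r : ℝ≥0) :
    ∑ m ∈ (rootKernel n).support, rootKernel n m * (laguerreFun m r : ℂ)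
      = ((hermiteFun (n 0) (Real.sqrt r) + hermiteFun (n 0) (-Real.sqrt r)) / 2 : ℝ) := by
  rw [rootKernel, sumKernel_sum, hermiteFun_neg]
  split_ifs with h
  · obtain ⟨k, hk⟩ := h
    have hk' : n 0 = 2 * k := by omega
    rw [hk', Nat.mul_div_cancel_left _ two_pos, pow_mul, neg_one_sq, one_pow, one_mul,
      add_self_div_two]
    exact_mod_cast (hermiteFun_eq_sum k r _ (Real.sq_sqrt r.2).symm).symm
  · rw [(Nat.not_even_iff_odd.1 h).neg_one_pow]
    simp

theorem rootMap_coe {K : Scale} (hK : K.Pos) (ψ : HermTest K 1) (hψ : ψ.1 ∈ evenFun 1) :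
    (rootMap hK ψ).1 = mapJ ψ.1 := by
  obtain ⟨ψ, a, ha, haf⟩ := ψ
  refine kerOp_eq isSystem_hermite_one isSystem_laguerre isKernel_rootKernel
    (ha.rapidDecay hK) haf fun r => ?_
  simp only [rootKernel_sum]
  have h1 := haf (WithLp.toLp 2 fun _ => Real.sqrt r)
  have h2 := haf (WithLp.toLp 2 fun _ => -Real.sqrt r)
  have h3 : ψ (WithLp.toLp 2 fun _ => -Real.sqrt r) = ψ (WithLp.toLp 2 fun _ => Real.sqrt r) := by
    have := hψ (fun _ => -1) (WithLp.toLp 2 fun _ => Real.sqrt r)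
    refine Eq.trans ?_ this
    simp only [signFlip]
    congr 2
    simp
  rw [h3] at h2
  have h4 := (h1.add h2).div_const 2
  rw [add_self_div_two] at h4
  refine h4.congr_fun fun n => ?_
  simp only [hermiteFunD_one]
  push_cast
  ring

/-! ### The pointwise relations between the maps -/

theorem mapJ_radialLift (φ : ℝ≥0 → ℂ) : mapJ (radialLift φ) = φ := by
  funext x
  rw [mapJ, radialLift]
  congr 1
  apply NNReal.coe_injective
  push_cast
  rw [EuclideanSpace.norm_sq_eq]
  simp

/-- This factorization of `Φ` through `𝒥` turns the relation `𝒥' u = Φ' w` into a statement about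
the lift alone. -/
theorem mapPhi_eq (ψ : EuclideanSpace ℝ (Fin 1) → ℂ) : mapPhi ψ = radialLift (mapJ ψ) := by
  funext x
  simp [mapPhi, radialLift, mapJ]

theorem norm_signFlip {d : ℕ} (ε : Fin d → ℤˣ) (x : EuclideanSpace ℝ (Fin d)) :
    ‖signFlip ε x‖ = ‖x‖ := by
  rw [EuclideanSpace.norm_eq, EuclideanSpace.norm_eq]
  congr 1
  refine Finset.sum_congr rfl fun i _ => ?_
  rcases Int.units_eq_one_or (ε i) with h | h <;> simp [signFlip, h]

theorem radialLift_even {d : ℕ} (φ : ℝ≥0 → ℂ) : radialLift φ ∈ evenFun d := fun ε x => by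
  have : ‖signFlip ε x‖₊ = ‖x‖₊ := NNReal.coe_injective (norm_signFlip ε x)
  rw [radialLift, radialLift, this]

/-! ### The Laguerre operator -/

/-- The Laguerre functions on the whole line. -/
def laguerreExt (n : ℕ) (x : ℝ) : ℝ := laguerrePoly n x * Real.exp (-x / 2)

/-- The derivative of `laguerreExt`. -/
def laguerreExtDeriv (n : ℕ) (x : ℝ) : ℝ :=
  -∑ j ∈ Finset.range n, laguerreExt j x - laguerreExt n x / 2

/-- The second derivative of `laguerreExt`. -/
def laguerreExtDeriv2 (n : ℕ) (x : ℝ) : ℝ :=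
  -∑ j ∈ Finset.range n, laguerreExtDeriv j x - laguerreExtDeriv n x / 2

theorem hasDerivAt_laguerreExt (n : ℕ) (x : ℝ) :
    HasDerivAt (laguerreExt n) (laguerreExtDeriv n x) x := by
  have h1 : HasDerivAt (fun x : ℝ => Real.exp (-x / 2)) (Real.exp (-x / 2) * (-1 / 2)) x :=
    (((hasDerivAt_id x).neg).div_const 2).exp
  refine ((hasDerivAt_laguerrePoly n x).mul h1).congr_deriv ?_
  simp only [laguerreExtDeriv, laguerreExt, ← Finset.sum_mul]
  ring

theorem hasDerivAt_laguerreExtDeriv (n : ℕ) (x : ℝ) :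
    HasDerivAt (laguerreExtDeriv n) (laguerreExtDeriv2 n x) x :=
  ((HasDerivAt.fun_sum fun j _ => hasDerivAt_laguerreExt j x).neg).sub
    ((hasDerivAt_laguerreExt n x).div_const 2)

/-- Laguerre's equation `x L'' + (1 - x) L' + n L = 0`, with both derivatives written as sums of
lower polynomials. It follows by differentiating `mul_sum_laguerrePoly`. -/
theorem laguerrePoly_ode (n : ℕ) (x : ℝ) :
    x * ∑ j ∈ Finset.range n, ∑ i ∈ Finset.range j, laguerrePoly i x
      - (1 - x) * ∑ j ∈ Finset.range n, laguerrePoly j x + n * laguerrePoly n x = 0 := by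
  cases n with
  | zero => simp
  | succ n =>
    have hS : HasDerivAt (fun x => ∑ j ∈ Finset.range (n + 1), laguerrePoly j x)
        (∑ j ∈ Finset.range (n + 1), -∑ i ∈ Finset.range j, laguerrePoly i x) x :=
      HasDerivAt.fun_sum fun j _ => hasDerivAt_laguerrePoly j x
    have h1 := (hasDerivAt_id x).mul hS
    have h2 := ((hasDerivAt_laguerrePoly n x).sub (hasDerivAt_laguerrePoly (n + 1) x)).const_mul
      ((n : ℝ) + 1)
    have h3 := h1.unique (h2.congr_of_eventuallyEq
      (Filter.Eventually.of_forall fun y => mul_sum_laguerrePoly n y))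
    have h4 := mul_sum_laguerrePoly n x
    rw [Finset.sum_neg_distrib] at h3
    have h5 := Finset.sum_range_succ (fun j => laguerrePoly j x) n
    simp only [id_eq] at h3
    push_cast
    linear_combination -h3 + h4 - (n + 1) * h5

/-- Conjugating Laguerre's equation with `exp(-x/2)` gives the eigenvalue equation `E l_n = n l_n`.
-/
theorem laguerreExt_ode (n : ℕ) (x : ℝ) :
    -(x * laguerreExtDeriv2 n x + laguerreExtDeriv n x - x / 4 * laguerreExt n x
      + 1 / 2 * laguerreExt n x) = n * laguerreExt n x := by
  have h := laguerrePoly_ode n x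
  simp only [laguerreExtDeriv2, laguerreExtDeriv, laguerreExt, ← Finset.sum_mul,
    Finset.sum_sub_distrib, Finset.sum_neg_distrib, ← Finset.sum_div]
  linear_combination (-Real.exp (-x / 2)) * h

theorem laguerreFun_eq_ext (n : ℕ) (x : ℝ≥0) : laguerreFun n x = laguerreExt n x := rfl

/-- The derivative of `l_n` is this combination of Laguerre functions, so each differentiation costs
one power of `1 + n`. -/
theorem abs_sum_range_add_half_le {f : ℕ → ℝ} {C : ℝ} {p : ℕ} (hC : 0 ≤ C)
    (hf : ∀ n : ℕ, |f n| ≤ C * (1 + n) ^ p) (n : ℕ) :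
    |-∑ j ∈ Finset.range n, f j - f n / 2| ≤ C * (1 + n) ^ (p + 1) := by
  have h1 : |∑ j ∈ Finset.range n, f j| ≤ n * (C * (1 + n) ^ p) := by
    refine (Finset.abs_sum_le_sum_abs _ _).trans ?_
    refine (Finset.sum_le_card_nsmul _ _ (C * (1 + n) ^ p) fun j hj => (hf j).trans ?_).trans ?_
    · have : (j : ℝ) ≤ n := by exact_mod_cast (Finset.mem_range.1 hj).le
      gcongr
    · rw [Finset.card_range, nsmul_eq_mul]
  have h2 := hf n
  have h3 : 0 ≤ C * (1 + (n : ℝ)) ^ p := by positivity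
  rw [abs_le] at *
  rw [pow_succ]
  constructor <;> nlinarith

theorem abs_laguerreExt_le (n : ℕ) {x : ℝ} (hx : 0 ≤ x) : |laguerreExt n x| ≤ 32 * (1 + n) ^ 3 :=
  abs_laguerreFun_le n ⟨x, hx⟩

theorem abs_laguerreExtDeriv_le (n : ℕ) {x : ℝ} (hx : 0 ≤ x) :
    |laguerreExtDeriv n x| ≤ 32 * (1 + n) ^ 4 :=
  abs_sum_range_add_half_le (by norm_num) (fun n => abs_laguerreExt_le n hx) n

theorem abs_laguerreExtDeriv2_le (n : ℕ) {x : ℝ} (hx : 0 ≤ x) :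
    |laguerreExtDeriv2 n x| ≤ 32 * (1 + n) ^ 5 :=
  abs_sum_range_add_half_le (by norm_num) (fun n => abs_laguerreExtDeriv_le n hx) n

-- The bounds hold only for `x ≥ 0`. Termwise differentiation is therefore done on the open half
-- line, and the one-sided derivative at `0` is obtained as the limit of the derivatives.
open Set Filter Topology in
theorem hasDerivWithinAt_tsum_Ici {f f' : ℕ → ℝ → ℂ} {u v : ℕ → ℝ} (hu : Summable u)
    (hv : Summable v) (hf : ∀ n x, HasDerivAt (f n) (f' n x) x)
    (hc : ∀ n, Continuous (f' n)) (hfu : ∀ n x, 0 ≤ x → ‖f n x‖ ≤ u n)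
    (hfv : ∀ n x, 0 ≤ x → ‖f' n x‖ ≤ v n) {x : ℝ} (hx : 0 ≤ x) :
    HasDerivWithinAt (fun y => ∑' n, f n y) (∑' n, f' n x) (Ici 0) x := by
  have hint : ∀ y ∈ Ioi (0 : ℝ), HasDerivAt (fun y => ∑' n, f n y) (∑' n, f' n y) y :=
    fun y hy => hasDerivAt_tsum_of_isPreconnected hv isOpen_Ioi isPreconnected_Ioi
      (fun n y _ => hf n y) (fun n y hy => hfv n y (le_of_lt hy)) hy
      (Summable.of_norm_bounded hu fun n => hfu n y (le_of_lt hy)) hy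
  rcases hx.eq_or_lt with rfl | hx
  · have hcont : ContinuousOn (fun y => ∑' n, f n y) (Ici 0) :=
      continuousOn_tsum (fun n => (continuous_iff_continuousAt.2 fun y =>
        (hf n y).continuousAt).continuousOn) hu fun n y hy => hfu n y hy
    have hcont' : ContinuousOn (fun y => ∑' n, f' n y) (Ici 0) :=
      continuousOn_tsum (fun n => (hc n).continuousOn) hv fun n y hy => hfv n y hy
    refine hasDerivWithinAt_Ici_of_tendsto_deriv (s := Ioi 0)
      (fun y hy => (hint y hy).differentiableAt.differentiableWithinAt)
      ((hcont 0 self_mem_Ici).mono Ioi_subset_Ici_self) self_mem_nhdsWithin ?_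
    have h1 := ((hcont' 0 self_mem_Ici).mono Ioi_subset_Ici_self).tendsto
    refine h1.congr' ?_
    filter_upwards [self_mem_nhdsWithin] with y hy
    exact (hint y hy).deriv.symm
  · exact (hint x hx).hasDerivWithinAt

/-- The eigenvalues of the Laguerre operator. -/
def laguerreEigen (ρ c : ℂ) (n : ℕ) : ℂ := ρ * n + c

theorem isKernel_laguerreEigen (ρ c : ℂ) :
    IsKernel (fun n : ℕ => n) (fun n : ℕ => n) (diagKernel (laguerreEigen ρ c)) := by
  refine isKernel_diagKernel (‖ρ‖ + ‖c‖) 1 fun n => ?_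
  have h1 : ‖laguerreEigen ρ c n‖ ≤ ‖ρ‖ * n + ‖c‖ := by
    refine (norm_add_le _ _).trans ?_
    rw [norm_mul, Complex.norm_natCast]
  have h2 : (0 : ℝ) ≤ n := by positivity
  rw [pow_one]
  nlinarith [norm_nonneg ρ, norm_nonneg c]

theorem RapidDecay.summable_mul {a : ℕ → ℂ} (ha : RapidDecay (fun n : ℕ => n) a) (C : ℝ) (p : ℕ) :
    Summable fun n : ℕ => ‖a n‖ * (C * (1 + (n : ℝ)) ^ p) :=
  ((ha.summable polynomialGrowth_nat p).mul_left C).congr fun n => by ring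

theorem laguerreOp_expands {a : ℕ → ℂ} {φ : ℝ≥0 → ℂ} (ha : RapidDecay (fun n : ℕ => n) a)
    (hφ : Expands laguerreFun a φ) (ρ c : ℂ) (x : ℝ≥0) :
    HasSum (fun n => a n * (laguerreEigen ρ c n * (laguerreFun n x : ℂ)))
      (laguerreOp ρ c φ x) := by
  have hbd : ∀ {f : ℕ → ℝ → ℝ} {C : ℝ} {p : ℕ}, (∀ n {x : ℝ}, 0 ≤ x → |f n x| ≤ C * (1 + n) ^ p) →
      ∀ n x, 0 ≤ x → ‖a n * (f n x : ℂ)‖ ≤ ‖a n‖ * (C * (1 + (n : ℝ)) ^ p) := by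
    intro f C p hf n x hx
    rw [norm_mul, Complex.norm_real]
    gcongr
    exact hf n hx
  have b0 := hbd abs_laguerreExt_le
  have b1 := hbd abs_laguerreExtDeriv_le
  have b2 := hbd abs_laguerreExtDeriv2_le
  have s0 := ha.summable_mul 32 3
  have s1 := ha.summable_mul 32 4
  have s2 := ha.summable_mul 32 5
  have c1 : ∀ n, Continuous (laguerreExtDeriv n) := fun n =>
    continuous_iff_continuousAt.2 fun x => (hasDerivAt_laguerreExtDeriv n x).continuousAt
  have c2 : ∀ n, Continuous (laguerreExtDeriv2 n) := fun n =>
    ((continuous_finsetSum _ fun j _ => c1 j).neg).sub ((c1 n).div_const 2)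
  have d1 : ∀ x : ℝ, 0 ≤ x → HasDerivWithinAt (fun y => ∑' n, a n * (laguerreExt n y : ℂ))
      (∑' n, a n * (laguerreExtDeriv n x : ℂ)) (Set.Ici 0) x := fun x hx =>
    hasDerivWithinAt_tsum_Ici s0 s1
      (fun n x => ((hasDerivAt_laguerreExt n x).ofReal_comp).const_mul (a n))
      (fun n => continuous_const.mul (Complex.continuous_ofReal.comp (c1 n))) b0 b1 hx
  have d2 : ∀ x : ℝ, 0 ≤ x → HasDerivWithinAt (fun y => ∑' n, a n * (laguerreExtDeriv n y : ℂ))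
      (∑' n, a n * (laguerreExtDeriv2 n x : ℂ)) (Set.Ici 0) x := fun x hx =>
    hasDerivWithinAt_tsum_Ici s1 s2
      (fun n x => ((hasDerivAt_laguerreExtDeriv n x).ofReal_comp).const_mul (a n))
      (fun n => continuous_const.mul (Complex.continuous_ofReal.comp (c2 n))) b1 b2 hx
  set F : ℝ → ℂ := fun y => φ y.toNNReal with hF
  -- The extension of `φ` by `toNNReal` agrees with the series only on the half line, which suffices
  -- for derivatives within it.
  have hF0 : Set.EqOn F (fun y => ∑' n, a n * (laguerreExt n y : ℂ)) (Set.Ici 0) := by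
    intro y hy
    have := (hφ y.toNNReal).tsum_eq
    simp only [laguerreFun_eq_ext, Real.coe_toNNReal y hy] at this
    exact this.symm
  have hu : UniqueDiffOn ℝ (Set.Ici (0 : ℝ)) := uniqueDiffOn_Ici 0
  have hF1 : Set.EqOn (derivWithin F (Set.Ici 0))
      (fun y => ∑' n, a n * (laguerreExtDeriv n y : ℂ)) (Set.Ici 0) := fun y hy =>
    ((d1 y hy).congr hF0 (hF0 hy)).derivWithin (hu y hy)
  have hx : (0 : ℝ) ≤ x := x.2
  have hF2 : iteratedDerivWithin 2 F (Set.Ici 0) x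
      = ∑' n, a n * (laguerreExtDeriv2 n x : ℂ) := by
    rw [iteratedDerivWithin_succ', iteratedDerivWithin_one]
    exact ((d2 x hx).congr hF1 (hF1 hx)).derivWithin (hu x hx)
  have t0 : HasSum (fun n => a n * (laguerreExt n x : ℂ)) (φ x) := hφ x
  have t1 : HasSum (fun n => a n * (laguerreExtDeriv n x : ℂ)) (derivWithin F (Set.Ici 0) x) := by
    rw [hF1 hx]
    exact (Summable.of_norm_bounded s1 fun n => b1 n x hx).hasSum
  have t2 : HasSum (fun n => a n * (laguerreExtDeriv2 n x : ℂ))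
      (iteratedDerivWithin 2 F (Set.Ici 0) x) := by
    rw [hF2]
    exact (Summable.of_norm_bounded s2 fun n => b2 n x hx).hasSum
  have key := ((((((t2.mul_left ((x : ℝ) : ℂ)).add t1).sub (t0.mul_left (((x : ℝ) : ℂ) / 4))).add
    (t0.mul_left (1 / 2))).neg).mul_left ρ).add (t0.mul_left c)
  refine key.congr_fun fun n => ?_
  have hode : ((-((x : ℝ) * laguerreExtDeriv2 n x + laguerreExtDeriv n x
      - (x : ℝ) / 4 * laguerreExt n x + 1 / 2 * laguerreExt n x) : ℝ) : ℂ)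
      = ((n * laguerreExt n x : ℝ) : ℂ) := by rw [laguerreExt_ode]
  push_cast at hode
  rw [laguerreEigen, laguerreFun_eq_ext]
  linear_combination (-(ρ * a n)) * hode

/-- The Laguerre operator as a map of test spaces. -/
def laguerreOpMap {K : Scale} (hK : K.Pos) (ρ c : ℂ) : LagTest K →ₗ[ℂ] LagTest K :=
  kerMap isSystem_laguerre isSystem_laguerre (isKernel_laguerreEigen ρ c) hK

theorem laguerreOpMap_coe {K : Scale} (hK : K.Pos) (ρ c : ℂ) (φ : LagTest K) :
    (laguerreOpMap hK ρ c φ).1 = laguerreOp ρ c φ.1 := by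
  obtain ⟨φ, a, ha, haf⟩ := φ
  refine kerOp_eq isSystem_laguerre isSystem_laguerre (isKernel_laguerreEigen ρ c)
    (ha.rapidDecay hK) haf fun x => ?_
  simp only [diagKernel_sum]
  exact laguerreOp_expands (ha.rapidDecay hK) haf ρ c x

/-! ### The harmonic oscillator -/

theorem contDiff_hermiteFun (n : ℕ) {N : WithTop ℕ∞} : ContDiff ℝ N (hermiteFun n) := by
  obtain ⟨p, hp⟩ := exists_hermiteFun_eq n
  rw [funext hp]
  refine ContDiff.mul ?_ (by fun_prop)
  simpa using Polynomial.contDiff_aeval (𝕜 := ℝ) p N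

theorem deriv_hermiteFun (n : ℕ) : deriv (hermiteFun n) = fun x =>
    ladder n * hermiteFun (n - 1) x - ladder (n + 1) * hermiteFun (n + 1) x :=
  funext fun x => (hasDerivAt_hermiteFun n x).deriv

theorem ladder_le (n : ℕ) : ladder n ≤ 1 + n := by
  refine Real.sqrt_le_iff.2 ⟨by positivity, ?_⟩
  have : (0 : ℝ) ≤ n := by positivity
  nlinarith

theorem exists_iteratedDeriv_hermiteFun_le (k : ℕ) : ∃ (C : ℝ) (p : ℕ), 0 ≤ C ∧
    ∀ n x, |iteratedDeriv k (hermiteFun n) x| ≤ C * (1 + (n : ℝ)) ^ p := by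
  induction k with
  | zero => exact ⟨2, 1, by norm_num, fun n x => by simpa using abs_hermiteFun_le n x⟩
  | succ k ih =>
    obtain ⟨C, p, hC0, hC⟩ := ih
    -- The derivative involves the neighbours `n ± 1` with factors at most `1 + n` and `2(1 + n)`,
    -- which sum to `3(1 + n)`; the shift of the index costs `2^p`.
    refine ⟨3 * 2 ^ p * C, p + 1, by positivity, fun n x => ?_⟩
    have h1 : iteratedDeriv (k + 1) (hermiteFun n) x
        = ladder n * iteratedDeriv k (hermiteFun (n - 1)) x
          - ladder (n + 1) * iteratedDeriv k (hermiteFun (n + 1)) x := by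
      rw [iteratedDeriv_succ', deriv_hermiteFun]
      rw [iteratedDeriv_fun_sub, iteratedDeriv_const_mul_field, iteratedDeriv_const_mul_field]
      · exact (contDiff_const.mul (contDiff_hermiteFun _)).contDiffAt
      · exact (contDiff_const.mul (contDiff_hermiteFun _)).contDiffAt
    have hn : (0 : ℝ) ≤ n := by positivity
    have h2 : |iteratedDeriv k (hermiteFun (n - 1)) x| ≤ C * (2 * (1 + (n : ℝ))) ^ p := by
      refine (hC _ _).trans ?_
      have : ((n - 1 : ℕ) : ℝ) ≤ n := by exact_mod_cast Nat.sub_le n 1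
      gcongr
      linarith
    have h3 : |iteratedDeriv k (hermiteFun (n + 1)) x| ≤ C * (2 * (1 + (n : ℝ))) ^ p := by
      refine (hC _ _).trans ?_
      push_cast
      gcongr
      linarith
    have h4 : ladder (n + 1) ≤ 2 * (1 + n) := by
      have := ladder_le (n + 1)
      push_cast at this
      linarith
    rw [h1]
    calc _ ≤ |ladder n * iteratedDeriv k (hermiteFun (n - 1)) x|
          + |ladder (n + 1) * iteratedDeriv k (hermiteFun (n + 1)) x| := abs_sub _ _
      _ ≤ (1 + n) * (C * (2 * (1 + (n : ℝ))) ^ p) + 2 * (1 + n) * (C * (2 * (1 + (n : ℝ))) ^ p) := by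
          rw [abs_mul, abs_mul, abs_of_nonneg (ladder_nonneg _), abs_of_nonneg (ladder_nonneg _)]
          gcongr
          exact ladder_le n
      _ = _ := by rw [mul_pow, pow_succ]; ring

/-- The coordinate functionals on the plane. -/
abbrev coord (i : Fin 2) : EuclideanSpace ℝ (Fin 2) →L[ℝ] ℝ := EuclideanSpace.proj i

theorem norm_coord_le (i : Fin 2) : ‖coord i‖ ≤ 1 :=
  ContinuousLinearMap.opNorm_le_bound _ zero_le_one fun x => by
    simpa using PiLp.norm_apply_le x i

theorem norm_iteratedFDeriv_hermite_coord_le (k n : ℕ) (i : Fin 2)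
    (x : EuclideanSpace ℝ (Fin 2)) :
    ‖iteratedFDeriv ℝ k (hermiteFun n ∘ coord i) x‖ ≤ |iteratedDeriv k (hermiteFun n) (x i)| := by
  rw [ContinuousLinearMap.iteratedFDeriv_comp_right (coord i) (contDiff_hermiteFun n (N := k)) x
    le_rfl]
  refine (ContinuousMultilinearMap.norm_compContinuousLinearMap_le _ _).trans ?_
  rw [norm_iteratedFDeriv_eq_norm_iteratedDeriv, Real.norm_eq_abs]
  refine mul_le_of_le_one_right (abs_nonneg _) ?_
  exact Finset.prod_le_one (fun _ _ => norm_nonneg _) fun _ _ => norm_coord_le i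

theorem hermiteFunD_two_eq (m : Fin 2 → ℕ) : hermiteFunD 2 m = fun x =>
    (hermiteFun (m 0) ∘ coord 0) x * (hermiteFun (m 1) ∘ coord 1) x :=
  funext fun x => hermiteFunD_two m x

theorem contDiff_hermiteFunD_two (m : Fin 2 → ℕ) {N : WithTop ℕ∞} :
    ContDiff ℝ N (hermiteFunD 2 m) := by
  rw [hermiteFunD_two_eq]
  exact ((contDiff_hermiteFun _).comp (coord 0).contDiff).mul
    ((contDiff_hermiteFun _).comp (coord 1).contDiff)

theorem exists_iteratedFDeriv_hermiteFunD_le (k : ℕ) : ∃ (C : ℝ) (p : ℕ),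
    ∀ m x, ‖iteratedFDeriv ℝ k (hermiteFunD 2 m) x‖ ≤ C * (1 + (multiDeg 2 m : ℝ)) ^ p := by
  choose C p hC0 hC using exists_iteratedDeriv_hermiteFun_le
  refine ⟨∑ i ∈ Finset.range (k + 1), (k.choose i : ℝ) * C i * C (k - i),
    -- A common exponent for all terms of the Leibniz formula: the sum dominates each summand.
    ∑ i ∈ Finset.range (k + 1), (p i + p (k - i)), fun m x => ?_⟩
  rw [hermiteFunD_two_eq]
  refine (norm_iteratedFDeriv_mul_le (N := k) ((contDiff_hermiteFun _).comp (coord 0).contDiff)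
    ((contDiff_hermiteFun _).comp (coord 1).contDiff) x le_rfl).trans ?_
  rw [Finset.sum_mul]
  refine Finset.sum_le_sum fun i hi => ?_
  have e : (multiDeg 2 m : ℝ) = m 0 + m 1 := by simp [multiDeg]
  have h0 : (0 : ℝ) ≤ m 0 := by positivity
  have h1 : (0 : ℝ) ≤ m 1 := by positivity
  have hA : ‖iteratedFDeriv ℝ i (hermiteFun (m 0) ∘ coord 0) x‖
      ≤ C i * (1 + (multiDeg 2 m : ℝ)) ^ p i := by
    refine (norm_iteratedFDeriv_hermite_coord_le _ _ _ _).trans ((hC i _ _).trans ?_)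
    have := hC0 i
    rw [e]
    gcongr
    linarith
  have hB : ‖iteratedFDeriv ℝ (k - i) (hermiteFun (m 1) ∘ coord 1) x‖
      ≤ C (k - i) * (1 + (multiDeg 2 m : ℝ)) ^ p (k - i) := by
    refine (norm_iteratedFDeriv_hermite_coord_le _ _ _ _).trans ((hC (k - i) _ _).trans ?_)
    have := hC0 (k - i)
    rw [e]
    gcongr
    linarith
  have hCi := hC0 i
  have hCk := hC0 (k - i)
  calc _ ≤ (k.choose i : ℝ) * (C i * (1 + (multiDeg 2 m : ℝ)) ^ p i)
        * (C (k - i) * (1 + (multiDeg 2 m : ℝ)) ^ p (k - i)) := by gcongr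
    _ = (k.choose i : ℝ) * C i * C (k - i) * (1 + (multiDeg 2 m : ℝ)) ^ (p i + p (k - i)) := by
        rw [pow_add]; ring
    _ ≤ _ := by
        have := Finset.single_le_sum (f := fun i => p i + p (k - i)) (fun _ _ => Nat.zero_le _) hi
        have h2 : (1 : ℝ) ≤ 1 + multiDeg 2 m := by rw [e]; linarith
        gcongr

/-- The oscillator equation in one variable, from applying the ladder relation twice and eliminating
the indices `n ± 2` by the recurrence. -/
theorem hasDerivAt_deriv_hermiteFun (n : ℕ) (x : ℝ) :
    HasDerivAt (deriv (hermiteFun n)) ((x ^ 2 - (2 * n + 1)) * hermiteFun n x) x := by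
  rw [deriv_hermiteFun]
  refine (((hasDerivAt_hermiteFun (n - 1) x).const_mul _).sub
    ((hasDerivAt_hermiteFun (n + 1) x).const_mul _)).congr_deriv ?_
  have h0 := mul_hermiteFun n x
  have h1 := mul_hermiteFun (n - 1) x
  have h2 := mul_hermiteFun (n + 1) x
  have l0 := ladder_sq n
  have l1 := ladder_sq (n + 1)
  push_cast at l1
  rw [Nat.add_sub_cancel] at *
  cases n with
  | zero =>
    simp only [ladder_zero, zero_mul, zero_add, zero_sub, Nat.cast_zero] at *
    linear_combination (-x) * h0 - ladder 1 * h2 - 2 * hermiteFun 0 x * l1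
  | succ n =>
    simp only [Nat.add_sub_cancel] at *
    linear_combination (-x) * h0 - ladder (n + 1) * h1 - ladder (n + 1 + 1) * h2
      - 2 * hermiteFun (n + 1) x * l0 - 2 * hermiteFun (n + 1) x * l1

theorem hasFDerivAt_mul_coord {f g : ℝ → ℝ} {f' g' : ℝ} {x : EuclideanSpace ℝ (Fin 2)}
    (hf : HasDerivAt f f' (x 0)) (hg : HasDerivAt g g' (x 1)) :
    HasFDerivAt (fun y : EuclideanSpace ℝ (Fin 2) => f (y 0) * g (y 1))
      ((f (x 0) * g') • coord 1 + (g (x 1) * f') • coord 0) x := by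
  have h0 : HasFDerivAt (fun y : EuclideanSpace ℝ (Fin 2) => f (y 0)) (f' • coord 0) x :=
    HasDerivAt.comp_hasFDerivAt (f := fun y : EuclideanSpace ℝ (Fin 2) => y 0) x hf
      (coord 0).hasFDerivAt
  have h1 : HasFDerivAt (fun y : EuclideanSpace ℝ (Fin 2) => g (y 1)) (g' • coord 1) x :=
    HasDerivAt.comp_hasFDerivAt (f := fun y : EuclideanSpace ℝ (Fin 2) => y 1) x hg
      (coord 1).hasFDerivAt
  refine (h0.mul h1).congr_fderiv ?_
  rw [smul_smul, smul_smul]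

theorem iteratedFDeriv_two_hermiteFunD (m : Fin 2 → ℕ) (x : EuclideanSpace ℝ (Fin 2)) (i : Fin 2) :
    iteratedFDeriv ℝ 2 (hermiteFunD 2 m) x
      ![EuclideanSpace.single i 1, EuclideanSpace.single i 1]
      = (x i ^ 2 - (2 * m i + 1)) * hermiteFunD 2 m x := by
  have hd : ∀ n y, HasDerivAt (hermiteFun n) (deriv (hermiteFun n) y) y := fun n y =>
    (hasDerivAt_hermiteFun n y).differentiableAt.hasDerivAt
  have hf : hermiteFunD 2 m = fun y : EuclideanSpace ℝ (Fin 2) =>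
      hermiteFun (m 0) (y 0) * hermiteFun (m 1) (y 1) := funext (hermiteFunD_two m)
  have h1 : ∀ y : EuclideanSpace ℝ (Fin 2), fderiv ℝ (hermiteFunD 2 m) y
      = (hermiteFun (m 0) (y 0) * deriv (hermiteFun (m 1)) (y 1)) • coord 1
        + (hermiteFun (m 1) (y 1) * deriv (hermiteFun (m 0)) (y 0)) • coord 0 := fun y => by
    rw [hf]
    exact (hasFDerivAt_mul_coord (hd _ _) (hd _ _)).fderiv
  have hdiff : DifferentiableAt ℝ (fderiv ℝ (hermiteFunD 2 m)) x :=
    ((contDiff_hermiteFunD_two m (N := 2)).fderiv_right (m := 1) le_rfl).differentiable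
      one_ne_zero x
  rw [iteratedFDeriv_two_apply]
  simp only [Matrix.cons_val_zero, Matrix.cons_val_one]
  -- The second derivative along a fixed direction is the derivative of a directional derivative,
  -- which is again a product of one-variable functions.
  have h2 : fderiv ℝ (fderiv ℝ (hermiteFunD 2 m)) x (EuclideanSpace.single i 1)
      (EuclideanSpace.single i 1) = fderiv ℝ (fun y => fderiv ℝ (hermiteFunD 2 m) y
        (EuclideanSpace.single i 1)) x (EuclideanSpace.single i 1) := by
    rw [fderiv_clm_apply hdiff (differentiableAt_const _)]
    simp
  rw [h2]
  fin_cases i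
  · have h3 : (fun y => fderiv ℝ (hermiteFunD 2 m) y (EuclideanSpace.single 0 1))
        = fun y : EuclideanSpace ℝ (Fin 2) =>
          deriv (hermiteFun (m 0)) (y 0) * hermiteFun (m 1) (y 1) := by
      funext y
      rw [h1]
      simp
      ring
    simp only [Fin.zero_eta]
    rw [h3, (hasFDerivAt_mul_coord (hasDerivAt_deriv_hermiteFun _ _) (hd _ _)).fderiv,
      hermiteFunD_two]
    simp
    ring
  · have h3 : (fun y => fderiv ℝ (hermiteFunD 2 m) y (EuclideanSpace.single 1 1))
        = fun y : EuclideanSpace ℝ (Fin 2) =>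
          hermiteFun (m 0) (y 0) * deriv (hermiteFun (m 1)) (y 1) := by
      funext y
      rw [h1]
      simp
    simp only [Fin.mk_one]
    rw [h3, (hasFDerivAt_mul_coord (hd _ _) (hasDerivAt_deriv_hermiteFun _ _)).fderiv,
      hermiteFunD_two]
    simp
    ring

theorem hasSum_iteratedFDeriv_two {a : (Fin 2 → ℕ) → ℂ} {φ : EuclideanSpace ℝ (Fin 2) → ℂ}
    (ha : RapidDecay (multiDeg 2) a) (hφ : Expands (hermiteFunD 2) a φ)
    (x : EuclideanSpace ℝ (Fin 2)) (i : Fin 2) :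
    HasSum (fun m => a m * (((x i ^ 2 - (2 * m i + 1)) * hermiteFunD 2 m x : ℝ) : ℂ))
      (iteratedFDeriv ℝ 2 φ x ![EuclideanSpace.single i 1, EuclideanSpace.single i 1]) := by
  -- Writing the terms as real functions followed by real-linear maps into `ℂ` lets the iterated
  -- derivatives pass through.
  set T : (Fin 2 → ℕ) → ℝ →L[ℝ] ℂ := fun m => a m • Complex.ofRealCLM with hT
  have hTn : ∀ m, ‖T m‖ ≤ ‖a m‖ := fun m => by
    simp only [hT]
    rw [norm_smul, Complex.ofRealCLM_norm, mul_one]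
  choose C p hC using exists_iteratedFDeriv_hermiteFunD_le
  have hfun : φ = fun y => ∑' m, (T m ∘ hermiteFunD 2 m) y := funext fun y => by
    rw [← (hφ y).tsum_eq]
    rfl
  have hbound : ∀ (k : ℕ) (m : Fin 2 → ℕ) (y : EuclideanSpace ℝ (Fin 2)),
      ‖iteratedFDeriv ℝ k (T m ∘ hermiteFunD 2 m) y‖
        ≤ C k * (‖a m‖ * (1 + (multiDeg 2 m : ℝ)) ^ p k) := fun k m y => by
    refine ((T m).norm_iteratedFDeriv_comp_left (contDiff_hermiteFunD_two m (N := k)).contDiffAt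
      le_rfl).trans ?_
    calc _ ≤ ‖a m‖ * (C k * (1 + (multiDeg 2 m : ℝ)) ^ p k) :=
          mul_le_mul (hTn m) (hC k m y) (norm_nonneg _) (norm_nonneg _)
      _ = _ := by ring
  have hsum : ∀ k : ℕ, Summable fun m => C k * (‖a m‖ * (1 + (multiDeg 2 m : ℝ)) ^ p k) :=
    fun k => (ha.summable polynomialGrowth_two (p k)).mul_left _
  have h1 := iteratedFDeriv_tsum_apply (𝕜 := ℝ) (N := 2) (f := fun m => T m ∘ hermiteFunD 2 m)
    (v := fun k m => C k * (‖a m‖ * (1 + (multiDeg 2 m : ℝ)) ^ p k))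
    (fun m => (T m).contDiff.comp (contDiff_hermiteFunD_two m)) (fun k _ => hsum k)
    (fun k m y _ => hbound k m y) (k := 2) le_rfl x
  have h2 : HasSum (fun m => iteratedFDeriv ℝ 2 (T m ∘ hermiteFunD 2 m) x)
      (iteratedFDeriv ℝ 2 φ x) := by
    rw [hfun, h1]
    exact (Summable.of_norm_bounded (hsum 2) fun m => hbound 2 m x).hasSum
  have h3 := ContinuousMultilinearMap.hasSum_eval h2
    ![EuclideanSpace.single i 1, EuclideanSpace.single i 1]
  refine h3.congr_fun fun m => ?_
  rw [(T m).iteratedFDeriv_comp_left (contDiff_hermiteFunD_two m (N := 2)).contDiffAt le_rfl,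
    ContinuousLinearMap.compContinuousMultilinearMap_coe, Function.comp_apply,
    iteratedFDeriv_two_hermiteFunD]
  rfl

/-- The eigenvalues of the harmonic oscillator. -/
def oscillatorEigen (z b : ℂ) (m : Fin 2 → ℕ) : ℂ := z * (2 * (multiDeg 2 m : ℂ) + 2) + b

theorem isKernel_oscillatorEigen (z b : ℂ) :
    IsKernel (multiDeg 2) (multiDeg 2) (diagKernel (oscillatorEigen z b)) := by
  refine isKernel_diagKernel (2 * ‖z‖ + ‖b‖) 1 fun m => ?_
  have h1 : ‖oscillatorEigen z b m‖ ≤ ‖z‖ * (2 * (multiDeg 2 m : ℝ) + 2) + ‖b‖ := by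
    refine (norm_add_le _ _).trans ?_
    rw [norm_mul]
    gcongr
    refine (norm_add_le _ _).trans ?_
    simp
  have h2 : (0 : ℝ) ≤ multiDeg 2 m := by positivity
  rw [pow_one]
  nlinarith [norm_nonneg z, norm_nonneg b]

/-- After termwise differentiation the quadratic terms cancel against `|x|²`, leaving the eigenvalue
`(2 m_0 + 1) + (2 m_1 + 1)`. -/
theorem oscillatorOp_expands {a : (Fin 2 → ℕ) → ℂ} {φ : EuclideanSpace ℝ (Fin 2) → ℂ}
    (ha : RapidDecay (multiDeg 2) a) (hφ : Expands (hermiteFunD 2) a φ) (z b : ℂ)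
    (x : EuclideanSpace ℝ (Fin 2)) :
    HasSum (fun m => a m * (oscillatorEigen z b m * (hermiteFunD 2 m x : ℂ)))
      (oscillatorOp z b φ x) := by
  have hL : (Laplacian.laplacian φ) x
      = iteratedFDeriv ℝ 2 φ x ![EuclideanSpace.single 0 1, EuclideanSpace.single 0 1]
        + iteratedFDeriv ℝ 2 φ x ![EuclideanSpace.single 1 1, EuclideanSpace.single 1 1] := by
    rw [InnerProductSpace.laplacian_eq_iteratedFDeriv_orthonormalBasis φ
      (EuclideanSpace.basisFun (Fin 2) ℝ)]
    simp [Fin.sum_univ_two]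
  have h0 := hasSum_iteratedFDeriv_two ha hφ x 0
  have h1 := hasSum_iteratedFDeriv_two ha hφ x 1
  have hx : ‖x‖ ^ 2 = x 0 ^ 2 + x 1 ^ 2 := by
    rw [EuclideanSpace.norm_sq_eq]; simp
  have key := ((((h0.add h1).neg).add ((hφ x).mul_left ((‖x‖ ^ 2 : ℝ) : ℂ))).mul_left z).add
    ((hφ x).mul_left b)
  rw [← hL] at key
  refine key.congr_fun fun m => ?_
  rw [hx, oscillatorEigen, multiDeg, Fin.sum_univ_two]
  push_cast
  ring

/-- The harmonic oscillator as a map of test spaces. -/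
def oscillatorOpMap {K : Scale} (hK : K.Pos) (z b : ℂ) : HermTest K 2 →ₗ[ℂ] HermTest K 2 :=
  kerMap isSystem_hermite_two isSystem_hermite_two (isKernel_oscillatorEigen z b) hK

theorem oscillatorOpMap_coe {K : Scale} (hK : K.Pos) (z b : ℂ) (φ : HermTest K 2) :
    (oscillatorOpMap hK z b φ).1 = oscillatorOp z b φ.1 := by
  obtain ⟨φ, a, ha, haf⟩ := φ
  refine kerOp_eq isSystem_hermite_two isSystem_hermite_two (isKernel_oscillatorEigen z b)
    (ha.rapidDecay hK) haf fun x => ?_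
  simp only [diagKernel_sum]
  exact oscillatorOp_expands (ha.rapidDecay hK) haf z b x

/-! ### One-parameter groups of orthogonal matrices -/

section Orthogonal

variable {n : Type*} [Fintype n] [DecidableEq n]

open scoped Matrix.Norms.Operator in
theorem hasDerivAt_exp_apply (A : Matrix n n ℝ) (θ : ℝ) (k l : n) :
    HasDerivAt (fun θ : ℝ => NormedSpace.exp (θ • A) k l) ((NormedSpace.exp (θ • A) * A) k l) θ ∧
    HasDerivAt (fun θ : ℝ => NormedSpace.exp (θ • A) k l)
      ((A * NormedSpace.exp (θ • A)) k l) θ := by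
  have key : ∀ D : Matrix n n ℝ, HasDerivAt (fun θ : ℝ => NormedSpace.exp (θ • A)) D θ →
      HasDerivAt (fun θ : ℝ => NormedSpace.exp (θ • A) k l) (D k l) θ := fun D h =>
    hasDerivAt_pi.1 (hasDerivAt_pi.1 h k) l
  exact ⟨key _ (hasDerivAt_exp_smul_const A θ), key _ (hasDerivAt_exp_smul_const' A θ)⟩

theorem exp_mul_transpose {A : Matrix n n ℝ} (hA : A.transpose = -A) (θ : ℝ) :
    NormedSpace.exp (θ • A) * (NormedSpace.exp (θ • A)).transpose = 1 := by
  have hc : Commute (θ • A) (-(θ • A)) := (Commute.refl (θ • A)).neg_right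
  rw [← Matrix.exp_transpose, Matrix.transpose_smul, hA, smul_neg,
    ← Matrix.exp_add_of_commute _ _ hc, add_neg_cancel, NormedSpace.exp_zero]

/-- Rows of an orthogonal matrix are unit vectors. The bound is uniform in the size of the matrix,
as the rotation kernel requires. -/
theorem abs_exp_apply_le {A : Matrix n n ℝ} (hA : A.transpose = -A) (θ : ℝ) (k l : n) :
    |NormedSpace.exp (θ • A) k l| ≤ 1 := by
  have h := congrFun (congrFun (exp_mul_transpose hA θ) k) k
  rw [Matrix.mul_apply, Matrix.one_apply_eq] at h
  refine abs_le_of_sq_le_sq ?_ zero_le_one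
  rw [one_pow, ← h]
  simp only [Matrix.transpose_apply, ← sq]
  exact Finset.single_le_sum (f := fun j => NormedSpace.exp (θ • A) k j ^ 2)
    (fun _ _ => sq_nonneg _) (Finset.mem_univ l)

theorem exp_mulVec_of_mulVec_eq_zero {A : Matrix n n ℝ} {g : n → ℝ} (hg : A.mulVec g = 0)
    (θ : ℝ) : (NormedSpace.exp (θ • A)).mulVec g = g := by
  funext k
  have hd : ∀ θ : ℝ, HasDerivAt (fun θ : ℝ => (NormedSpace.exp (θ • A)).mulVec g k) 0 θ := by
    intro θ
    have h1 : HasDerivAt (fun θ : ℝ => ∑ l, NormedSpace.exp (θ • A) k l * g l)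
        (∑ l, (NormedSpace.exp (θ • A) * A) k l * g l) θ :=
      HasDerivAt.fun_sum fun l _ => (hasDerivAt_exp_apply A θ k l).1.mul_const (g l)
    have h2 : ∑ l, (NormedSpace.exp (θ • A) * A) k l * g l = 0 := by
      change ((NormedSpace.exp (θ • A) * A).mulVec g) k = 0
      rw [← Matrix.mulVec_mulVec, hg, Matrix.mulVec_zero]
      rfl
    rw [h2] at h1
    exact h1
  have h3 := is_const_of_deriv_eq_zero (fun θ => (hd θ).differentiableAt)
    (fun θ => (hd θ).deriv) θ 0
  simpa using h3

/-- Variation of constants: `exp(θ A)ᵀ v(θ)` has derivative zero, the transpose being the inverse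
since `A` is skew. -/
theorem eq_exp_mulVec {A : Matrix n n ℝ} (hA : A.transpose = -A) {v : ℝ → n → ℝ}
    (hv : ∀ θ k, HasDerivAt (fun θ => v θ k) (A.mulVec (v θ) k) θ) (θ : ℝ) :
    v θ = (NormedSpace.exp (θ • A)).mulVec (v 0) := by
  have hd : ∀ (k : n) (θ : ℝ),
      HasDerivAt (fun θ : ℝ => (NormedSpace.exp (θ • A)).transpose.mulVec (v θ) k) 0 θ := by
    intro k θ
    set R := NormedSpace.exp (θ • A) with hR
    have h1 : HasDerivAt (fun θ : ℝ => ∑ l, NormedSpace.exp (θ • A) l k * v θ l)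
        (∑ l, ((A * R) l k * v θ l + R l k * A.mulVec (v θ) l)) θ :=
      HasDerivAt.fun_sum fun l _ => (hasDerivAt_exp_apply A θ l k).2.mul (hv θ l)
    have h2 : ∑ l, ((A * R) l k * v θ l + R l k * A.mulVec (v θ) l) = 0 := by
      rw [Finset.sum_add_distrib]
      change (A * R).transpose.mulVec (v θ) k + R.transpose.mulVec (A.mulVec (v θ)) k = 0
      rw [Matrix.transpose_mul, hA, Matrix.mulVec_mulVec, Matrix.mul_neg, Matrix.neg_mulVec]
      simp
    rw [h2] at h1
    exact h1
  have h3 : (NormedSpace.exp (θ • A)).transpose.mulVec (v θ) = v 0 := by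
    funext k
    have h4 := is_const_of_deriv_eq_zero (fun θ => (hd k θ).differentiableAt)
      (fun θ => (hd k θ).deriv) θ 0
    simpa using h4
  rw [← h3, Matrix.mulVec_mulVec, exp_mul_transpose hA, Matrix.one_mulVec]

end Orthogonal

/-! ### Rotations of Hermite functions -/

/-- The off-diagonal entries of the generator of rotations. -/
def rotOff (N k : ℕ) : ℝ := 2 * ladder (k + 1) * ladder (N - k)

/-- The generator of rotations on the products `h_k h_{N-k}`. -/
def rotGen (N : ℕ) : Matrix (Fin (N + 1)) (Fin (N + 1)) ℝ := fun k l =>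
  (if (l : ℕ) = k + 1 then rotOff N k else 0) - if (k : ℕ) = l + 1 then rotOff N l else 0

theorem rotGen_transpose (N : ℕ) : (rotGen N).transpose = -rotGen N := by
  ext k l
  simp [rotGen]

/-- Row `k` has only the neighbours `k ± 1`. At the ends the missing neighbour carries the factor
`ladder 0 = 0`, so the out-of-range values of `g` do not matter. -/
theorem rotGen_sum {M : Type*} [AddCommGroup M] [Module ℝ M] (N : ℕ) (k : Fin (N + 1))
    (g : ℕ → M) : ∑ l, rotGen N k l • g l = rotOff N k • g (k + 1)
      - (2 * ladder k * ladder (N - k + 1)) • g (k - 1) := by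
  have hk : (k : ℕ) < N + 1 := k.2
  simp only [rotGen, sub_smul, Finset.sum_sub_distrib, ite_smul, zero_smul]
  congr 1
  · rw [Fin.sum_univ_eq_sum_range (fun l => if l = (k : ℕ) + 1 then rotOff N k • g l else 0) (N + 1),
      Finset.sum_ite_eq']
    split_ifs with h
    · rfl
    · have : N - k = 0 := by
        rw [Finset.mem_range] at h; omega
      rw [rotOff, this, ladder_zero, mul_zero, zero_smul]
  · rw [Fin.sum_univ_eq_sum_range (fun l => if (k : ℕ) = l + 1 then rotOff N l • g l else 0) (N + 1)]
    obtain ⟨k, hk'⟩ := k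
    simp only at hk ⊢
    cases k with
    | zero => simp [ladder_zero]
    | succ j =>
      simp only [Nat.add_right_cancel_iff, Nat.add_sub_cancel]
      rw [Finset.sum_ite_eq, if_pos (Finset.mem_range.2 (by omega)), rotOff]
      congr 3
      omega

/-- The rotation of the plane by the angle `θ`. -/
def rot (θ : ℝ) (x : EuclideanSpace ℝ (Fin 2)) : EuclideanSpace ℝ (Fin 2) :=
  WithLp.toLp 2 ![x 0 * Real.cos θ - x 1 * Real.sin θ, x 0 * Real.sin θ + x 1 * Real.cos θ]

/-- The matrix coefficients of rotations. -/
def rotCoef (N : ℕ) (θ : ℝ) : Matrix (Fin (N + 1)) (Fin (N + 1)) ℝ :=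
  NormedSpace.exp (θ • rotGen N)

/-- Along a rotation, `d/dθ` is `X ∂_Y - Y ∂_X`. By the ladder relations it maps `h_k h_{N-k}` to
its two neighbours of the same total degree, so the vector of these products solves `v' = A v`. -/
theorem hermiteFunD_rot (N : ℕ) (k : Fin (N + 1)) (θ : ℝ) (x : EuclideanSpace ℝ (Fin 2)) :
    hermiteFunD 2 ![k, N - k] (rot θ x)
      = ∑ l, rotCoef N θ k l * hermiteFunD 2 ![(l : ℕ), N - l] x := by
  set v : ℝ → Fin (N + 1) → ℝ := fun θ k => hermiteFunD 2 ![(k : ℕ), N - k] (rot θ x) with hv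
  have hder : ∀ θ k, HasDerivAt (fun θ => v θ k) ((rotGen N).mulVec (v θ) k) θ := by
    intro θ k
    set X : ℝ → ℝ := fun θ => x 0 * Real.cos θ - x 1 * Real.sin θ with hX
    set Y : ℝ → ℝ := fun θ => x 0 * Real.sin θ + x 1 * Real.cos θ with hY
    have hval : ∀ θ (a b : ℕ), hermiteFunD 2 ![a, b] (rot θ x)
        = hermiteFun a (X θ) * hermiteFun b (Y θ) := fun θ a b => by
      simp [hermiteFunD_two, rot, hX, hY]
    have hX' : HasDerivAt X (-Y θ) θ := by
      refine (((Real.hasDerivAt_cos θ).const_mul (x 0)).sub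
        ((Real.hasDerivAt_sin θ).const_mul (x 1))).congr_deriv ?_
      simp only [hY]; ring
    have hY' : HasDerivAt Y (X θ) θ := by
      refine (((Real.hasDerivAt_sin θ).const_mul (x 0)).add
        ((Real.hasDerivAt_cos θ).const_mul (x 1))).congr_deriv ?_
      simp only [hX]; ring
    have h1 := ((hasDerivAt_hermiteFun k (X θ)).comp θ hX').mul
      ((hasDerivAt_hermiteFun (N - k) (Y θ)).comp θ hY')
    have h2 : (fun θ => v θ k) = (hermiteFun k ∘ X) * (hermiteFun (N - k) ∘ Y) :=
      funext fun θ => by simp only [hv, hval]; rfl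
    rw [h2]
    refine h1.congr_deriv ?_
    have h3 := rotGen_sum N k fun l => hermiteFunD 2 ![l, N - l] (rot θ x)
    simp only [smul_eq_mul, hval] at h3
    have h4 : (rotGen N).mulVec (v θ) k = ∑ l : Fin (N + 1),
        rotGen N k l * (hermiteFun l (X θ) * hermiteFun (N - l) (Y θ)) := by
      simp only [Matrix.mulVec, dotProduct, hv, hval]
    rw [h4, h3]
    have m1 := mul_hermiteFun k (X θ)
    have m2 := mul_hermiteFun (N - k) (Y θ)
    have hkN : (k : ℕ) < N + 1 := k.2
    have e1 : N - (k + 1) = N - k - 1 := by omega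
    simp only [Function.comp_apply, rotOff, e1]
    -- Truncated subtraction makes `N - (k - 1)` differ from `N - k + 1` only at `k = 0`, where the
    -- factor vanishes.
    have e2 : ladder k * hermiteFun (N - (k - 1)) (Y θ)
        = ladder k * hermiteFun (N - k + 1) (Y θ) := by
      rcases Nat.eq_zero_or_pos (k : ℕ) with h0 | h0
      · rw [h0, ladder_zero, zero_mul, zero_mul]
      · rw [show N - ((k : ℕ) - 1) = N - k + 1 by omega]
    linear_combination (ladder k * hermiteFun (k - 1) (X θ)
          - ladder (k + 1) * hermiteFun (k + 1) (X θ)) * (-m2)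
        + (ladder (N - k) * hermiteFun (N - k - 1) (Y θ)
          - ladder (N - k + 1) * hermiteFun (N - k + 1) (Y θ)) * m1
        + 2 * ladder (N - k + 1) * hermiteFun (k - 1) (X θ) * e2
  have h := congrFun (eq_exp_mulVec (rotGen_transpose N) hder θ) k
  have h0 : rot 0 x = x := by
    ext i; fin_cases i <;> simp [rot]
  simp only [Matrix.mulVec, dotProduct, hv, h0] at h
  exact h

/-- The kernel of `φ ↦ φ ∘ rot θ`. -/
def rotKernel (θ : ℝ) : (Fin 2 → ℕ) → (Fin 2 → ℕ) →₀ ℂ :=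
  sumKernel (fun m => Finset.range (m 0 + m 1 + 1)) (fun m l => ![l, m 0 + m 1 - l])
    fun m l => ((rotCoef (m 0 + m 1) θ (Fin.ofNat _ (m 0)) (Fin.ofNat _ l) : ℝ) : ℂ)

theorem isKernel_rotKernel (θ : ℝ) : IsKernel (multiDeg 2) (multiDeg 2) (rotKernel θ) := by
  refine isKernel_sumKernel 1 1 (fun m => ?_) 1 fun m l hl _ => ?_
  · refine (Finset.sum_le_card_nsmul _ _ 1 fun l _ => ?_).trans ?_
    · rw [Complex.norm_real]
      exact abs_exp_apply_le (rotGen_transpose _) θ _ _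
    · rw [Finset.card_range, nsmul_eq_mul]
      simp only [multiDeg, Fin.sum_univ_two]
      push_cast
      linarith
  · rw [Finset.mem_range] at hl
    simp only [multiDeg, Fin.sum_univ_two, Matrix.cons_val_zero, Matrix.cons_val_one]
    omega

theorem rotKernel_sum_smul {M : Type*} [AddCommGroup M] [Module ℂ M] (θ : ℝ) (N : ℕ)
    (k : Fin (N + 1)) (V : (Fin 2 → ℕ) → M) :
    ((rotKernel θ ![k, N - k]).sum fun m c => c • V m)
      = ∑ l : Fin (N + 1), ((rotCoef N θ k l : ℝ) : ℂ) • V ![l, N - l] := by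
  rw [rotKernel, sumKernel_sum_smul]
  have hN : ![(k : ℕ), N - k] 0 + ![(k : ℕ), N - k] 1 = N := by
    have := k.2
    simp only [Matrix.cons_val_zero, Matrix.cons_val_one]
    omega
  -- The size of the matrix in the kernel equals `N` only propositionally; generalizing it allows
  -- substitution in the dependent types.
  have gen : ∀ N', N' = N → ∑ l ∈ Finset.range (N' + 1),
      ((rotCoef N' θ (Fin.ofNat _ (k : ℕ)) (Fin.ofNat _ l) : ℝ) : ℂ) • V ![l, N' - l]
      = ∑ l : Fin (N + 1), ((rotCoef N θ k l : ℝ) : ℂ) • V ![l, N - l] := by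
    rintro N' rfl
    rw [Finset.sum_range]
    refine Finset.sum_congr rfl fun l _ => ?_
    rw [Fin.ofNat_val_eq_self, Fin.ofNat_val_eq_self]
  exact gen _ hN

theorem exists_fin_eq (m : Fin 2 → ℕ) : ∃ (N : ℕ) (k : Fin (N + 1)), m = ![(k : ℕ), N - k] := by
  refine ⟨m 0 + m 1, ⟨m 0, by omega⟩, ?_⟩
  funext i
  fin_cases i <;> simp

theorem rotKernel_sum (θ : ℝ) (m : Fin 2 → ℕ) (x : EuclideanSpace ℝ (Fin 2)) :
    ∑ l ∈ (rotKernel θ m).support, rotKernel θ m l * (hermiteFunD 2 l x : ℂ)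
      = (hermiteFunD 2 m (rot θ x) : ℂ) := by
  obtain ⟨N, k, rfl⟩ := exists_fin_eq m
  have := rotKernel_sum_smul θ N k fun l => (hermiteFunD 2 l x : ℂ)
  rw [Finsupp.sum] at this
  simp only [smul_eq_mul] at this
  rw [this, hermiteFunD_rot]
  push_cast
  rfl

/-- Composition with a rotation. -/
def rotMap {K : Scale} (hK : K.Pos) (θ : ℝ) : HermTest K 2 →ₗ[ℂ] HermTest K 2 :=
  kerMap isSystem_hermite_two isSystem_hermite_two (isKernel_rotKernel θ) hK

theorem rotMap_coe {K : Scale} (hK : K.Pos) (θ : ℝ) (φ : HermTest K 2) :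
    (rotMap hK θ φ).1 = fun x => φ.1 (rot θ x) := by
  obtain ⟨φ, a, ha, haf⟩ := φ
  refine kerOp_eq isSystem_hermite_two isSystem_hermite_two (isKernel_rotKernel θ)
    (ha.rapidDecay hK) haf fun x => ?_
  simp only [rotKernel_sum]
  exact haf _

/-- The reflection of the second coordinate. -/
def reflect (x : EuclideanSpace ℝ (Fin 2)) : EuclideanSpace ℝ (Fin 2) :=
  WithLp.toLp 2 ![x 0, -x 1]

theorem isKernel_reflect :
    IsKernel (multiDeg 2) (multiDeg 2) (diagKernel fun m : Fin 2 → ℕ => (-1 : ℂ) ^ m 1) :=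
  isKernel_diagKernel 1 0 fun m => by simp

/-- Composition with the reflection. -/
def reflectMap {K : Scale} (hK : K.Pos) : HermTest K 2 →ₗ[ℂ] HermTest K 2 :=
  kerMap isSystem_hermite_two isSystem_hermite_two isKernel_reflect hK

theorem reflectMap_coe {K : Scale} (hK : K.Pos) (φ : HermTest K 2) :
    (reflectMap hK φ).1 = fun x => φ.1 (reflect x) := by
  obtain ⟨φ, a, ha, haf⟩ := φ
  refine kerOp_eq isSystem_hermite_two isSystem_hermite_two isKernel_reflect
    (ha.rapidDecay hK) haf fun x => ?_
  refine (haf (reflect x)).congr_fun fun m => ?_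
  rw [diagKernel_sum, hermiteFunD_two, hermiteFunD_two]
  have h0 : reflect x 0 = x 0 := by simp [reflect]
  have h1 : reflect x 1 = -x 1 := by simp [reflect]
  rw [h0, h1, hermiteFun_neg]
  push_cast
  ring

/-! ### The orthogonal group of the plane -/

theorem complex_repr_apply (z : ℂ) :
    Complex.orthonormalBasisOneI.repr z = WithLp.toLp 2 ![z.re, z.im] := by
  ext i
  fin_cases i <;> simp

theorem complex_repr_rotation (θ : ℝ) (z : ℂ) :
    Complex.orthonormalBasisOneI.repr (rotation (Circle.exp θ) z)
      = rot θ (Complex.orthonormalBasisOneI.repr z) := by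
  rw [complex_repr_apply, complex_repr_apply, rotation_apply, Circle.coe_exp, rot]
  congr 1
  ext i
  fin_cases i
  · simp [Complex.exp_ofReal_mul_I_re, Complex.exp_ofReal_mul_I_im]; ring
  · simp [Complex.exp_ofReal_mul_I_re, Complex.exp_ofReal_mul_I_im]; ring

theorem exists_isometry_symm_eq_rot (θ : ℝ) :
    ∃ A : EuclideanSpace ℝ (Fin 2) ≃ₗᵢ[ℝ] EuclideanSpace ℝ (Fin 2), ∀ x, A.symm x = rot θ x := by
  set E := Complex.orthonormalBasisOneI.repr
  refine ⟨((E.symm.trans (rotation (Circle.exp θ))).trans E).symm, fun x => ?_⟩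
  rw [LinearIsometryEquiv.symm_symm]
  have h := complex_repr_rotation θ (E.symm x)
  have h1 : E (E.symm x) = x := E.apply_symm_apply x
  exact h.trans (congrArg (rot θ) h1)

/-- Through the identification with `ℂ` this is the classification of its real-linear isometries: a
rotation, possibly preceded by conjugation. -/
theorem isometry_eq_rot (A : EuclideanSpace ℝ (Fin 2) ≃ₗᵢ[ℝ] EuclideanSpace ℝ (Fin 2)) :
    ∃ θ : ℝ, (∀ x, A x = rot θ x) ∨ ∀ x, A x = rot θ (reflect x) := by
  set E := Complex.orthonormalBasisOneI.repr
  obtain ⟨a, ha⟩ := linear_isometry_complex ((E.trans A).trans E.symm)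
  refine ⟨Complex.arg a, ?_⟩
  have hA : ∀ x, A x = E (((E.trans A).trans E.symm) (E.symm x)) := fun x => by simp
  have hr : ∀ z, E (rotation a z) = rot (Complex.arg a) (E z) := fun z => by
    rw [← complex_repr_rotation, Circle.exp_arg]
  rcases ha with h | h
  · left
    intro x
    rw [hA, h, hr, LinearIsometryEquiv.apply_symm_apply]
  · right
    intro x
    have hc : E (Complex.conjLIE (E.symm x)) = reflect x := by
      obtain ⟨z, rfl⟩ := E.surjective x
      rw [E.symm_apply_apply, complex_repr_apply, complex_repr_apply, reflect]
      simp
    rw [hA, h, LinearIsometryEquiv.trans_apply, hr, hc]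

/-! ### The maps on basis functions -/

/-- The Laguerre functions as test functions. -/
def lagBasis (K : Scale) (n : ℕ) : LagTest K := basisVec K (fun n : ℕ => n) laguerreFun n

/-- The Hermite functions of the plane as test functions. -/
def hermBasis (K : Scale) (m : Fin 2 → ℕ) : HermTest K 2 := basisVec K (multiDeg 2) (hermiteFunD 2) m

theorem LagDual.ext_basis {K : Scale} (hK : K.Pos) {u v : LagTest K →ₗ[ℂ] ℂ}
    (hu : K.IsContinuous (fun n : ℕ => n) laguerreFun (LagTest K) u)
    (hv : K.IsContinuous (fun n : ℕ => n) laguerreFun (LagTest K) v)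
    (h : ∀ n, u (lagBasis K n) = v (lagBasis K n)) : u = v :=
  ext_of_basisVec isSystem_laguerre hK hu hv h

theorem HermDual.ext_basis {K : Scale} (hK : K.Pos) {u v : HermTest K 2 →ₗ[ℂ] ℂ}
    (hu : K.IsContinuous (multiDeg 2) (hermiteFunD 2) (HermTest K 2) u)
    (hv : K.IsContinuous (multiDeg 2) (hermiteFunD 2) (HermTest K 2) v)
    (h : ∀ n, u (hermBasis K n) = v (hermBasis K n)) : u = v :=
  ext_of_basisVec isSystem_hermite_two hK hu hv h

/-- The coefficients, up to a constant, of the radial functions with respect to the products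
`h_l h_{N-l}`. -/
def radialVec (N l : ℕ) : ℝ :=
  if Even l ∧ Even (N - l) then evenCoeff (l / 2) * evenCoeff ((N - l) / 2) / Real.pi else 0

section Basis

variable {K : Scale} (hK : K.Pos)

theorem liftMap_lagBasis (n : ℕ) : liftMap hK (lagBasis K n) = ∑ z ∈ antidiagonal n,
    ((evenCoeff z.1 * evenCoeff z.2 : ℝ) : ℂ) • hermBasis K ![2 * z.1, 2 * z.2] :=
  (kerMap_basisVec isSystem_laguerre isSystem_hermite_two isKernel_liftKernel hK n).trans
    (sumKernel_sum_smul n _)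

theorem projMap_hermBasis (m : Fin 2 → ℕ) : projMap hK (hermBasis K m) =
    (radialVec (m 0 + m 1) (m 0) : ℂ) • lagBasis K ((m 0 + m 1) / 2) := by
  refine ((kerMap_basisVec isSystem_hermite_two isSystem_laguerre isKernel_projKernel hK m).trans
    (sumKernel_sum_smul m _)).trans ?_
  rw [Finset.sum_singleton, radialVec, Nat.add_sub_cancel_left]
  split_ifs
  · rfl
  · rw [Complex.ofReal_zero]; rfl

theorem laguerreOpMap_lagBasis (ρ c : ℂ) (n : ℕ) :
    laguerreOpMap hK ρ c (lagBasis K n) = laguerreEigen ρ c n • lagBasis K n :=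
  (kerMap_basisVec isSystem_laguerre isSystem_laguerre (isKernel_laguerreEigen ρ c) hK n).trans
    (diagKernel_sum_smul _ n _)

theorem oscillatorOpMap_hermBasis (z b : ℂ) (m : Fin 2 → ℕ) :
    oscillatorOpMap hK z b (hermBasis K m) = oscillatorEigen z b m • hermBasis K m :=
  (kerMap_basisVec isSystem_hermite_two isSystem_hermite_two (isKernel_oscillatorEigen z b) hK
    m).trans (diagKernel_sum_smul _ m _)

theorem rotMap_hermBasis (θ : ℝ) (N : ℕ) (k : Fin (N + 1)) :
    rotMap hK θ (hermBasis K ![k, N - k])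
      = ∑ l : Fin (N + 1), (rotCoef N θ k l : ℂ) • hermBasis K ![l, N - l] :=
  (kerMap_basisVec isSystem_hermite_two isSystem_hermite_two (isKernel_rotKernel θ) hK _).trans
    (rotKernel_sum_smul θ N k _)

theorem reflectMap_hermBasis (m : Fin 2 → ℕ) :
    reflectMap hK (hermBasis K m) = (-1 : ℂ) ^ m 1 • hermBasis K m :=
  (kerMap_basisVec isSystem_hermite_two isSystem_hermite_two isKernel_reflect hK m).trans
    (diagKernel_sum_smul _ m _)

end Basis

/-! ### Rotation invariant sequences -/

theorem ladder_mul_evenCoeff (i j : ℕ) :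
    ladder (2 * i + 2) * ladder (2 * j + 1) * (evenCoeff (i + 1) * evenCoeff j)
      = ladder (2 * i + 1) * ladder (2 * j + 2) * (evenCoeff i * evenCoeff (j + 1)) := by
  linear_combination (ladder (2 * j + 1) * evenCoeff j) * evenCoeff_succ i
    - (ladder (2 * i + 1) * evenCoeff i) * evenCoeff_succ j

theorem radialVec_two_mul (i j : ℕ) :
    radialVec (2 * i + 2 * j) (2 * i) = evenCoeff i * evenCoeff j / Real.pi := by
  rw [radialVec, Nat.add_sub_cancel_left, if_pos ⟨even_two_mul i, even_two_mul j⟩,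
    Nat.mul_div_cancel_left _ two_pos, Nat.mul_div_cancel_left _ two_pos]

/-- Even rows only see odd entries, which vanish. In odd rows with `N` even the two neighbouring
terms cancel by `ladder_mul_evenCoeff`; with `N` odd there is nothing left. -/
theorem rotGen_mulVec_radialVec (N : ℕ) :
    (rotGen N).mulVec (fun l => radialVec N l) = 0 := by
  funext k
  have h := rotGen_sum N k (radialVec N)
  simp only [smul_eq_mul] at h
  change ∑ l, rotGen N k l * radialVec N l = 0
  have hk : (k : ℕ) < N + 1 := k.2
  rw [h]
  generalize (k : ℕ) = k at hk
  rcases Nat.even_or_odd' k with ⟨i, rfl | rfl⟩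
  · have h1 : radialVec N (2 * i + 1) = 0 := if_neg fun h => by
      have := h.1; rw [Nat.even_iff] at this; omega
    rw [h1, mul_zero, zero_sub, neg_eq_zero]
    cases i with
    | zero => rw [mul_zero, ladder_zero, mul_zero, zero_mul, zero_mul]
    | succ i =>
      have h2 : radialVec N (2 * (i + 1) - 1) = 0 := if_neg fun h => by
        have := h.1; rw [Nat.even_iff] at this; omega
      rw [h2, mul_zero]
  · rcases Nat.even_or_odd' N with ⟨n, rfl | rfl⟩
    · obtain ⟨j, rfl⟩ : ∃ j, n = i + j + 1 := ⟨n - i - 1, by omega⟩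
      have e1 := radialVec_two_mul (i + 1) j
      have e2 := radialVec_two_mul i (j + 1)
      rw [show 2 * (i + 1) + 2 * j = 2 * (i + j + 1) by ring] at e1
      rw [show 2 * i + 2 * (j + 1) = 2 * (i + j + 1) by ring] at e2
      rw [rotOff, show 2 * i + 1 + 1 = 2 * (i + 1) by ring, Nat.add_sub_cancel, e1, e2,
        show 2 * (i + j + 1) - (2 * i + 1) = 2 * j + 1 by omega]
      have h3 := ladder_mul_evenCoeff i j
      rw [show 2 * (i + 1) = 2 * i + 2 by ring, show 2 * j + 1 + 1 = 2 * j + 2 by ring]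
      linear_combination (2 / Real.pi) * h3
    · have h2 : radialVec (2 * n + 1) (2 * i + 1 - 1) = 0 := if_neg fun h => by
        have := h.2; rw [Nat.even_iff] at this; omega
      rw [h2, mul_zero, sub_zero]
      -- In the last row the index is `N + 1`, whose truncated complement `0` is even, so the parity
      -- argument fails there; the factor `ladder 0` takes over.
      rcases eq_or_ne n i with rfl | hne
      · rw [rotOff, Nat.sub_self, ladder_zero, mul_zero, zero_mul]
      · have h1 : radialVec (2 * n + 1) (2 * i + 1 + 1) = 0 := if_neg fun h => by
          have := h.2; rw [Nat.even_iff] at this; omega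
        rw [h1, mul_zero]

theorem rotCoef_sum_radialVec (N : ℕ) (θ : ℝ) (k : Fin (N + 1)) :
    ∑ l : Fin (N + 1), rotCoef N θ k l * radialVec N l = radialVec N k :=
  congrFun (exp_mulVec_of_mulVec_eq_zero (rotGen_mulVec_radialVec N) θ) k

/-- Differentiate the invariance under `exp(θ A)` at `θ = 0`. -/
theorem rotGen_sum_eq_zero {N : ℕ} {W : ℕ → ℂ} {k : Fin (N + 1)}
    (h : ∀ θ : ℝ, ∑ l : Fin (N + 1), (rotCoef N θ k l : ℂ) * W l = W k) :
    ∑ l : Fin (N + 1), rotGen N k l • W l = 0 := by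
  have h1 : HasDerivAt (fun θ : ℝ => ∑ l : Fin (N + 1), (rotCoef N θ k l : ℂ) * W l)
      (∑ l : Fin (N + 1), (((NormedSpace.exp ((0 : ℝ) • rotGen N) * rotGen N) k l : ℝ) : ℂ) * W l)
      0 :=
    HasDerivAt.fun_sum fun l _ =>
      ((hasDerivAt_exp_apply (rotGen N) 0 k l).1.ofReal_comp).mul_const (W l)
  simp only [h] at h1
  have h2 := h1.unique (hasDerivAt_const (0 : ℝ) (W k))
  rw [zero_smul, NormedSpace.exp_zero, one_mul] at h2
  simpa only [Complex.real_smul] using h2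

/-- The odd rows of the kernel equation link `W (2i)` to `W (2i + 2)` by the relation satisfied by
`c_i c_{n-i}`. Its coefficients do not vanish, so `W 0` determines all even entries. -/
theorem eq_mul_evenCoeff {n : ℕ} {W : ℕ → ℂ}
    (h : ∀ k : Fin (2 * n + 1), ∑ l : Fin (2 * n + 1), rotGen (2 * n) k l • W l = 0) :
    ∃ c : ℂ, ∀ i j, i + j = n → W (2 * i) = c * ((evenCoeff i * evenCoeff j : ℝ) : ℂ) := by
  have hne : ((evenCoeff 0 * evenCoeff n : ℝ) : ℂ) ≠ 0 := by
    exact_mod_cast mul_ne_zero (evenCoeff_ne_zero 0) (evenCoeff_ne_zero n)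
  refine ⟨W 0 / ((evenCoeff 0 * evenCoeff n : ℝ) : ℂ), fun i => ?_⟩
  induction i with
  | zero =>
    rintro j hj
    rw [zero_add] at hj
    rw [hj, mul_zero, div_mul_cancel₀ _ hne]
  | succ i ih =>
    intro j hj
    have h1 := ih (j + 1) (by omega)
    have h2 := rotGen_sum (2 * n) ⟨2 * i + 1, by omega⟩ W
    rw [h] at h2
    simp only [rotOff, Complex.real_smul, Nat.add_sub_cancel] at h2
    rw [show 2 * n - (2 * i + 1) = 2 * j + 1 by omega, h1] at h2
    have h3 := ladder_mul_evenCoeff i j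
    have hA : ((ladder (2 * i + 2) * ladder (2 * j + 1) : ℝ) : ℂ) ≠ 0 := by
      exact_mod_cast mul_ne_zero (ladder_pos _).ne' (ladder_pos _).ne'
    have h3' : ((ladder (2 * i + 2) * ladder (2 * j + 1) : ℝ) : ℂ)
        * ((evenCoeff (i + 1) * evenCoeff j : ℝ) : ℂ)
        = ((ladder (2 * i + 1) * ladder (2 * j + 2) : ℝ) : ℂ)
          * ((evenCoeff i * evenCoeff (j + 1) : ℝ) : ℂ) := by exact_mod_cast h3
    apply mul_left_cancel₀ hA
    push_cast at h2 h3' ⊢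
    rw [show 2 * (i + 1) = 2 * i + 1 + 1 by ring]
    linear_combination (-1 / 2 : ℂ) * h2
      - (W 0 / ((evenCoeff 0 : ℂ) * evenCoeff n)) * h3'

/-! ### Radial ultradistributions -/

section Radial

variable {K : Scale} (hK : K.Pos)

/-- The radial ultradistribution that corresponds to an ultradistribution on the half line. -/
def radialDual (u : LagDual K) : HermDual K 2 :=
  Subtype.mk (u.1 ∘ₗ projMap hK)
    (u.2.comp_kerMap isSystem_hermite_two isSystem_laguerre isKernel_projKernel hK)

/-- The restriction of an ultradistribution on the plane to the radial test functions. -/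
def radialPart (w : HermDual K 2) : LagDual K :=
  Subtype.mk (w.1 ∘ₗ liftMap hK)
    (w.2.comp_kerMap isSystem_laguerre isSystem_hermite_two isKernel_liftKernel hK)

/-- On each degree the values on the products `h_k h_{N-k}` are proportional to `radialVec N`, which
`exp(θ A)` fixes. -/
theorem radialDual_comp_rotMap (u : LagDual K) (θ : ℝ) :
    (radialDual hK u).1 ∘ₗ rotMap hK θ = (radialDual hK u).1 := by
  refine HermDual.ext_basis hK ((radialDual hK u).2.comp_kerMap isSystem_hermite_two
    isSystem_hermite_two (isKernel_rotKernel θ) hK) (radialDual hK u).2 fun m => ?_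
  obtain ⟨N, k, rfl⟩ := exists_fin_eq m
  have hval : ∀ k : Fin (N + 1), (radialDual hK u).1 (hermBasis K ![k, N - k])
      = (radialVec N k : ℂ) * u.1 (lagBasis K (N / 2)) := fun k => by
    have hN : (k : ℕ) + (N - k) = N := by omega
    change u.1 (projMap hK _) = _
    rw [projMap_hermBasis]
    simp only [Matrix.cons_val_zero, Matrix.cons_val_one, hN, map_smul, smul_eq_mul]
  rw [LinearMap.comp_apply, rotMap_hermBasis, map_sum]
  simp only [map_smul, hval, smul_eq_mul]
  rw [← rotCoef_sum_radialVec N θ k]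
  push_cast
  rw [Finset.sum_mul]
  exact Finset.sum_congr rfl fun l _ => by ring

theorem radialDual_comp_reflectMap (u : LagDual K) :
    (radialDual hK u).1 ∘ₗ reflectMap hK = (radialDual hK u).1 := by
  refine HermDual.ext_basis hK ((radialDual hK u).2.comp_kerMap isSystem_hermite_two
    isSystem_hermite_two isKernel_reflect hK) (radialDual hK u).2 fun m => ?_
  rw [LinearMap.comp_apply, reflectMap_hermBasis, map_smul, smul_eq_mul]
  change _ * u.1 (projMap hK _) = u.1 (projMap hK _)
  rw [projMap_hermBasis, map_smul, radialVec, Nat.add_sub_cancel_left]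
  split_ifs with h
  · rw [h.2.neg_one_pow, one_mul]
  · simp

theorem radialDual_isRadial (u : LagDual K) : (radialDual hK u).IsRadial := by
  intro A φ
  have key : ∀ ψ : HermTest K 2, ψ.1 = (fun x => φ.1 (A.symm x)) →
      (radialDual hK u).1 ψ = (radialDual hK u).1 φ →
      ∃ h : (fun x => φ.1 (A.symm x)) ∈ HermTest K 2,
        (radialDual hK u).1 ⟨_, h⟩ = (radialDual hK u).1 φ := by
    rintro ⟨ψ, hψ⟩ rfl h
    exact ⟨hψ, h⟩
  obtain ⟨θ, h | h⟩ := isometry_eq_rot A.symm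
  · refine key (rotMap hK θ φ) ?_ (LinearMap.congr_fun (radialDual_comp_rotMap hK u θ) φ)
    rw [rotMap_coe]
    simp only [h]
  · refine key (reflectMap hK (rotMap hK θ φ)) ?_
      ((LinearMap.congr_fun (radialDual_comp_reflectMap hK u) _).trans
        (LinearMap.congr_fun (radialDual_comp_rotMap hK u θ) φ))
    rw [reflectMap_coe, rotMap_coe]
    simp only [h]

theorem HermDual.IsRadial.isEven {d : ℕ} {w : HermDual K d} (hw : w.IsRadial) : w.IsEven := by
  intro ε φ
  have hinv : Function.Involutive (signFlip ε) := fun x => by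
    ext i
    rcases Int.units_eq_one_or (ε i) with h | h <;> simp [signFlip, h]
  set A : EuclideanSpace ℝ (Fin d) ≃ₗᵢ[ℝ] EuclideanSpace ℝ (Fin d) :=
    { toFun := signFlip ε
      invFun := signFlip ε
      left_inv := hinv
      right_inv := hinv
      map_add' := fun x y => by ext i; simp [signFlip, mul_add]
      map_smul' := fun c x => by ext i; simp [signFlip]; ring
      norm_map' := norm_signFlip ε }
  exact hw A φ

/-- Flipping the sign of coordinate `i` negates the basis function, so the value equals its own
negative. -/
theorem HermDual.IsEven.apply_hermBasis {w : HermDual K 2} (hw : w.IsEven) {m : Fin 2 → ℕ}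
    {i : Fin 2} (hi : Odd (m i)) : w.1 (hermBasis K m) = 0 := by
  obtain ⟨h, h1⟩ := hw (Pi.mulSingle i (-1)) (hermBasis K m)
  have h2 : (⟨_, h⟩ : HermTest K 2) = -hermBasis K m := by
    refine Subtype.ext (funext fun x => ?_)
    have h3 : hermiteFunD 2 m (signFlip (Pi.mulSingle i (-1)) x) = -hermiteFunD 2 m x := by
      rw [hermiteFunD_two, hermiteFunD_two]
      fin_cases i
      · simp at hi
        simp [signFlip, hermiteFun_neg, hi.neg_one_pow]
      · simp at hi
        simp [signFlip, hermiteFun_neg, hi.neg_one_pow]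
    change ((hermiteFunD 2 m (signFlip (Pi.mulSingle i (-1)) x) : ℝ) : ℂ)
      = -((hermiteFunD 2 m x : ℝ) : ℂ)
    rw [h3]
    push_cast
    rfl
  rw [h2, map_neg] at h1
  exact self_eq_neg.1 h1.symm

theorem HermDual.IsRadial.comp_rotMap {w : HermDual K 2} (hw : w.IsRadial) (θ : ℝ)
    (φ : HermTest K 2) : w.1 (rotMap hK θ φ) = w.1 φ := by
  obtain ⟨A, hA⟩ := exists_isometry_symm_eq_rot θ
  obtain ⟨h, h1⟩ := hw A φ
  rw [← h1]
  congr 1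
  refine Subtype.ext ?_
  rw [rotMap_coe]
  simp only [hA]

/-- A radial functional is determined by its values on radial test functions. Invariance forces its
value on `h_{2i} h_{2j}` to be a constant depending on `i + j` times `c_i c_j`; summing over the
degree yields `π`, which the projection divides out. On the other products both sides vanish by
evenness. -/
theorem HermDual.IsRadial.eq_lift_proj {w : HermDual K 2} (hw : w.IsRadial) (φ : HermTest K 2) :
    w.1 (liftMap hK (projMap hK φ)) = w.1 φ := by
  refine LinearMap.congr_fun (f := (radialDual hK (radialPart hK w)).1) (HermDual.ext_basis hK
    (radialDual hK (radialPart hK w)).2 w.2 fun m => ?_) φ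
  change w.1 (liftMap hK (projMap hK (hermBasis K m))) = _
  rw [projMap_hermBasis]
  by_cases hm : Even (m 0) ∧ Even (m 1)
  · obtain ⟨⟨i, hi⟩, ⟨j, hj⟩⟩ := hm
    have hm' : m = ![2 * i, 2 * j] := by
      funext s
      fin_cases s
      · simp; omega
      · simp; omega
    subst hm'
    simp only [Matrix.cons_val_zero, Matrix.cons_val_one]
    rw [radialVec_two_mul, ← mul_add, Nat.mul_div_cancel_left _ two_pos, map_smul, map_smul,
      liftMap_lagBasis, map_sum]
    obtain ⟨c, hc⟩ := eq_mul_evenCoeff (n := i + j)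
      (W := fun l => w.1 (hermBasis K ![l, 2 * (i + j) - l])) fun k =>
        rotGen_sum_eq_zero (W := fun l => w.1 (hermBasis K ![l, 2 * (i + j) - l])) fun θ => by
          have h := hw.comp_rotMap hK θ (hermBasis K ![k, 2 * (i + j) - k])
          rw [rotMap_hermBasis, map_sum] at h
          simpa only [map_smul, smul_eq_mul] using h
    have hc' : ∀ z ∈ antidiagonal (i + j), w.1 (hermBasis K ![2 * z.1, 2 * z.2])
        = c * ((evenCoeff z.1 * evenCoeff z.2 : ℝ) : ℂ) := fun z hz => by
      have hz' := Finset.HasAntidiagonal.mem_antidiagonal.1 hz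
      rw [← hc z.1 z.2 hz', show 2 * (i + j) - 2 * z.1 = 2 * z.2 by omega]
    have hsum : ∑ z ∈ antidiagonal (i + j), w.1 (((evenCoeff z.1 * evenCoeff z.2 : ℝ) : ℂ) •
        hermBasis K ![2 * z.1, 2 * z.2]) = c * (Real.pi : ℂ) := by
      rw [← sum_evenCoeff_sq (i + j)]
      push_cast
      rw [Finset.mul_sum]
      refine Finset.sum_congr rfl fun z hz => ?_
      have := hc' z hz
      push_cast at this
      rw [map_smul, this, smul_eq_mul]
      ring
    have hpi : (Real.pi : ℂ) ≠ 0 := by exact_mod_cast Real.pi_ne_zero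
    rw [hsum, hc' (i, j) (by simp), smul_eq_mul]
    push_cast
    field_simp
  · have h1 : radialVec (m 0 + m 1) (m 0) = 0 := by
      rw [radialVec, Nat.add_sub_cancel_left, if_neg hm]
    rw [h1, Complex.ofReal_zero, zero_smul, map_zero, map_zero]
    rw [not_and_or, Nat.not_even_iff_odd, Nat.not_even_iff_odd] at hm
    rcases hm with hm | hm
    · exact (hw.isEven.apply_hermBasis hm).symm
    · exact (hw.isEven.apply_hermBasis hm).symm

/-- Lifting and then projecting `l_n` multiplies it by `∑ (c_i c_j)² / π = 1`. -/
theorem proj_lift (u : LagDual K) (φ : LagTest K) :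
    u.1 (projMap hK (liftMap hK φ)) = u.1 φ := by
  refine LinearMap.congr_fun (f := (radialPart hK (radialDual hK u)).1) (LagDual.ext_basis hK
    (radialPart hK (radialDual hK u)).2 u.2 fun n => ?_) φ
  change u.1 (projMap hK (liftMap hK (lagBasis K n))) = _
  rw [liftMap_lagBasis, map_sum, map_sum]
  have hterm : ∀ z ∈ antidiagonal n, u.1 (projMap hK (((evenCoeff z.1 * evenCoeff z.2 : ℝ) : ℂ) •
      hermBasis K ![2 * z.1, 2 * z.2]))
      = (((evenCoeff z.1 * evenCoeff z.2) ^ 2 : ℝ) : ℂ) * (u.1 (lagBasis K n) / Real.pi) := by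
    intro z hz
    have hz' := Finset.HasAntidiagonal.mem_antidiagonal.1 hz
    rw [map_smul, projMap_hermBasis]
    simp only [Matrix.cons_val_zero, Matrix.cons_val_one]
    rw [radialVec_two_mul, ← mul_add, hz', Nat.mul_div_cancel_left _ two_pos, map_smul, map_smul,
      smul_eq_mul, smul_eq_mul]
    push_cast
    ring
  have hpi : (Real.pi : ℂ) ≠ 0 := by exact_mod_cast Real.pi_ne_zero
  rw [Finset.sum_congr rfl hterm, ← Finset.sum_mul, ← Complex.ofReal_sum, sum_evenCoeff_sq,
    mul_div_cancel₀ _ hpi]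

end Radial

/-! ### The two images -/

theorem Scale.IsContinuous.comp_inclusion {ι X : Type*} {deg : ι → ℕ} {e : ι → X → ℝ}
    {K : Scale} {V W : Submodule ℂ (X → ℂ)} (hWV : W ≤ V) {u : V →ₗ[ℂ] ℂ}
    (hu : K.IsContinuous deg e V u) :
    K.IsContinuous deg e W (u ∘ₗ Submodule.inclusion hWV) := by
  cases K with
  | finite => trivial
  | roumieu α =>
    intro h hh
    obtain ⟨C, hC⟩ := hu h hh
    exact ⟨C, fun f a M haf ha => hC (Submodule.inclusion hWV f) a M haf ha⟩
  | beurling α =>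
    obtain ⟨h, hh, C, hC⟩ := hu
    exact ⟨h, hh, C, fun f a M haf hadm ha => hC (Submodule.inclusion hWV f) a M haf hadm ha⟩

section Images

variable {K : Scale}

/-- Testing on `ψ(x) = φ(x²)`, for which `𝒥 ψ = φ`, gives one direction. Conversely `v` is taken to
be `u ∘ 𝒥`, continuous because `𝒥` is given by a kernel. -/
theorem isBackwardImage_iff (hK : K.Pos) {w : HermDual K 2} {u : LagDual K} :
    IsBackwardImage w u ↔ ∀ φ : LagTest K, u.1 φ = w.1 (liftMap hK φ) := by
  constructor
  · rintro ⟨v, hw, hu⟩ φ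
    set ψ : HermEven K 1 :=
      ⟨radialLift φ.1, radialLift_mem_one hK φ.2, radialLift_even φ.1⟩ with hψ
    obtain ⟨h, hv⟩ := hw ψ
    obtain ⟨h', hv'⟩ := hu ψ
    have e : (⟨_, h'⟩ : LagTest K) = φ := Subtype.ext (mapJ_radialLift φ.1)
    have e' : (⟨_, h⟩ : HermTest K 2) = liftMap hK φ := by
      refine Subtype.ext ?_
      rw [liftMap_coe]
      exact (mapPhi_eq _).trans (congrArg radialLift (mapJ_radialLift φ.1))
    rw [e] at hv'
    rw [e'] at hv
    rw [← hv', hv]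
  · intro h
    have hroot : ∀ ψ : HermEven K 1,
        (rootMap hK (Submodule.inclusion inf_le_left ψ)).1 = mapJ ψ.1 := fun ψ =>
      rootMap_coe hK _ ψ.2.2
    refine ⟨Subtype.mk ((u.1 ∘ₗ rootMap hK) ∘ₗ Submodule.inclusion inf_le_left)
      (Scale.IsContinuous.comp_inclusion inf_le_left (u.2.comp_kerMap isSystem_hermite_one
        isSystem_laguerre isKernel_rootKernel hK)), fun ψ => ?_, fun ψ => ?_⟩
    · have e : (liftMap hK (rootMap hK (Submodule.inclusion inf_le_left ψ))).1 = mapPhi ψ.1 := by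
        rw [liftMap_coe, hroot, mapPhi_eq]
      refine ⟨e ▸ (liftMap hK _).2, (h _).trans ?_⟩
      congr 1
      exact Subtype.ext e
    · refine ⟨hroot ψ ▸ (rootMap hK _).2, ?_⟩
      change u.1 (rootMap hK _) = _
      congr 1
      exact Subtype.ext (hroot ψ)

/-- For radial `w` the relation `u = w ∘ lift` can be inverted, the lift and the projection being
mutually inverse as seen by `u` and `w`. -/
theorem isForwardImage_iff (hK : K.Pos) {w : HermDual K 2} {u : LagDual K} :
    IsForwardImage u w ↔ w.IsRadial ∧ ∀ φ : HermTest K 2, w.1 φ = u.1 (projMap hK φ) := by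
  have h0 : IsForwardImage u w ↔ w.IsRadial ∧ IsBackwardImage w u :=
    and_congr_right fun _ => exists_congr fun _ => and_comm
  rw [h0, isBackwardImage_iff hK]
  refine and_congr_right fun hw => ⟨fun h φ => ?_, fun h φ => ?_⟩
  · rw [h, hw.eq_lift_proj]
  · rw [h, proj_lift]

theorem existsUnique_isForwardImage (hK : K.Pos) (u : LagDual K) :
    ∃! w : HermDual K 2, IsForwardImage u w := by
  refine ⟨radialDual hK u, (isForwardImage_iff hK).2 ⟨radialDual_isRadial hK u, fun _ => rfl⟩,
    fun w hw => Subtype.ext (LinearMap.ext fun φ => ((isForwardImage_iff hK).1 hw).2 φ)⟩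

theorem existsUnique_isBackwardImage (hK : K.Pos) (w : HermDual K 2) :
    ∃! u : LagDual K, IsBackwardImage w u :=
  ⟨radialPart hK w, (isBackwardImage_iff hK).2 fun _ => rfl,
    fun _ hu => Subtype.ext (LinearMap.ext fun φ => (isBackwardImage_iff hK).1 hu φ)⟩

/-- A product of degree `2n` projects to a multiple of `l_n`, and the eigenvalues agree: `(ρ/4)(4n +
2) + c - ρ/2 = ρ n + c`. Products with an odd index project to zero. -/
theorem projMap_oscillatorOpMap (hK : K.Pos) (u : LagDual K) (ρ c : ℂ) (φ : HermTest K 2) :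
    u.1 (projMap hK (oscillatorOpMap hK (ρ / 4) (c - ρ / 2) φ))
      = u.1 (laguerreOpMap hK ρ c (projMap hK φ)) := by
  refine LinearMap.congr_fun
    (f := (radialDual hK u).1 ∘ₗ oscillatorOpMap hK (ρ / 4) (c - ρ / 2))
    (g := (u.1 ∘ₗ laguerreOpMap hK ρ c) ∘ₗ projMap hK)
    (HermDual.ext_basis hK ((radialDual hK u).2.comp_kerMap isSystem_hermite_two
      isSystem_hermite_two (isKernel_oscillatorEigen _ _) hK)
      (Scale.IsContinuous.comp_kerMap isSystem_hermite_two isSystem_laguerre isKernel_projKernel hK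
        (u.2.comp_kerMap isSystem_laguerre isSystem_laguerre (isKernel_laguerreEigen ρ c) hK))
      fun m => ?_) φ
  change u.1 (projMap hK (oscillatorOpMap hK _ _ (hermBasis K m)))
    = u.1 (laguerreOpMap hK ρ c (projMap hK (hermBasis K m)))
  rw [oscillatorOpMap_hermBasis, map_smul, projMap_hermBasis, map_smul (laguerreOpMap hK ρ c),
    laguerreOpMap_lagBasis, smul_comm, radialVec, Nat.add_sub_cancel_left]
  split_ifs with h
  · obtain ⟨⟨i, hi⟩, ⟨j, hj⟩⟩ := h
    have hdeg : multiDeg 2 m = 2 * (i + j) := by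
      simp only [multiDeg, Fin.sum_univ_two]; omega
    have hn : (m 0 + m 1) / 2 = i + j := by omega
    congr 3
    rw [oscillatorEigen, laguerreEigen, hdeg, hn]
    push_cast
    ring
  · simp

/-- The lift of `l_n` has pure degree `2n`, and `4ρ n + c + 2ρ = ρ(4n + 2) + c`. -/
theorem liftMap_laguerreOpMap (hK : K.Pos) (w : HermDual K 2) (ρ c : ℂ) (φ : LagTest K) :
    w.1 (liftMap hK (laguerreOpMap hK (4 * ρ) (c + 2 * ρ) φ))
      = w.1 (oscillatorOpMap hK ρ c (liftMap hK φ)) := by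
  refine LinearMap.congr_fun
    (f := (radialPart hK w).1 ∘ₗ laguerreOpMap hK (4 * ρ) (c + 2 * ρ))
    (g := (w.1 ∘ₗ oscillatorOpMap hK ρ c) ∘ₗ liftMap hK)
    (LagDual.ext_basis hK ((radialPart hK w).2.comp_kerMap isSystem_laguerre
      isSystem_laguerre (isKernel_laguerreEigen _ _) hK)
      (Scale.IsContinuous.comp_kerMap isSystem_laguerre isSystem_hermite_two isKernel_liftKernel hK
        (w.2.comp_kerMap isSystem_hermite_two isSystem_hermite_two
          (isKernel_oscillatorEigen ρ c) hK))
      fun n => ?_) φ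
  change w.1 (liftMap hK (laguerreOpMap hK _ _ (lagBasis K n)))
    = w.1 (oscillatorOpMap hK ρ c (liftMap hK (lagBasis K n)))
  rw [laguerreOpMap_lagBasis, map_smul, liftMap_lagBasis, map_sum, Finset.smul_sum]
  congr 1
  refine Finset.sum_congr rfl fun z hz => ?_
  have hz' := Finset.HasAntidiagonal.mem_antidiagonal.1 hz
  have hdeg : multiDeg 2 ![2 * z.1, 2 * z.2] = 2 * n := by
    simp only [multiDeg, Fin.sum_univ_two, Matrix.cons_val_zero, Matrix.cons_val_one]; omega
  rw [map_smul, oscillatorOpMap_hermBasis, smul_comm]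
  congr 2
  rw [oscillatorEigen, laguerreEigen, hdeg]
  push_cast
  ring

end Images

/-! ### The two Cauchy problems -/

section Cauchy

variable {S K : Scale} {ρ c : ℂ} {T : ℝ}

/-- Pairing `w(t)` with `φ` is pairing `u(t)` with the fixed test function `proj φ`, so the time
derivative is the same; the projection intertwines the two operators. -/
theorem solvesOscillator_of_solvesLaguerre (hS : S.Pos) (hK : K.Pos) (hT : 0 < T)
    {u : ℝ → LagDual S} {f : LagDual K}
    {w : ℝ → HermDual S 2} {g : HermDual K 2} (hu : SolvesLaguerre ρ c T u f)
    (huw : ∀ t ∈ Set.Icc 0 T, IsForwardImage (u t) (w t)) (hfg : IsForwardImage f g) :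
    SolvesOscillator (ρ / 4) (c - ρ / 2) T w g := by
  have hrel : ∀ t ∈ Set.Icc 0 T, ∀ φ, (w t).1 φ = (u t).1 (projMap hS φ) := fun t ht =>
    ((isForwardImage_iff hS).1 (huw t ht)).2
  refine ⟨fun t ht φ => ?_, fun φ hφS hφK => ?_⟩
  · obtain ⟨h, D, hD, hDu⟩ := hu.1 t ht (projMap hS φ)
    have e := oscillatorOpMap_coe hS (ρ / 4) (c - ρ / 2) φ
    refine ⟨e ▸ (oscillatorOpMap hS _ _ φ).2, D,
      hD.congr (fun s hs => hrel s hs φ) (hrel t ht φ), ?_⟩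
    rw [← hDu]
    congr 1
    have e1 : (⟨_, e ▸ (oscillatorOpMap hS (ρ / 4) (c - ρ / 2) φ).2⟩ : HermTest S 2)
        = oscillatorOpMap hS (ρ / 4) (c - ρ / 2) φ := Subtype.ext e.symm
    have e2 : (⟨_, h⟩ : LagTest S) = laguerreOpMap hS ρ c (projMap hS φ) :=
      Subtype.ext (laguerreOpMap_coe hS ρ c _).symm
    rw [e1, e2, hrel t ht, projMap_oscillatorOpMap]
  · rw [hrel 0 ⟨le_rfl, hT.le⟩, ((isForwardImage_iff hK).1 hfg).2]
    -- The projections of `φ` for the two types have the same underlying function, since the formula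
    -- of the kernel operator does not involve the type.
    exact hu.2 _ (projMap hS ⟨φ, hφS⟩).2 (projMap hK ⟨φ, hφK⟩).2

theorem solvesLaguerre_of_solvesOscillator (hS : S.Pos) (hK : K.Pos) (hT : 0 < T)
    {u : ℝ → LagDual S} {f : LagDual K}
    {w : ℝ → HermDual S 2} {g : HermDual K 2} (hw : SolvesOscillator ρ c T w g)
    (hwu : ∀ t ∈ Set.Icc 0 T, IsBackwardImage (w t) (u t)) (hgf : IsBackwardImage g f) :
    SolvesLaguerre (4 * ρ) (c + 2 * ρ) T u f := by
  have hrel : ∀ t ∈ Set.Icc 0 T, ∀ φ, (u t).1 φ = (w t).1 (liftMap hS φ) := fun t ht =>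
    (isBackwardImage_iff hS).1 (hwu t ht)
  refine ⟨fun t ht φ => ?_, fun φ hφS hφK => ?_⟩
  · obtain ⟨h, D, hD, hDw⟩ := hw.1 t ht (liftMap hS φ)
    have e := laguerreOpMap_coe hS (4 * ρ) (c + 2 * ρ) φ
    refine ⟨e ▸ (laguerreOpMap hS _ _ φ).2, D,
      hD.congr (fun s hs => hrel s hs φ) (hrel t ht φ), ?_⟩
    rw [← hDw]
    congr 1
    have e1 : (⟨_, e ▸ (laguerreOpMap hS (4 * ρ) (c + 2 * ρ) φ).2⟩ : LagTest S)
        = laguerreOpMap hS (4 * ρ) (c + 2 * ρ) φ := Subtype.ext e.symm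
    have e2 : (⟨_, h⟩ : HermTest S 2) = oscillatorOpMap hS ρ c (liftMap hS φ) :=
      Subtype.ext (oscillatorOpMap_coe hS ρ c _).symm
    rw [e1, e2, hrel t ht, liftMap_laguerreOpMap]
  · rw [hrel 0 ⟨le_rfl, hT.le⟩, (isBackwardImage_iff hK).1 hgf]
    exact hw.2 _ (liftMap hS ⟨φ, hφS⟩).2 (liftMap hK ⟨φ, hφK⟩).2

end Cauchy

end LaguerreHermite
end

/-! ### Assembly of the proposition -/

open LaguerreHermite

theorem proposition5p6 (α : ℝ) (hα : 0 < α) (ρ c : ℂ) (hρ : ρ ≠ 0) (T : ℝ) (hT : 0 < T)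
    (K : Scale)
    (hK : K = Scale.roumieu α ∨ K = Scale.beurling α)
    (S : Scale) (hS : S = K ∨ S = Scale.finite) :
    -- the two maps between ultradistributions are well defined
    ((∀ u : LagDual S,
        ∃! w : HermDual S 2, IsForwardImage u w) ∧
      (∀ f : LagDual K,
        ∃! g : HermDual K 2, IsForwardImage f g) ∧
      (∀ w : HermDual S 2,
        ∃! u : LagDual S, IsBackwardImage w u) ∧
      (∀ g : HermDual K 2,
        ∃! f : LagDual K, IsBackwardImage g f)) ∧
    -- from the Laguerre problem to the harmonic oscillator
    (∀ (u : ℝ → LagDual S) (f : LagDual K)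
        (w : ℝ → HermDual S 2) (g : HermDual K 2),
      SolvesLaguerre ρ c T u f →
      (∀ t ∈ Set.Icc 0 T, IsForwardImage (u t) (w t)) →
      IsForwardImage f g →
      SolvesOscillator (ρ / 4) (c - ρ / 2) T w g ∧ g.IsEven ∧
        ∀ t ∈ Set.Icc 0 T, (w t).IsEven) ∧
    -- from the harmonic oscillator to the Laguerre problem
    (∀ (w : ℝ → HermDual S 2) (g : HermDual K 2)
        (u : ℝ → LagDual S) (f : LagDual K),
      g.IsEven →
      SolvesOscillator ρ c T w g →
      (∀ t ∈ Set.Icc 0 T, IsBackwardImage (w t) (u t)) →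
      IsBackwardImage g f →
      SolvesLaguerre (4 * ρ) (c + 2 * ρ) T u f) := by

  have hKp : K.Pos := by rcases hK with rfl | rfl <;> exact hα
  have hSp : S.Pos := by
    rcases hS with rfl | rfl
    · exact hKp
    · trivial
  refine ⟨⟨existsUnique_isForwardImage hSp, existsUnique_isForwardImage hKp,
    existsUnique_isBackwardImage hSp, existsUnique_isBackwardImage hKp⟩, ?_, ?_⟩
  · intro u f w g hu huw hfg
    exact ⟨solvesOscillator_of_solvesLaguerre hSp hKp hT hu huw hfg, hfg.1.isEven,
      fun t ht => (huw t ht).1.isEven⟩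
  · intro w g u f _ hw hwu hgf
    exact solvesLaguerre_of_solvesOscillator hSp hKp hT hw hwu hgf
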